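/- Let $M$ be a smooth $n$-dimensional manifold with (possibly empty) boundary, $n\ge 1$, not necessarily compact. Let $m\in[0,\infty)$, let $g_0$ be a smooth Riemannian metric on $M$ and let $\phi_0\in C^\infty(M)$, with $\phi_0=0$ if $m=0$. For a metric $g$ and a function $\phi$ put $$R_\phi^m=R_g+2\Delta_g\phi-\tfrac{m+1}{m}|\nabla\phi|_g^2 \ \text{ in } M,\qquad H_\phi^m=H_g+\frac{\partial\phi}{\partial\nu_g}\ \text{ on }\partial M,$$ where $R_g$ is the scalar curvature, $\nu_g$ the outward unit normal, and $H_g$ the mean curvature of $\partial M$ (the trace of its second fundamental form); for $m=0$, where $\phi=0$, $R^m_\phi$ means $R_g$. Let $\lambda\in\mathbb R$ and let $X$ be a smooth complete vector field on $M$ (through every point there is an integral curve defined for all times) such that $$(\lambda-R_{\phi_0}^m)g_0=\mathcal L_Xg_0,\qquad \mathcal L_X\phi_0=\tfrac m2\,(R_{\phi_0}^m-\lambda)\quad\text{in }M,\qquad H_{\phi_0}^m=0,\quad X\perp\nu_{g_0}\quad\text{on }\partial M.$$ Put $\sigma(t)=1-\lambda t$. Then there exist, for all $t\in\mathbb R$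 with $\sigma(t)>0$, smooth Riemannian metrics $g(t)$ and smooth functions $\phi(t)$ on $M$ (with $\phi(t)=0$ if $m=0$), diffeomorphisms $\psi_t:M\to M$ depending smoothly on $(t,x)$, and vector fields $X(t)$, with $g(0)=g_0$, $\phi(0)=\phi_0$, $\psi_0=\mathrm{id}_M$, $X(0)=X$, such that $(g(t),\phi(t))$ solves the unnormalized weighted Yamabe flow with boundary $$\frac{\partial}{\partial t}g(t)=-R_{\phi(t)}^m\,g(t),\qquad \frac{\partial}{\partial t}\phi(t)=\frac m2R_{\phi(t)}^m\quad\text{in }M,\qquad H_{\phi(t)}^m=0\quad\text{on }\partial M$$ for all $t$ with $\sigma(t)>0$, and for all such $t$: (i) $X(t)=\frac1{\sigma(t)}X$, and $\psi_t$ is generated by $X(t)$, that is, $\frac{\partial}{\partial t}\psi_t(p)=X(t)(\psi_t(p))$ for all $p\in M$; (ii) $g(t)=\sigma(t)\,\psi_t^*g_0$ and $\phi(t)=\psi_t^*\phi_0-\frac m2\log\sigma(t)$; (iii) $X(t)$ is, up to the scale factor $\frac1{\sigma(t)}$, the pullback of $X$ by $\psi_t$: $X(t)=\frac1{\sigma(t)}\psi_t^*X$.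 -/

import Mathlib

open Set Manifold Bundle
open scoped ContDiff

noncomputable section

namespace WeightedYamabe

/-! ### Calculus of a metric in one chart

`G` is a metric written in a coordinate chart, i.e. a function on `ℝⁿ` with values in bilinear
forms, `S` is the domain of the coordinates (a half-space, so derivatives are taken within `S`), and
vectors of `ℝⁿ` are regarded as constant vector fields in the coordinates. -/

/-- The coordinate space `ℝⁿ`. -/
abbrev Coord (n : ℕ) : Type := EuclideanSpace ℝ (Fin n)

section Local

variable {n : ℕ}

/-- The `i`-th coordinate vector. -/
def coordVec (i : Fin n) : Coord n := EuclideanSpace.single i (1 : ℝ)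

/-- The Christoffel symbols `Γ(u,v) = ∇_u v` of the Levi-Civita connection:
`G(Γ(u,v), w) = ½ (∂_u G(v,w) + ∂_v G(u,w) - ∂_w G(u,v))` for all `w`. -/
def christoffel (S : Set (Coord n)) (G : Coord n → Coord n →L[ℝ] Coord n →L[ℝ] ℝ)
    (z u v : Coord n) : Coord n :=
  (G z).inverse ((1 / 2 : ℝ) • (fderivWithin ℝ G S z u v + fderivWithin ℝ G S z v u
    - ((fderivWithin ℝ G S z).flip u).flip v))

/-- The curvature `R(u,v)w = ∇_u ∇_v w - ∇_v ∇_u w`. -/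
def riemann (S : Set (Coord n)) (G : Coord n → Coord n →L[ℝ] Coord n →L[ℝ] ℝ)
    (z u v w : Coord n) : Coord n :=
  fderivWithin ℝ (fun z' => christoffel S G z' v w) S z u
    - fderivWithin ℝ (fun z' => christoffel S G z' u w) S z v
    + christoffel S G z u (christoffel S G z v w)
    - christoffel S G z v (christoffel S G z u w)

/-- The Ricci curvature, the trace of `u ↦ R(u,v)w`. -/
def ricci (S : Set (Coord n)) (G : Coord n → Coord n →L[ℝ] Coord n →L[ℝ] ℝ)
    (z v w : Coord n) : ℝ :=
  ∑ i : Fin n, riemann S G z (coordVec i) v w i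

/-- The Hessian `∇²f(u,v) = ∂_u ∂_v f - df(Γ(u,v))`. -/
def hessian (S : Set (Coord n)) (G : Coord n → Coord n →L[ℝ] Coord n →L[ℝ] ℝ)
    (f : Coord n → ℝ) (z u v : Coord n) : ℝ :=
  fderivWithin ℝ (fun z' => fderivWithin ℝ f S z' v) S z u
    - fderivWithin ℝ f S z (christoffel S G z u v)

/-- The trace of a bilinear form `B` with respect to an inner product `g`, on the span of the
linearly independent family `b`: the sum of `gⁱʲ B(bᵢ,bⱼ)`, where `(gⁱʲ)` is the inverse of the
matrix `(g(bᵢ,bⱼ))`. -/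
def metricTrace {ι : Type} [Fintype ι] [DecidableEq ι] (g : Coord n →L[ℝ] Coord n →L[ℝ] ℝ)
    (b : ι → Coord n) (B : Coord n → Coord n → ℝ) : ℝ :=
  ∑ i, ∑ j, (Matrix.of fun k l => g (b k) (b l))⁻¹ i j * B (b i) (b j)

end Local

/-! ### Geometry of a Riemannian manifold with boundary -/

variable {n : ℕ} [NeZero n] {M : Type*} [TopologicalSpace M]
  [ChartedSpace (EuclideanHalfSpace n) M] [IsManifold (𝓡∂ n) ∞ M]

/-- Smooth Riemannian metrics on `M`. -/
abbrev Metric (n : ℕ) [NeZero n] (M : Type*) [TopologicalSpace M]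
    [ChartedSpace (EuclideanHalfSpace n) M] [IsManifold (𝓡∂ n) ∞ M] : Type _ :=
  ContMDiffRiemannianMetric (𝓡∂ n) ∞ (Coord n) (fun p : M => TangentSpace (𝓡∂ n) p)

/-- The metric `g` in the preferred chart at `p`, a function of the coordinates `z`: the inner
product `B` on the tangent space at the point `q` with coordinates `z`, pulled back along the
derivative `D : ℝⁿ → T_qM` of the inverse chart (Mathlib's type of tangent vectors is `ℝⁿ`). -/
def chartMetric (g : Metric n M) (p : M) (z : Coord n) : Coord n →L[ℝ] Coord n →L[ℝ] ℝ :=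
  let q : M := (extChartAt (𝓡∂ n) p).symm z
  let B : Coord n →L[ℝ] Coord n →L[ℝ] ℝ := g.inner q
  let D : Coord n →L[ℝ] Coord n :=
    mfderivWithin 𝓘(ℝ, Coord n) (𝓡∂ n) (extChartAt (𝓡∂ n) p).symm (range (𝓡∂ n)) z
  B.bilinearComp D D

/-- The function `f` in the preferred chart at `p`. -/
def chartFun (f : M → ℝ) (p : M) (z : Coord n) : ℝ := f ((extChartAt (𝓡∂ n) p).symm z)

/-- The vector field `X` in the preferred chart at `p`. -/
def chartField (X : ∀ p : M, TangentSpace (𝓡∂ n) p) (p : M) (z : Coord n) : Coord n :=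
  VectorField.mpullbackWithin 𝓘(ℝ, Coord n) (𝓡∂ n) (extChartAt (𝓡∂ n) p).symm X
    (range (𝓡∂ n)) z

/-- The scalar curvature `R_g`. -/
def scalarCurvature (g : Metric n M) (p : M) : ℝ :=
  metricTrace (chartMetric g p (extChartAt (𝓡∂ n) p p)) coordVec
    (ricci (range (𝓡∂ n)) (chartMetric g p) (extChartAt (𝓡∂ n) p p))

/-- The Laplacian `Δ_g f`, the trace of the Hessian. -/
def laplacian (g : Metric n M) (f : M → ℝ) (p : M) : ℝ :=
  metricTrace (chartMetric g p (extChartAt (𝓡∂ n) p p)) coordVec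
    (hessian (range (𝓡∂ n)) (chartMetric g p) (chartFun f p) (extChartAt (𝓡∂ n) p p))

/-- `|∇f|_g²`, the trace of `df ⊗ df`. -/
def gradNormSq (g : Metric n M) (f : M → ℝ) (p : M) : ℝ :=
  metricTrace (chartMetric g p (extChartAt (𝓡∂ n) p p)) coordVec
    (fun u v => fderivWithin ℝ (chartFun f p) (range (𝓡∂ n)) (extChartAt (𝓡∂ n) p p) u *
      fderivWithin ℝ (chartFun f p) (range (𝓡∂ n)) (extChartAt (𝓡∂ n) p p) v)

/-- The outward unit normal `ν_g` at a boundary point `p`. Mathlib identifies `T_pM` with `ℝⁿ`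
through the preferred chart at `p`, in which `M` is the half-space `x₀ ≥ 0`. So `T_p∂M` is the
kernel of `dx₀`, outward vectors are those with `dx₀ < 0`, and `ν_g = - ∇x₀ / |∇x₀|`. -/
def outwardNormal (g : Metric n M) (p : M) : TangentSpace (𝓡∂ n) p :=
  let dx : Coord n →L[ℝ] ℝ := EuclideanSpace.proj 0
  let grad : Coord n := (chartMetric g p (extChartAt (𝓡∂ n) p p)).inverse dx
  let c : ℝ := -(Real.sqrt (dx grad))⁻¹
  c • grad

/-- The mean curvature `H_g` of the boundary at a boundary point `p`: the trace over `T_p∂M` of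
the second fundamental form `(u,v) ↦ g(∇_u ν_g, v) = -g(ν_g, ∇_u v)`. The coordinate vectors other
than the zeroth form a basis of `T_p∂M`. For a round ball it is positive. -/
def meanCurvature (g : Metric n M) (p : M) : ℝ :=
  let z : Coord n := extChartAt (𝓡∂ n) p p
  metricTrace (chartMetric g p z) (fun i : {i : Fin n // i ≠ 0} => coordVec i.1)
    (fun u v => -(chartMetric g p z (outwardNormal g p)
      (christoffel (range (𝓡∂ n)) (chartMetric g p) z u v)))

/-- The Lie derivative `L_X g` at `p`: in coordinates,
`(L_X g)(u,v) = ∂_X G(u,v) + G(∂_u X, v) + G(u, ∂_v X)`. -/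
def lieDerivMetric (X : ∀ p : M, TangentSpace (𝓡∂ n) p) (g : Metric n M) (p : M)
    (u v : TangentSpace (𝓡∂ n) p) : ℝ :=
  let z : Coord n := extChartAt (𝓡∂ n) p p
  fderivWithin ℝ (chartMetric g p) (range (𝓡∂ n)) z (chartField X p z) u v
    + chartMetric g p z (fderivWithin ℝ (chartField X p) (range (𝓡∂ n)) z u) v
    + chartMetric g p z u (fderivWithin ℝ (chartField X p) (range (𝓡∂ n)) z v)

/-- The derivative `df(X)` of a function `f` along `X`, which is the Lie derivative `L_X f`. -/
def lieDerivFun (X : ∀ p : M, TangentSpace (𝓡∂ n) p) (f : M → ℝ) (p : M) : ℝ :=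
  mfderiv (𝓡∂ n) 𝓘(ℝ, ℝ) f p (X p)

/-- A vector field is complete if through every point there is an integral curve defined for
all times. -/
def IsCompleteField (X : ∀ p : M, TangentSpace (𝓡∂ n) p) : Prop :=
  ∀ p : M, ∃ γ : ℝ → M, γ 0 = p ∧ IsMIntegralCurve (I := 𝓡∂ n) γ X

/-! ### Smooth metric measure spaces, solitons, and the flow -/

/-- A smooth metric measure space with boundary `(M, g, e^{-φ}dV_g, e^{-φ}dA_g, m)`. The two
measures are determined by `g` and `φ`. -/
structure SmoothMetricMeasureSpace (n : ℕ) [NeZero n] (m : ℝ) (M : Type*) [TopologicalSpace M]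
    [ChartedSpace (EuclideanHalfSpace n) M] [IsManifold (𝓡∂ n) ∞ M] where
  g : Metric n M
  φ : M → ℝ
  contMDiff_φ : ContMDiff (𝓡∂ n) 𝓘(ℝ, ℝ) ∞ φ
  dim_nonneg : 0 ≤ m
  φ_eq_zero : m = 0 → φ = 0

namespace SmoothMetricMeasureSpace

variable {m : ℝ}

/-- The weighted scalar curvature `R_φ^m = R_g + 2 Δ_g φ - (m+1)/m |∇φ|²`. For `m = 0`, where
`φ = 0`, this is `R_g`. -/
def scalarCurv (A : SmoothMetricMeasureSpace n m M) (p : M) : ℝ :=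
  scalarCurvature A.g p + 2 * laplacian A.g A.φ p - (m + 1) / m * gradNormSq A.g A.φ p

/-- The weighted mean curvature `H_φ^m = H_g + ∂φ/∂ν_g` at a boundary point. -/
def meanCurv (A : SmoothMetricMeasureSpace n m M) (p : M) : ℝ :=
  meanCurvature A.g p + lieDerivFun (outwardNormal A.g) A.φ p

/-- The equations of a weighted Yamabe soliton with boundary `(M, g₀, X, φ₀, λ)`. -/
structure IsYamabeSoliton (A : SmoothMetricMeasureSpace n m M)
    (X : ∀ p : M, TangentSpace (𝓡∂ n) p) (lam : ℝ) : Prop where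
  metric_eq : ∀ (p : M) (u v : TangentSpace (𝓡∂ n) p),
    (lam - A.scalarCurv p) * A.g.inner p u v = lieDerivMetric X A.g p u v
  φ_eq : ∀ p : M, lieDerivFun X A.φ p = m / 2 * (A.scalarCurv p - lam)
  meanCurv_eq : ∀ p ∈ (𝓡∂ n).boundary M, A.meanCurv p = 0
  perp : ∀ p ∈ (𝓡∂ n).boundary M, A.g.inner p (X p) (outwardNormal A.g p) = 0

/-- The family `(g(t), φ(t))` solves the unnormalized weighted Yamabe flow with boundary at all
times of the open set `J`. -/
structure IsYamabeFlow (A : ℝ → SmoothMetricMeasureSpace n m M) (J : Set ℝ) : Prop where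
  metric_eq : ∀ t ∈ J, ∀ (p : M) (u v : TangentSpace (𝓡∂ n) p),
    HasDerivAt (fun s => (A s).g.inner p u v) (-(A t).scalarCurv p * (A t).g.inner p u v) t
  φ_eq : ∀ t ∈ J, ∀ p : M, HasDerivAt (fun s => (A s).φ p) (m / 2 * (A t).scalarCurv p) t
  meanCurv_eq : ∀ t ∈ J, ∀ p ∈ (𝓡∂ n).boundary M, (A t).meanCurv p = 0

end SmoothMetricMeasureSpace

end WeightedYamabe

end

/-! The solution is self-similar: it moves the initial data by the flow of `X`, reparametrised in
time, and rescales. Let θ be the flow of `X` and let τ = `solitonTime` be the primitive of 1/σ with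
τ(0) = 0. With ψ_t = θ_{τ(t)}, the chain rule gives ∂_t ψ_t = σ⁻¹ X(ψ_t). Put g(t) = σ ψ_t^*g₀ and
φ(t) = ψ_t^*φ₀ - (m/2) log σ.

Two facts turn the soliton equations into the flow equations. First, naturality and scaling: under
the passage to (c ψ^*g, ψ^*φ - const) each of the three terms of the weighted scalar curvature
becomes c⁻¹ times its value at ψ(p), and both terms of the weighted mean curvature acquire c^(-1/2)
at boundary points (`scalarCurv_pullback`, `meanCurv_pullback`). Hence R(t) = σ⁻¹ R∘ψ_t and the
boundary condition persists. Second, d/ds θ_s^*g₀ = θ_s^*(L_X g₀), and likewise for functions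
(`hasDerivAt_metric_flow`, `hasDerivAt_fun_flow`). Therefore ∂_t g = -λ ψ_t^*g₀ + σ · σ⁻¹ ψ_t^*(L_X
g₀) = -(R∘ψ_t) ψ_t^*g₀ = -R(t) g(t), and the same substitution gives ∂_t φ = (m/2) R(t): the terms
in λ cancel against σ' = -λ and against the derivative of log σ. Assertion (iii) holds because a
field is invariant under its own flow (`IsFlow.mfderiv_apply`).

Completeness only provides one integral curve through each point, on a manifold with boundary. So
uniqueness of integral curves, the group law and joint smoothness of θ are proved up to the
boundary: locally by Grönwall estimates and the variational equation inside a closed convex set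
(`contDiffWithinAt_flow`), then globally by the group law (`IsFlow.contMDiff`). Naturality of
curvature is computed in charts from the transformation law of the Christoffel symbols
(`christoffel_eq`, `riemannCLM_eq`); at the boundary it also uses that diffeomorphisms preserve the
boundary, hence the normal direction up to scale. -/

noncomputable section

open Filter Topology Metric

/-! ### Smooth dependence of local flows in a closed convex set -/

namespace LocalFlow

variable {E : Type*} [NormedAddCommGroup E] [NormedSpace ℝ E]

/-- Two-sided Grönwall inequality around `0`. -/
theorem norm_le_gronwallBound_abs {f f' : ℝ → E} {K c ε δ : ℝ}
    (hf : ∀ t, |t| < ε → HasDerivAt f (f' t) t) (h0 : ‖f 0‖ ≤ δ)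
    (hb : ∀ t, |t| < ε → ‖f' t‖ ≤ K * ‖f t‖ + c) {t : ℝ} (ht : |t| < ε) :
    ‖f t‖ ≤ gronwallBound δ K c |t| := by
  rcases le_total 0 t with h | h
  · have key : ∀ s ∈ Icc (0 : ℝ) t, |s| < ε := fun s hs => by
      rw [abs_of_nonneg hs.1]; rw [abs_of_nonneg h] at ht; linarith [hs.2]
    have := norm_le_gronwallBound_of_norm_deriv_right_le (f := f) (f' := f') (δ := δ) (K := K)
      (ε := c) (a := 0) (b := t)
      (fun s hs => (hf s (key s hs)).continuousAt.continuousWithinAt)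
      (fun s hs => (hf s (key s ⟨hs.1, hs.2.le⟩)).hasDerivWithinAt) h0
      (fun s hs => hb s (key s ⟨hs.1, hs.2.le⟩)) t ⟨h, le_rfl⟩
    rw [sub_zero] at this; rwa [abs_of_nonneg h]
  · have key : ∀ s ∈ Icc (0 : ℝ) (-t), |-s| < ε := fun s hs => by
      rw [abs_neg, abs_of_nonneg hs.1]; rw [abs_of_nonpos h] at ht; linarith [hs.2]
    have hd : ∀ s ∈ Icc (0 : ℝ) (-t), HasDerivAt (fun s => f (-s)) (-f' (-s)) s := fun s hs => by
      simpa [Function.comp_def] using (hf (-s) (key s hs)).scomp s (hasDerivAt_neg s)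
    have := norm_le_gronwallBound_of_norm_deriv_right_le (f := fun s => f (-s))
      (f' := fun s => -f' (-s)) (δ := δ) (K := K) (ε := c) (a := 0) (b := -t)
      (fun s hs => (hd s hs).continuousAt.continuousWithinAt)
      (fun s hs => (hd s ⟨hs.1, hs.2.le⟩).hasDerivWithinAt) (by simpa using h0)
      (fun s hs => by simpa using hb (-s) (key s ⟨hs.1, hs.2.le⟩)) (-t) ⟨by linarith, le_rfl⟩
    simpa [abs_of_nonpos h] using this

/-- The fundamental solution of a linear equation, on a short time interval. -/
theorem exists_fundamentalSolution [CompleteSpace E] {a : ℝ → E →L[ℝ] E} {ε L : ℝ}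
    (hL : 0 ≤ L) (hε : 0 < ε) (ha : ∀ t, |t| ≤ ε → ContinuousWithinAt a (Icc (-ε) ε) t)
    (hb : ∀ t, |t| ≤ ε → ‖a t‖ ≤ L) (hLε : L * 2 * ε ≤ 1) :
    ∃ W : ℝ → E →L[ℝ] E, W 0 = 1 ∧ (∀ t, |t| < ε → HasDerivAt W (a t ∘L W t) t) ∧
      ∀ t, |t| < ε → ‖W t - 1‖ ≤ gronwallBound 0 L L |t| := by
  have h1 : ‖(1 : E →L[ℝ] E)‖ ≤ 1 := ContinuousLinearMap.norm_id_le
  -- In the ball of radius 1 around the identity ‖W‖ ≤ 2, so the right-hand side is bounded by 2L.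
  -- `hLε` says that the solution cannot leave this ball within time ε.
  have hpl : IsPicardLindelof (fun t W => a t ∘L W) (tmin := -ε) (tmax := ε)
      ⟨0, by constructor <;> linarith⟩ (1 : E →L[ℝ] E) 1 0 (⟨L, hL⟩ * 2) ⟨L, hL⟩ := by
    constructor
    · intro t ht
      refine LipschitzOnWith.of_dist_le_mul fun x _ y _ => ?_
      rw [dist_eq_norm, dist_eq_norm, ← ContinuousLinearMap.comp_sub]
      exact (ContinuousLinearMap.opNorm_comp_le _ _).trans
        (mul_le_mul_of_nonneg_right (hb t (abs_le.2 ht)) (norm_nonneg _))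
    · intro x _ t ht
      exact (ha t (abs_le.2 ht)).clm_comp continuousWithinAt_const
    · intro t ht x hx
      refine (ContinuousLinearMap.opNorm_comp_le _ _).trans ?_
      have : ‖x‖ ≤ 2 := by
        have h2 : ‖x - 1‖ ≤ 1 := by simpa [dist_eq_norm] using hx
        calc ‖x‖ = ‖(x - 1) + 1‖ := by simp
          _ ≤ 2 := (norm_add_le _ _).trans (by linarith)
      exact mul_le_mul (hb t (abs_le.2 ht)) this (norm_nonneg _) hL
    · have : ((⟨L, hL⟩ * 2 : NNReal) : ℝ) = L * 2 := rfl
      simpa [this] using hLε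
  obtain ⟨W, hW0, hW⟩ := hpl.exists_eq_forall_mem_Icc_hasDerivWithinAt₀
  have hd : ∀ t, |t| < ε → HasDerivAt W (a t ∘L W t) t := fun t ht =>
    (hW t (abs_le.1 ht.le)).hasDerivAt (Icc_mem_nhds (abs_lt.1 ht).1 (abs_lt.1 ht).2)
  refine ⟨W, hW0, hd, fun t ht => ?_⟩
  refine norm_le_gronwallBound_abs (f := fun t => W t - 1) (fun s hs => (hd s hs).sub_const 1)
    (by simp [show W 0 = 1 from hW0]) (fun s hs => ?_) ht
  -- `W - 1` starts at 0 and solves the same equation with forcing `a`. The resulting bound depends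
  -- only on L, hence is uniform over all trajectories.
  have : a s ∘L W s = a s ∘L (W s - 1) + a s := by
    rw [ContinuousLinearMap.comp_sub]; ext; simp
  rw [this]
  refine (norm_add_le _ _).trans (add_le_add ?_ (hb s hs.le))
  exact (ContinuousLinearMap.opNorm_comp_le _ _).trans
    (mul_le_mul_of_nonneg_right (hb s hs.le) (norm_nonneg _))

/-- Differentiability of a local flow with respect to time and initial value, with the derivative
given by the variational equation. -/
theorem exists_hasFDerivWithinAt [CompleteSpace E] {C U : Set E} {F : E → E}
    {A : E → E →L[ℝ] E} {φ : ℝ × E → E} {ε L : ℝ} (hC : Convex ℝ C) (hL : 0 ≤ L) (hε : 0 < ε)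
    (hF : ∀ z ∈ C, HasFDerivWithinAt F (A z) C z) (hA : ∀ z ∈ C, ‖A z‖ ≤ L)
    (hAu : UniformContinuousOn A C)
    (hφC : ∀ t, |t| ≤ ε → ∀ x ∈ U, φ (t, x) ∈ C)
    (hφ : ∀ t, |t| ≤ ε → ∀ x ∈ U, HasDerivAt (fun s => φ (s, x)) (F (φ (t, x))) t)
    (hφ0 : ∀ x ∈ U, φ (0, x) = x) (hLε : L * 2 * ε ≤ 1) :
    ∃ W : ℝ × E → E →L[ℝ] E, ∀ t, |t| < ε → ∀ x ∈ U, W (0, x) = 1 ∧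
      HasDerivAt (fun s => W (s, x)) (A (φ (t, x)) ∘L W (t, x)) t ∧
      ContinuousWithinAt W (Ioo (-ε) ε ×ˢ U) (t, x) ∧
      HasFDerivWithinAt φ ((ContinuousLinearMap.fst ℝ ℝ E).smulRight (F (φ (t, x))) +
        W (t, x) ∘L ContinuousLinearMap.snd ℝ ℝ E) (Ioo (-ε) ε ×ˢ U) (t, x) := by
  have hcont : ∀ t, |t| ≤ ε → ∀ x ∈ U, ContinuousAt (fun s => φ (s, x)) t :=
    fun t ht x hx => (hφ t ht x hx).continuousAt
  have hAφ : ∀ x ∈ U, ∀ t, |t| ≤ ε →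
      ContinuousWithinAt (fun s => A (φ (s, x))) (Icc (-ε) ε) t := fun x hx t ht =>
    ContinuousWithinAt.comp (f := fun s => φ (s, x)) (t := C)
      (hAu.continuousOn _ (hφC t ht x hx)) (hcont t ht x hx).continuousWithinAt
      (fun s hs => hφC s (abs_le.2 hs) x hx)
  have hW : ∀ x : E, ∃ W : ℝ → E →L[ℝ] E, x ∈ U → W 0 = 1 ∧
      (∀ t, |t| < ε → HasDerivAt W (A (φ (t, x)) ∘L W t) t) ∧
      ∀ t, |t| < ε → ‖W t - 1‖ ≤ gronwallBound 0 L L |t| := by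
    intro x
    by_cases hx : x ∈ U
    · obtain ⟨W, h⟩ := exists_fundamentalSolution (a := fun s => A (φ (s, x))) hL hε (hAφ x hx)
        (fun t ht => hA _ (hφC t ht x hx)) hLε
      exact ⟨W, fun _ => h⟩
    · exact ⟨0, fun h => absurd h hx⟩
  choose W hW using hW
  have hlip : ∀ y ∈ C, ∀ z ∈ C, ‖F z - F y‖ ≤ L * ‖z - y‖ := fun y hy z hz =>
    hC.norm_image_sub_le_of_norm_hasFDerivWithin_le hF hA hy hz
  set B := Real.exp (L * ε) with hB
  have hB0 : 0 < B := Real.exp_pos _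
  have hφlip : ∀ t, |t| < ε → ∀ x ∈ U, ∀ y ∈ U, ‖φ (t, y) - φ (t, x)‖ ≤ B * ‖y - x‖ := by
    intro t ht x hx y hy
    refine (norm_le_gronwallBound_abs (f := fun s => φ (s, y) - φ (s, x)) (K := L) (c := 0)
      (δ := ‖y - x‖)
      (fun s hs => (hφ s hs.le y hy).sub (hφ s hs.le x hx)) (by simp [hφ0 y hy, hφ0 x hx])
      (fun s hs => ?_) ht).trans ?_
    · simpa using hlip _ (hφC s hs.le x hx) _ (hφC s hs.le y hy)
    · rw [gronwallBound_ε0, mul_comm]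
      rw [hB]
      gcongr
  -- A first-order expansion in the initial value, uniform in `t` and `x`. The error solves the
  -- variational equation with forcing F(q) - F(p) - A(p)(q - p), where p and q are the two
  -- positions; uniform continuity of A makes this small compared with ‖q - p‖ ≤ B‖y - x‖.
  have hsmall : ∀ η > 0, ∃ δ > 0, ∀ t, |t| < ε → ∀ x ∈ U, ∀ y ∈ U, ‖y - x‖ < δ →
      ‖φ (t, y) - φ (t, x) - W x t (y - x)‖ ≤ η * ‖y - x‖ := by
    intro η hη
    set G := gronwallBound 0 L B ε with hG
    have hG0 : 0 ≤ G := by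
      have := gronwallBound_mono (le_refl (0 : ℝ)) hB0.le hL hε.le
      rwa [gronwallBound_x0] at this
    -- With zero initial value the Grönwall bound is linear in the forcing, so κ = η / (G + 1)
    -- yields a total error of at most η‖y - x‖.
    have hhom : ∀ c : ℝ, gronwallBound 0 L (c * B) ε = c * G := by
      intro c
      rw [hG]
      by_cases hK : L = 0
      · rw [hK, gronwallBound_K0, gronwallBound_K0]; ring
      · rw [gronwallBound_of_K_ne_0 hK, gronwallBound_of_K_ne_0 hK]; ring
    set κ := η / (G + 1) with hκ
    have hκ0 : 0 < κ := by positivity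
    obtain ⟨δ, hδ, hAδ⟩ := Metric.uniformContinuousOn_iff.1 hAu κ hκ0
    refine ⟨δ / B, by positivity, fun t ht x hx y hy hxy => ?_⟩
    have hfb : ∀ s, |s| < ε → ‖φ (s, y) - φ (s, x)‖ < δ := fun s hs =>
      (hφlip s hs x hx y hy).trans_lt (by rwa [lt_div_iff₀ hB0, mul_comm] at hxy)
    refine (norm_le_gronwallBound_abs (f := fun s => φ (s, y) - φ (s, x) - W x s (y - x)) (K := L)
      (c := κ * ‖y - x‖ * B) (δ := 0) (f' := fun s => F (φ (s, y)) - F (φ (s, x)) -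
        (A (φ (s, x)) ∘L W x s) (y - x))
      (fun s hs => ((hφ s hs.le y hy).sub (hφ s hs.le x hx)).sub ?_)
      (by simp [hφ0 y hy, hφ0 x hx, (hW x hx).1])
      (fun s hs => ?_) ht).trans ?_
    · exact ((hW x hx).2.1 s hs).clm_apply (hasDerivAt_const s (y - x)) |>.congr_deriv (by simp)
    · set p := φ (s, x) with hp
      set q := φ (s, y) with hq
      have hpC : p ∈ C := hφC s hs.le x hx
      have hqC : q ∈ C := hφC s hs.le y hy
      -- Mean value inequality on the convex set `C ∩ ball p δ`, where A differs from `A p` by at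
      -- most κ.
      have hm : ‖F q - F p - A p (q - p)‖ ≤ κ * ‖q - p‖ := by
        refine (hC.inter (convex_ball p δ)).norm_image_sub_le_of_norm_hasFDerivWithin_le'
          (f' := A) (fun z hz => (hF z hz.1).mono inter_subset_left) (fun z hz => ?_)
          ⟨hpC, mem_ball_self hδ⟩ ⟨hqC, ?_⟩
        · rw [← dist_eq_norm]
          exact (hAδ z hz.1 p hpC hz.2).le
        · rw [mem_ball, dist_eq_norm]; exact hfb s hs
      have he : F q - F p - (A p ∘L W x s) (y - x) =
          A p (q - p - W x s (y - x)) + (F q - F p - A p (q - p)) := by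
        simp only [map_sub, ContinuousLinearMap.comp_apply]; abel
      rw [he]
      refine (norm_add_le _ _).trans (add_le_add ((A p).le_of_opNorm_le (hA p hpC) _)
        (hm.trans ?_))
      rw [mul_assoc, mul_comm ‖y - x‖]
      exact mul_le_mul_of_nonneg_left (hφlip s hs x hx y hy) hκ0.le
    · refine (gronwallBound_mono le_rfl (by positivity) hL ht.le).trans ?_
      rw [hhom]
      have : κ * G ≤ η := by
        rw [hκ, div_mul_eq_mul_div, div_le_iff₀ (by positivity)]
        nlinarith
      nlinarith [norm_nonneg (y - x)]
  refine ⟨fun p => W p.2 p.1, fun t ht x hx => ⟨(hW x hx).1, (hW x hx).2.1 t ht,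
    ?_, ?_⟩⟩
  -- Continuity of W in the initial value is again Grönwall: the difference of two fundamental
  -- solutions is forced by (A q - A p) W, which is at most κ(G + 1). Continuity in time along a
  -- fixed trajectory follows from the equation.
  · refine Metric.continuousWithinAt_iff.2 fun c hc => ?_
    set G := gronwallBound 0 L L ε with hG
    have hWb : ∀ s, |s| < ε → ‖W x s‖ ≤ G + 1 := fun s hs => by
      have h1 : ‖(1 : E →L[ℝ] E)‖ ≤ 1 := ContinuousLinearMap.norm_id_le
      have h2 := ((hW x hx).2.2 s hs).trans (gronwallBound_mono le_rfl hL hL hs.le)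
      calc ‖W x s‖ = ‖(W x s - 1) + 1‖ := by simp
        _ ≤ G + 1 := (norm_add_le _ _).trans (add_le_add h2 h1)
    have hG0 : 0 ≤ G + 1 := (norm_nonneg _).trans (hWb t ht)
    have hlim : Tendsto (fun κ => gronwallBound 0 L (κ * (G + 1)) ε) (𝓝 0) (𝓝 0) := by
      have := ((gronwallBound_continuous_ε 0 L ε).comp
        (continuous_mul_const (G + 1))).tendsto 0
      simpa [Function.comp_def, gronwallBound_ε0_δ0] using this
    obtain ⟨κ, hκ, hκ0⟩ : ∃ κ, gronwallBound 0 L (κ * (G + 1)) ε < c / 2 ∧ 0 < κ :=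
      (((hlim.eventually_lt_const (half_pos hc)).filter_mono nhdsWithin_le_nhds).and
        (self_mem_nhdsWithin (s := Ioi (0 : ℝ)))).exists
    obtain ⟨δ, hδ, hAδ⟩ := Metric.uniformContinuousOn_iff.1 hAu κ hκ0
    obtain ⟨δ₂, hδ₂, h2⟩ := Metric.continuousAt_iff.1 ((hW x hx).2.1 t ht).continuousAt (c / 2)
      (half_pos hc)
    refine ⟨min (δ / B) δ₂, by positivity, ?_⟩
    rintro ⟨s, y⟩ ⟨hs', hy⟩ hd
    have hs : |s| < ε := abs_lt.2 hs'
    rw [Prod.dist_eq, max_lt_iff, lt_min_iff, lt_min_iff] at hd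
    have hxy : ‖y - x‖ < δ / B := by rw [← dist_eq_norm]; exact hd.2.1
    have hfb : ∀ r, |r| < ε → ‖φ (r, y) - φ (r, x)‖ < δ := fun r hr =>
      (hφlip r hr x hx y hy).trans_lt (by rwa [lt_div_iff₀ hB0, mul_comm] at hxy)
    have e1 : ‖W y s - W x s‖ ≤ gronwallBound 0 L (κ * (G + 1)) |s| := by
      refine norm_le_gronwallBound_abs (f := fun r => W y r - W x r)
        (fun r hr => ((hW y hy).2.1 r hr).sub ((hW x hx).2.1 r hr))
        (by simp [(hW y hy).1, (hW x hx).1]) (fun r hr => ?_) hs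
      set p := φ (r, x) with hp
      set q := φ (r, y) with hq
      have hpC : p ∈ C := hφC r hr.le x hx
      have hqC : q ∈ C := hφC r hr.le y hy
      have he : A q ∘L W y r - A p ∘L W x r = A q ∘L (W y r - W x r) + (A q - A p) ∘L W x r := by
        rw [ContinuousLinearMap.comp_sub, ContinuousLinearMap.sub_comp]; abel
      rw [he]
      refine (norm_add_le _ _).trans (add_le_add
        ((ContinuousLinearMap.opNorm_comp_le _ _).trans ?_)
        ((ContinuousLinearMap.opNorm_comp_le _ _).trans ?_))
      · exact mul_le_mul_of_nonneg_right (hA q hqC) (norm_nonneg _)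
      · refine mul_le_mul ?_ (hWb r hr) (norm_nonneg _) hκ0.le
        rw [← dist_eq_norm]
        exact (hAδ q hqC p hpC (by rw [dist_eq_norm]; exact hfb r hr)).le
    have e2 := e1.trans (gronwallBound_mono le_rfl (by positivity) hL hs.le)
    rw [← dist_eq_norm] at e2
    calc dist (W y s) (W x t) ≤ dist (W y s) (W x s) + dist (W x s) (W x t) := dist_triangle _ _ _
      _ < c / 2 + c / 2 := add_lt_add (e2.trans_lt hκ) (h2 hd.1.2)
      _ = c := by ring
  -- The increment is split into a time step at `x'` and a spatial step at time `t`. Each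
  -- contributes an error with coefficient c / 2: the first by the mean value inequality in time,
  -- the second by `hsmall`.
  refine HasFDerivWithinAt.of_isLittleO (Asymptotics.isLittleO_iff.2 fun c hc => ?_)
  obtain ⟨δ₁, hδ₁, h1⟩ := hsmall (c / 2) (by positivity)
  have hFt : ContinuousAt (fun s => φ (s, x)) t := hcont t ht.le x hx
  obtain ⟨δ₂, hδ₂, h2⟩ := Metric.continuousAt_iff.1 hFt (c / (4 * (L + 1))) (by positivity)
  -- Closeness in space (δ₃) and in time (δ₂) each bound a displacement by c / (4(L + 1)), so that F
  -- varies by at most c / 2 along the time step. L + 1 replaces L because L may vanish.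
  set δ₃ := c / (4 * (L + 1) * B) with hδ₃
  have hδ₃0 : 0 < δ₃ := by positivity
  have hball : ball (t, x) (min δ₁ (min δ₂ δ₃)) ∈ 𝓝 (t, x) := ball_mem_nhds _ (by positivity)
  filter_upwards [mem_nhdsWithin_of_mem_nhds hball, self_mem_nhdsWithin] with p hp hpU
  obtain ⟨t', x'⟩ := p
  have ht' : |t'| < ε := abs_lt.2 hpU.1
  have hx' : x' ∈ U := hpU.2
  rw [mem_ball, Prod.dist_eq, max_lt_iff, lt_min_iff, lt_min_iff, lt_min_iff, lt_min_iff] at hp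
  obtain ⟨⟨-, htt, -⟩, hxx1, -, hxx3⟩ := hp
  rw [dist_eq_norm] at hxx1 hxx3
  have e1 := h1 t ht x hx x' hx' hxx1
  have e2 : ‖φ (t', x') - φ (t, x') - (t' - t) • F (φ (t, x))‖ ≤ c / 2 * ‖t' - t‖ := by
    have hseg : ∀ s ∈ uIcc t t', |s| < ε ∧ dist s t < δ₂ := by
      intro s hs
      refine ⟨?_, ?_⟩
      · have := (convex_Ioo (-ε) ε).ordConnected.uIcc_subset (abs_lt.1 ht) (abs_lt.1 ht') hs
        exact abs_lt.2 this
      · refine lt_of_le_of_lt ?_ htt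
        rw [Real.dist_eq, Real.dist_eq]
        exact abs_sub_left_of_mem_uIcc hs
    have := (convex_uIcc t t').norm_image_sub_le_of_norm_hasDerivWithin_le
      (f := fun s => φ (s, x') - s • F (φ (t, x))) (f' := fun s => F (φ (s, x')) - F (φ (t, x)))
      (C := c / 2) (x := t) (y := t')
      (fun s hs => by
        have := ((hφ s (hseg s hs).1.le x' hx').sub
          ((hasDerivAt_id s).smul_const (F (φ (t, x))))).hasDerivWithinAt (s := uIcc t t')
        simpa [Pi.sub_def] using this)
      (fun s hs => ?_) left_mem_uIcc right_mem_uIcc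
    · convert this using 2
      rw [sub_smul]; abel
    · obtain ⟨hs1, hs2⟩ := hseg s hs
      refine (hlip _ (hφC t ht.le x hx) _ (hφC s hs1.le x' hx')).trans ?_
      have i1 : ‖φ (s, x') - φ (s, x)‖ ≤ c / (4 * (L + 1)) := by
        refine (hφlip s hs1 x hx x' hx').trans ?_
        calc B * ‖x' - x‖ ≤ B * δ₃ := by gcongr
          _ = c / (4 * (L + 1)) := by rw [hδ₃]; field_simp
      have i2 : ‖φ (s, x) - φ (t, x)‖ ≤ c / (4 * (L + 1)) := by
        have := h2 hs2
        rw [dist_eq_norm] at this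
        exact this.le
      have i3 : ‖φ (s, x') - φ (t, x)‖ ≤ c / (2 * (L + 1)) := by
        calc ‖φ (s, x') - φ (t, x)‖ = ‖(φ (s, x') - φ (s, x)) + (φ (s, x) - φ (t, x))‖ := by
              congr 1; abel
          _ ≤ c / (4 * (L + 1)) + c / (4 * (L + 1)) := (norm_add_le _ _).trans (add_le_add i1 i2)
          _ = c / (2 * (L + 1)) := by field_simp; norm_num
      calc L * ‖φ (s, x') - φ (t, x)‖ ≤ (L + 1) * (c / (2 * (L + 1))) := by gcongr; linarith
        _ = c / 2 := by field_simp
  have hsum : φ (t', x') - φ (t, x) - ((ContinuousLinearMap.fst ℝ ℝ E).smulRight (F (φ (t, x))) +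
        W x t ∘L ContinuousLinearMap.snd ℝ ℝ E) ((t', x') - (t, x)) =
      (φ (t', x') - φ (t, x') - (t' - t) • F (φ (t, x))) +
        (φ (t, x') - φ (t, x) - W x t (x' - x)) := by
    simp; abel
  rw [hsum]
  have n1 : ‖t' - t‖ ≤ ‖(t', x') - (t, x)‖ := norm_fst_le ((t', x') - (t, x))
  have n2 : ‖x' - x‖ ≤ ‖(t', x') - (t, x)‖ := norm_snd_le ((t', x') - (t, x))
  calc _ ≤ c / 2 * ‖t' - t‖ + c / 2 * ‖x' - x‖ := (norm_add_le _ _).trans (add_le_add e2 e1)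
    _ ≤ c / 2 * ‖(t', x') - (t, x)‖ + c / 2 * ‖(t', x') - (t, x)‖ := by gcongr
    _ = _ := by ring

/-- In finite dimension an operator is encoded linearly by its values on a basis, so regularity can
be tested on fixed vectors. This reduces the operator-valued W to the vector-valued curves W v, and
metrics to scalar functions. -/
theorem contDiffWithinAt_of_forall_apply {D G : Type*} [NormedAddCommGroup D] [NormedSpace ℝ D]
    [NormedAddCommGroup G] [NormedSpace ℝ G] [FiniteDimensional ℝ E] {k : WithTop ℕ∞}
    {f : D → E →L[ℝ] G} {s : Set D} {x : D}
    (h : ∀ v, ContDiffWithinAt ℝ k (fun y => f y v) s x) : ContDiffWithinAt ℝ k f s x := by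
  let d := Module.finrank ℝ E
  have hd : d = Module.finrank ℝ (Fin d → ℝ) := (Module.finrank_fin_fun ℝ).symm
  let e₁ := ContinuousLinearEquiv.ofFinrankEq hd
  let e₂ := (e₁.arrowCongr (1 : G ≃L[ℝ] G)).trans (ContinuousLinearEquiv.piRing (Fin d))
  rw [← Function.id_comp f, ← e₂.symm_comp_self]
  exact e₂.symm.contDiff.contDiffAt.comp_contDiffWithinAt x
    (contDiffWithinAt_pi.2 fun i => h _)

/-- Local compactness supplies the uniform hypotheses of `exists_hasFDerivWithinAt`: on a small
compact convex piece of S around `x₀` the derivative of F is bounded and uniformly continuous, and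
continuity of φ at one point keeps short trajectories inside that piece. -/
theorem contDiffWithinAt_flow_aux {S : Set E} {F : E → E} {φ : ℝ × E → E} {x₀ : E}
    [FiniteDimensional ℝ E]
    (hSc : IsClosed S) (hS : Convex ℝ S) (hSi : (interior S).Nonempty) (hx₀ : x₀ ∈ S)
    (hF : ContDiffWithinAt ℝ 1 F S x₀) (hc : ContinuousWithinAt φ (univ ×ˢ S) (0, x₀))
    (hφ : ∀ᶠ p in 𝓝[univ ×ˢ S] ((0 : ℝ), x₀), φ p ∈ S ∧
      HasDerivAt (fun s => φ (s, p.2)) (F (φ p)) p.1)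
    (h0 : ∀ᶠ x in 𝓝[S] x₀, φ (0, x) = x) :
    ∃ ε > 0, ∃ ρ > 0, ∃ W : ℝ × E → E →L[ℝ] E, ∀ t ∈ Ioo (-ε) ε, ∀ x ∈ S ∩ ball x₀ ρ,
      W (0, x) = 1 ∧ φ (0, x) = x ∧ φ (t, x) ∈ S ∧
      HasDerivAt (fun s => φ (s, x)) (F (φ (t, x))) t ∧
      HasDerivAt (fun s => W (s, x)) (fderivWithin ℝ F S (φ (t, x)) ∘L W (t, x)) t ∧
      ContinuousWithinAt W (Ioo (-ε) ε ×ˢ (S ∩ ball x₀ ρ)) (t, x) ∧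
      HasFDerivWithinAt φ ((ContinuousLinearMap.fst ℝ ℝ E).smulRight (F (φ (t, x))) +
        W (t, x) ∘L ContinuousLinearMap.snd ℝ ℝ E) (Ioo (-ε) ε ×ˢ (S ∩ ball x₀ ρ)) (t, x) := by
  have hproper : ProperSpace E := FiniteDimensional.proper ℝ E
  have hu : UniqueDiffOn ℝ S := uniqueDiffOn_convex hS hSi
  have hφx : φ (0, x₀) = x₀ := h0.self_of_nhdsWithin hx₀
  have hev : ∀ᶠ z in 𝓝[S] x₀, ContDiffWithinAt ℝ 1 F S z := by
    have := hF.eventually (by simp)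
    rwa [insert_eq_of_mem hx₀] at this
  obtain ⟨r, hr, hr'⟩ := Metric.mem_nhdsWithin_iff.1 hev
  set C := S ∩ closedBall x₀ (r / 2) with hCdef
  have hCs : ∀ z ∈ C, ContDiffWithinAt ℝ 1 F S z := fun z hz =>
    hr' ⟨closedBall_subset_ball (by linarith) hz.2, hz.1⟩
  have hCc : IsCompact C := (isCompact_closedBall _ _).inter_left hSc
  have hAc : ContinuousOn (fderivWithin ℝ F S) C := fun z hz =>
    (((hCs z hz).fderivWithin_right (m := 0) hu (by simp) hz.1).continuousWithinAt).mono
      inter_subset_left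
  obtain ⟨L, hL⟩ := hCc.exists_bound_of_continuousOn hAc
  have hL0 : 0 ≤ L := (norm_nonneg _).trans (hL x₀ ⟨hx₀, mem_closedBall_self (by linarith)⟩)
  have hφC : ∀ᶠ p in 𝓝[univ ×ˢ S] ((0 : ℝ), x₀), φ p ∈ ball x₀ (r / 2) := by
    have hc' : Tendsto φ (𝓝[univ ×ˢ S] ((0 : ℝ), x₀)) (𝓝 x₀) := by
      simpa [ContinuousWithinAt, hφx] using hc
    exact hc'.eventually (ball_mem_nhds _ (half_pos hr))
  obtain ⟨ρ, hρ, hρ'⟩ := Metric.mem_nhdsWithin_iff.1 (hφ.and hφC)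
  obtain ⟨ρ₂, hρ₂, hρ₂'⟩ := Metric.mem_nhdsWithin_iff.1 h0
  -- The first bound keeps (t, x) in the neighbourhood of radius ρ even when |t| = ε; the second
  -- gives 2Lε ≤ 1.
  set ε := min (ρ / 2) (1 / (2 * (L + 1))) with hε
  have hε0 : 0 < ε := by positivity
  have hU : ∀ t, |t| ≤ ε → ∀ x ∈ S ∩ ball x₀ (min ρ ρ₂), (φ (t, x) ∈ S ∧
      HasDerivAt (fun s => φ (s, x)) (F (φ (t, x))) t) ∧ φ (t, x) ∈ ball x₀ (r / 2) := by
    intro t ht x hx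
    refine @hρ' (t, x) ⟨?_, mem_univ _, hx.1⟩
    rw [mem_ball, Prod.dist_eq, max_lt_iff]
    refine ⟨?_, lt_of_lt_of_le hx.2 (min_le_left _ _)⟩
    rw [Real.dist_eq, sub_zero]
    have := min_le_left (ρ / 2) (1 / (2 * (L + 1)))
    simp only at *; linarith
  have hU0 : ∀ x ∈ S ∩ ball x₀ (min ρ ρ₂), φ (0, x) = x := fun x hx =>
    hρ₂' ⟨ball_subset_ball (min_le_right _ _) hx.2, hx.1⟩
  obtain ⟨W, hW⟩ := exists_hasFDerivWithinAt (C := C) (U := S ∩ ball x₀ (min ρ ρ₂)) (F := F)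
    (A := fderivWithin ℝ F S) (φ := φ) (ε := ε) (L := L) (hS.inter (convex_closedBall _ _)) hL0 hε0
    (fun z hz => (((hCs z hz).differentiableWithinAt (by simp)).hasFDerivWithinAt).mono
      inter_subset_left) hL (hCc.uniformContinuousOn_of_continuous hAc)
    (fun t ht x hx => ⟨(hU t ht x hx).1.1, ball_subset_closedBall (hU t ht x hx).2⟩)
    (fun t ht x hx => (hU t ht x hx).1.2) hU0
    (by
      calc L * 2 * ε ≤ (L + 1) * 2 * (1 / (2 * (L + 1))) := by
            gcongr
            · linarith
            · exact min_le_right _ _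
        _ = 1 := by field_simp)
  refine ⟨ε, hε0, min ρ ρ₂, by positivity, W, fun t ht x hx => ?_⟩
  have ht' : |t| < ε := abs_lt.2 ht
  obtain ⟨w1, w2, w3, w4⟩ := hW t ht' x hx
  exact ⟨w1, hU0 x hx, (hU t ht'.le x hx).1.1, (hU t ht'.le x hx).1.2, w2, w3, w4⟩

/-- Induction on the order. The derivative of φ is built from F ∘ φ and W, and (φ, W v) is itself a
flow, of the field (F(z), DF(z)w) on S × E, which is C^k when F is C^(k+1). The space must therefore
be quantified inside the induction, and the conditions imposed on S (closed, convex, with interior)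
are stable under products with E. -/
theorem contDiffWithinAt_flow_succ (k : ℕ) : ∀ {E : Type*} [NormedAddCommGroup E] [NormedSpace ℝ E]
    [FiniteDimensional ℝ E] {S : Set E} {F : E → E} {φ : ℝ × E → E} {x₀ : E},
    IsClosed S → Convex ℝ S → (interior S).Nonempty → x₀ ∈ S → ContDiffWithinAt ℝ k F S x₀ →
    (∀ᶠ p in 𝓝[univ ×ˢ S] ((0 : ℝ), x₀), ContinuousWithinAt φ (univ ×ˢ S) p) →
    (∀ᶠ p in 𝓝[univ ×ˢ S] ((0 : ℝ), x₀), φ p ∈ S ∧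
      HasDerivAt (fun s => φ (s, p.2)) (F (φ p)) p.1) →
    (∀ᶠ x in 𝓝[S] x₀, φ (0, x) = x) →
    ContDiffWithinAt ℝ k φ (univ ×ˢ S) (0, x₀) := by
  induction k with
  | zero =>
    intro E _ _ _ S F φ x₀ hSc hS hSi hx₀ hF hc hφ h0
    refine (contDiffWithinAt_zero (show ((0 : ℝ), x₀) ∈ univ ×ˢ S from ⟨mem_univ _, hx₀⟩)).2
      ⟨_, hc, fun p hp => hp.2.mono inter_subset_left⟩
  | succ k ih =>
    intro E _ _ _ S F φ x₀ hSc hS hSi hx₀ hF hc hφ h0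
    have hmem : ((0 : ℝ), x₀) ∈ univ ×ˢ S := ⟨mem_univ _, hx₀⟩
    have hu : UniqueDiffOn ℝ S := uniqueDiffOn_convex hS hSi
    have hφx : φ (0, x₀) = x₀ := h0.self_of_nhdsWithin hx₀
    obtain ⟨ε, hε, ρ, hρ, W, hW⟩ := contDiffWithinAt_flow_aux hSc hS hSi hx₀
      (hF.of_le (by exact_mod_cast Nat.le_add_left 1 k)) (hc.self_of_nhdsWithin hmem) hφ h0
    have hFk : ContDiffWithinAt ℝ k F S x₀ := hF.of_le (by exact_mod_cast Nat.le_succ k)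
    have hAk : ContDiffWithinAt ℝ k (fderivWithin ℝ F S) S x₀ :=
      hF.fderivWithin_right hu (by simp) hx₀
    set U := S ∩ ball x₀ ρ with hU
    have hopen : IsOpen (Ioo (-ε) ε ×ˢ ball x₀ ρ) := isOpen_Ioo.prod isOpen_ball
    have huniv : Ioo (-ε) ε ×ˢ U = (univ ×ˢ S) ∩ (Ioo (-ε) ε ×ˢ ball x₀ ρ) := by
      rw [prod_inter_prod, univ_inter]
    have humem : Ioo (-ε) ε ×ˢ U ∈ 𝓝[univ ×ˢ S] ((0 : ℝ), x₀) := by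
      rw [huniv]
      exact inter_mem self_mem_nhdsWithin (mem_nhdsWithin_of_mem_nhds
        (hopen.mem_nhds ⟨⟨by linarith, hε⟩, mem_ball_self hρ⟩))
    have hφk := ih hSc hS hSi hx₀ hFk hc hφ h0
    -- The induction hypothesis is applied to the augmented flow on S × E, started at (x₀, v); its
    -- second component is W v.
    have hWk : ContDiffWithinAt ℝ k W (univ ×ˢ S) (0, x₀) := by
      refine contDiffWithinAt_of_forall_apply fun v => ?_
      set S' : Set (E × E) := S ×ˢ univ with hS'
      set F' : E × E → E × E := fun z => (F z.1, fderivWithin ℝ F S z.1 z.2) with hF'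
      set φ' : ℝ × (E × E) → E × E := fun p => (φ (p.1, p.2.1), W (p.1, p.2.1) p.2.2) with hφ'
      have htend : Tendsto (fun p : ℝ × (E × E) => (p.1, p.2.1))
          (𝓝[univ ×ˢ S'] ((0 : ℝ), (x₀, v))) (𝓝[univ ×ˢ S] ((0 : ℝ), x₀)) :=
        (Continuous.continuousWithinAt (by fun_prop)).tendsto_nhdsWithin
          fun p hp => ⟨mem_univ _, hp.2.1⟩
      have hev := htend.eventually humem
      have hmaps : MapsTo (fun p : ℝ × (E × E) => (p.1, p.2.1)) (univ ×ˢ S') (univ ×ˢ S) :=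
        fun p hp => ⟨mem_univ _, hp.2.1⟩
      have key : ContDiffWithinAt ℝ k φ' (univ ×ˢ S') (0, (x₀, v)) := by
        refine ih (F := F') (hSc.prod isClosed_univ) (hS.prod convex_univ) ?_
          ⟨hx₀, mem_univ _⟩ ?_ ?_ ?_ ?_
        · rw [hS', interior_prod_eq, interior_univ]
          exact hSi.prod univ_nonempty
        · have h1 : ContDiffWithinAt ℝ k (fun z : E × E => F z.1) S' (x₀, v) :=
            ContDiffWithinAt.comp (t := S) (x₀, v) hFk contDiffWithinAt_fst fun z hz => hz.1
          have h2 : ContDiffWithinAt ℝ k (fun z : E × E => fderivWithin ℝ F S z.1) S' (x₀, v) :=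
            ContDiffWithinAt.comp (t := S) (x₀, v) hAk contDiffWithinAt_fst fun z hz => hz.1
          exact h1.prodMk (h2.clm_apply contDiffWithinAt_snd)
        · filter_upwards [hev] with p hp
          obtain ⟨w1, w2, w3, w4, w5, w6, w7⟩ := hW p.1 hp.1 p.2.1 hp.2
          have hnhds : Ioo (-ε) ε ×ˢ U ∈ 𝓝[univ ×ˢ S] (p.1, p.2.1) := by
            rw [huniv]
            exact inter_mem self_mem_nhdsWithin (mem_nhdsWithin_of_mem_nhds
              (hopen.mem_nhds ⟨hp.1, hp.2.2⟩))
          have c0 : ContinuousWithinAt (fun p : ℝ × (E × E) => (p.1, p.2.1)) (univ ×ˢ S') p :=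
            Continuous.continuousWithinAt (by fun_prop)
          have c1 := ContinuousWithinAt.comp (f := fun p : ℝ × (E × E) => (p.1, p.2.1))
            (w7.continuousWithinAt.mono_of_mem_nhdsWithin hnhds) c0 hmaps
          have c2 := ContinuousWithinAt.comp (f := fun p : ℝ × (E × E) => (p.1, p.2.1))
            (w6.mono_of_mem_nhdsWithin hnhds) c0 hmaps
          exact c1.prodMk (c2.clm_apply (Continuous.continuousWithinAt (by fun_prop)))
        · filter_upwards [hev] with p hp
          obtain ⟨w1, w2, w3, w4, w5, w6, w7⟩ := hW p.1 hp.1 p.2.1 hp.2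
          refine ⟨⟨w3, mem_univ _⟩, w4.prodMk ?_⟩
          simpa using w5.clm_apply (hasDerivAt_const p.1 p.2.2)
        · have htend0 : Tendsto (fun z : E × E => z.1) (𝓝[S'] (x₀, v)) (𝓝[S] x₀) :=
            (Continuous.continuousWithinAt (by fun_prop)).tendsto_nhdsWithin fun z hz => hz.1
          have hUm : U ∈ 𝓝[S] x₀ := inter_mem self_mem_nhdsWithin
            (mem_nhdsWithin_of_mem_nhds (ball_mem_nhds _ hρ))
          filter_upwards [htend0.eventually hUm] with z hz
          obtain ⟨w1, w2, -⟩ := hW 0 ⟨by linarith, hε⟩ z.1 hz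
          simp [hφ', w1, w2]
      have h2 : ContDiffWithinAt ℝ k (fun p : ℝ × E => ((p.1, (p.2, v)) : ℝ × (E × E)))
          (univ ×ˢ S) (0, x₀) := ContDiff.contDiffWithinAt (by fun_prop)
      have := ContDiffWithinAt.comp (t := univ ×ˢ S') ((0 : ℝ), x₀) key.snd h2
        fun p hp => ⟨mem_univ _, hp.2, mem_univ _⟩
      exact this
    rw [show ((k + 1 : ℕ) : WithTop ℕ∞) = (k : WithTop ℕ∞) + 1 by norm_cast,
      contDiffWithinAt_succ_iff_hasFDerivWithinAt (by simp)]
    refine ⟨Ioo (-ε) ε ×ˢ U, by rwa [insert_eq_of_mem hmem], fun h => by simp at h,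
      fun p => (ContinuousLinearMap.fst ℝ ℝ E).smulRight (F (φ p)) +
        W p ∘L ContinuousLinearMap.snd ℝ ℝ E,
      fun p hp => (hW p.1 hp.1 p.2 hp.2).2.2.2.2.2.2, ?_⟩
    have hsub : Ioo (-ε) ε ×ˢ U ⊆ univ ×ˢ S := prod_mono (subset_univ _) inter_subset_left
    have h1 : ContDiffWithinAt ℝ k (fun p => F (φ p)) (Ioo (-ε) ε ×ˢ U) (0, x₀) :=
      ContDiffWithinAt.comp (t := S) ((0 : ℝ), x₀) (by rwa [hφx]) (hφk.mono hsub)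
        fun p hp => (hW p.1 hp.1 p.2 hp.2).2.2.1
    have hs : ContDiff ℝ k (fun w : E => (ContinuousLinearMap.fst ℝ ℝ E).smulRight w) :=
      (ContinuousLinearMap.smulRightL ℝ (ℝ × E) E (ContinuousLinearMap.fst ℝ ℝ E)).contDiff
    exact (hs.contDiffAt.comp_contDiffWithinAt _ h1).add
      ((hWk.mono hsub).clm_comp contDiffWithinAt_const)

/-- Smooth dependence of a local flow on time and initial value, in a closed convex set. -/
theorem contDiffWithinAt_flow [FiniteDimensional ℝ E] {S : Set E} {F : E → E} {φ : ℝ × E → E}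
    {x₀ : E} (k : ℕ) (hSc : IsClosed S) (hS : Convex ℝ S) (hSi : (interior S).Nonempty)
    (hx₀ : x₀ ∈ S) (hF : ContDiffWithinAt ℝ ∞ F S x₀)
    (hc : ContinuousWithinAt φ (univ ×ˢ S) (0, x₀))
    (hφ : ∀ᶠ p in 𝓝[univ ×ˢ S] ((0 : ℝ), x₀), φ p ∈ S ∧
      HasDerivAt (fun s => φ (s, p.2)) (F (φ p)) p.1)
    (h0 : ∀ᶠ x in 𝓝[S] x₀, φ (0, x) = x) :
    ContDiffWithinAt ℝ k φ (univ ×ˢ S) (0, x₀) := by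
  obtain ⟨ε, hε, ρ, hρ, W, hW⟩ := contDiffWithinAt_flow_aux hSc hS hSi hx₀
      (hF.of_le (by exact_mod_cast le_top)) hc hφ h0
  -- The induction needs continuity of φ at all nearby points. It comes for free from the
  -- differentiability already established there.
  refine contDiffWithinAt_flow_succ k hSc hS hSi hx₀ (hF.of_le (by exact_mod_cast le_top)) ?_ hφ h0
  have hopen : IsOpen (Ioo (-ε) ε ×ˢ ball x₀ ρ) := isOpen_Ioo.prod isOpen_ball
  filter_upwards [self_mem_nhdsWithin, mem_nhdsWithin_of_mem_nhds
    (hopen.mem_nhds ⟨⟨by linarith, hε⟩, mem_ball_self hρ⟩)] with p hp hp'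
  refine (hW p.1 hp'.1 p.2 ⟨hp.2, hp'.2⟩).2.2.2.2.2.2.continuousWithinAt.mono_of_mem_nhdsWithin ?_
  filter_upwards [self_mem_nhdsWithin, mem_nhdsWithin_of_mem_nhds (hopen.mem_nhds hp')] with q h1 h2
  exact ⟨h2.1, h1.2, h2.2⟩

end LocalFlow
end

/-! ### The flow of a complete vector field on a manifold with boundary -/

noncomputable section

open Filter Topology Metric

namespace ManifoldFlow

variable {E : Type*} [NormedAddCommGroup E] [NormedSpace ℝ E]
  {H : Type*} [TopologicalSpace H] {I : ModelWithCorners ℝ E H}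
  {M : Type*} [TopologicalSpace M] [ChartedSpace H M]

/-- The vector field `X` in the preferred chart at `q`. -/
abbrev fieldRep (X : ∀ p : M, TangentSpace I p) (q : M) : E → E :=
  VectorField.mpullbackWithin 𝓘(ℝ, E) I (extChartAt I q).symm X (range I)

/-- Pulling back by the inverse chart applies the inverse of its derivative, which is the derivative
of the chart. Hence integral curves become solutions of the coordinate equation. -/
theorem fieldRep_extChartAt [IsManifold I 1 M] (X : ∀ p : M, TangentSpace I p) {q y : M}
    (hy : y ∈ (extChartAt I q).source) :
    fieldRep X q (extChartAt I q y) = mfderiv I 𝓘(ℝ, E) (extChartAt I q) y (X y) := by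
  let D : E →L[ℝ] E := mfderivWithin 𝓘(ℝ, E) I (extChartAt I q).symm (range I) (extChartAt I q y)
  let D' : E →L[ℝ] E := mfderiv I 𝓘(ℝ, E) (extChartAt I q) y
  have h1 : D' ∘L D = ContinuousLinearMap.id ℝ E :=
    mfderiv_extChartAt_comp_mfderivWithin_extChartAt_symm' hy
  have h2 : D ∘L D' = ContinuousLinearMap.id ℝ E :=
    mfderivWithin_extChartAt_symm_comp_mfderiv_extChartAt' hy
  have hx : (X ((extChartAt I q).symm (extChartAt I q y)) : E) = (X y : E) :=
    congrArg (fun p => (X p : E)) ((extChartAt I q).left_inv hy)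
  have key : D.inverse (X ((extChartAt I q).symm (extChartAt I q y)) : E) = D' (X y : E) := by
    rw [ContinuousLinearMap.inverse_eq h2 h1, hx]
  exact key

theorem contDiffWithinAt_fieldRep [FiniteDimensional ℝ E] [IsManifold I ∞ M]
    {X : ∀ p : M, TangentSpace I p}
    (hX : ContMDiff I I.tangent ∞ (fun p => (⟨p, X p⟩ : TangentBundle I M))) (q : M) :
    ContDiffWithinAt ℝ ∞ (fieldRep X q) (range I) (extChartAt I q q) := by
  have : CompleteSpace E := FiniteDimensional.complete ℝ E
  have h := VectorField.contMDiffWithinAt_mpullbackWithin_extChartAt_symm (m := ∞) (n := ∞)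
    (s := univ) (x := q) (V := X) (hX q).contMDiffWithinAt uniqueMDiffOn_univ (mem_univ q)
    (by simp)
  rw [preimage_univ, inter_univ, contMDiffWithinAt_vectorSpace_iff_contDiffWithinAt] at h
  exact h.mono_of_mem_nhdsWithin (extChartAt_target_mem_nhdsWithin q)

theorem hasDerivAt_extChartAt_comp [IsManifold I 1 M] {γ : ℝ → M} {t : ℝ}
    {v : TangentSpace I (γ t)} {q : M}
    (hγ : HasMFDerivAt 𝓘(ℝ, ℝ) I γ t ((1 : ℝ →L[ℝ] ℝ).smulRight v))
    (hq : γ t ∈ (extChartAt I q).source) :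
    HasDerivAt (fun s => extChartAt I q (γ s))
      (mfderiv I 𝓘(ℝ, E) (extChartAt I q) (γ t) v) t := by
  have h := (mdifferentiableAt_extChartAt (I := I) (x := q) (y := γ t)
    (by rwa [← extChartAt_source I])).hasMFDerivAt.comp t hγ
  let D' : E →L[ℝ] E := mfderiv I 𝓘(ℝ, E) (extChartAt I q) (γ t)
  have h' : HasFDerivAt (fun s => extChartAt I q (γ s))
    (D' ∘L (1 : ℝ →L[ℝ] ℝ).smulRight (v : E)) t := h.hasFDerivAt
  have h'' := h'.hasDerivAt
  have hv : (D' ∘L (1 : ℝ →L[ℝ] ℝ).smulRight (v : E)) 1 = D' v := by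
    change D' ((1 : ℝ) • (v : E)) = D' v
    rw [one_smul]
  rw [hv] at h''
  exact h''

theorem IsMIntegralCurve.hasDerivAt_extChartAt [IsManifold I 1 M] {γ : ℝ → M}
    {X : ∀ p : M, TangentSpace I p} (hγ : IsMIntegralCurve γ X) {t : ℝ} {q : M}
    (hq : γ t ∈ (extChartAt I q).source) :
    HasDerivAt (fun s => extChartAt I q (γ s)) (fieldRep X q (extChartAt I q (γ t))) t := by
  rw [fieldRep_extChartAt X hq]
  exact hasDerivAt_extChartAt_comp (hγ t) hq

/-- A curve of bounded coordinate speed stays in a coordinate ball for a while. -/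
theorem mem_source_of_speed_le [T2Space M] [FiniteDimensional ℝ E] {γ : ℝ → M} (hγ : Continuous γ)
    {q : M} {r C T : ℝ}
    (hr : closedBall (extChartAt I q q) (2 * r) ∩ range I ⊆ (extChartAt I q).target) (hC : 0 ≤ C)
    (hd : ∀ t, γ t ∈ (extChartAt I q).source →
      extChartAt I q (γ t) ∈ ball (extChartAt I q q) (2 * r) →
      ∃ d, ‖d‖ ≤ C ∧ HasDerivAt (fun s => extChartAt I q (γ s)) d t)
    (h0 : γ 0 ∈ (extChartAt I q).source)
    (h0' : extChartAt I q (γ 0) ∈ ball (extChartAt I q q) r) (hT : C * T ≤ r) :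
    ∀ t ∈ Icc 0 T, γ t ∈ (extChartAt I q).source ∧
      ‖extChartAt I q (γ t) - extChartAt I q (γ 0)‖ ≤ C * t := by
  have hproper : ProperSpace E := FiniteDimensional.proper ℝ E
  set e := extChartAt I q with he
  have hrpos : 0 < r := pos_of_mem_ball h0'
  -- The chart domain is open, whereas a continuation argument needs a closed condition. The compact
  -- coordinate ball is closed in M because M is Hausdorff.
  have hKc : IsCompact (e.symm '' (closedBall (e q) (2 * r) ∩ range I)) :=
    ((isCompact_closedBall _ _).inter_right I.isClosed_range).image_of_continuousOn
      ((continuousOn_extChartAt_symm q).mono hr)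
  have hKs : e.symm '' (closedBall (e q) (2 * r) ∩ range I) ⊆ e.source := by
    rintro _ ⟨z, hz, rfl⟩
    exact e.map_target (hr hz)
  set K := e.symm '' (closedBall (e q) (2 * r) ∩ range I) with hK
  have hKmem : ∀ y ∈ e.source, e y ∈ closedBall (e q) (2 * r) → y ∈ K := fun y hy hy' =>
    ⟨e y, ⟨hy', extChartAt_target_subset_range q (e.map_source hy)⟩, e.left_inv hy⟩
  have hcl : IsClosed (γ ⁻¹' K) := hKc.isClosed.preimage hγ
  have hcont : ContinuousOn (fun t => ‖e (γ t) - e (γ 0)‖ - C * t) (γ ⁻¹' K) := by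
    refine ContinuousOn.sub (ContinuousOn.norm (ContinuousOn.sub ?_ continuousOn_const))
      (by fun_prop)
    exact (continuousOn_extChartAt q).comp hγ.continuousOn fun t ht => hKs ht
  have hA := hcont.preimage_isClosed_of_isClosed hcl (isClosed_Iic (a := (0 : ℝ)))
  -- Continuation: the times at which the curve lies in K and obeys the displacement bound form a
  -- closed set. As C T ≤ r, the curve is then strictly inside the ball of radius 2r, and the mean
  -- value inequality extends both properties a little further.
  have hsub := IsClosed.Icc_subset_of_forall_exists_gt (a := 0) (b := T)
    (s := γ ⁻¹' K ∩ (fun t => ‖e (γ t) - e (γ 0)‖ - C * t) ⁻¹' Iic 0) (hA.inter isClosed_Icc)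
    ⟨hKmem _ h0 (ball_subset_closedBall (ball_subset_ball (by linarith) h0')), by simp⟩ ?_
  · intro t ht
    obtain ⟨h1, h2⟩ := hsub ht
    exact ⟨hKs h1, by simpa using h2⟩
  · rintro t ⟨⟨htK, htC⟩, ht⟩ y hy
    have hts : γ t ∈ e.source := hKs htK
    have htC' : ‖e (γ t) - e (γ 0)‖ ≤ C * t := by simpa using htC
    have hball : e (γ t) ∈ ball (e q) (2 * r) := by
      have h1 : C * t ≤ r := (mul_le_mul_of_nonneg_left ht.2.le hC).trans hT
      rw [mem_ball, dist_eq_norm] at h0' ⊢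
      calc ‖e (γ t) - e q‖ = ‖(e (γ t) - e (γ 0)) + (e (γ 0) - e q)‖ := by congr 1; abel
        _ ≤ ‖e (γ t) - e (γ 0)‖ + ‖e (γ 0) - e q‖ := norm_add_le _ _
        _ < 2 * r := by linarith
    have hec : ContinuousAt (fun s => e (γ s)) t :=
      (continuousAt_extChartAt' hts).comp (f := γ) hγ.continuousAt
    have hev : ∀ᶠ s in 𝓝 t, γ s ∈ e.source ∧ e (γ s) ∈ ball (e q) (2 * r) :=
      (hγ.continuousAt.eventually (extChartAt_source_mem_nhds' hts)).and
        (hec.eventually (isOpen_ball.mem_nhds hball))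
    obtain ⟨δ, hδ, hδ'⟩ := Metric.eventually_nhds_iff_ball.1 hev
    set s := min y (t + δ / 2) with hs
    have hts' : t < s := lt_min hy (by linarith)
    have hsI : ∀ u ∈ Icc t s, u ∈ ball t δ := fun u hu => by
      rw [mem_ball, Real.dist_eq, abs_lt]
      have := min_le_right y (t + δ / 2)
      constructor <;> linarith [hu.1, hu.2]
    choose! d hd1 hd2 using hd
    have hmv := (convex_Icc t s).norm_image_sub_le_of_norm_hasDerivWithin_le
      (f := fun u => e (γ u)) (f' := d) (C := C)
      (fun u hu => (hd2 u (hδ' u (hsI u hu)).1 (hδ' u (hsI u hu)).2).hasDerivWithinAt)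
      (fun u hu => hd1 u (hδ' u (hsI u hu)).1 (hδ' u (hsI u hu)).2)
      (left_mem_Icc.2 hts'.le) (right_mem_Icc.2 hts'.le)
    obtain ⟨hs1, hs2⟩ := hδ' s (hsI s (right_mem_Icc.2 hts'.le))
    refine ⟨s, ⟨hKmem _ hs1 (ball_subset_closedBall hs2), ?_⟩, hts', min_le_left _ _⟩
    rw [Real.norm_eq_abs, abs_of_pos (by linarith)] at hmv
    have : ‖e (γ s) - e (γ 0)‖ ≤ C * (s - t) + C * t := by
      calc ‖e (γ s) - e (γ 0)‖ = ‖(e (γ s) - e (γ t)) + (e (γ t) - e (γ 0))‖ := by congr 1; abel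
        _ ≤ _ := (norm_add_le _ _).trans (add_le_add hmv htC')
    simp only [mem_preimage, mem_Iic]
    linarith

variable [T2Space M] [FiniteDimensional ℝ E] [IsManifold I ∞ M] {X : ∀ p : M, TangentSpace I p}

/-- Uniqueness of integral curves on a manifold with boundary. -/
theorem IsMIntegralCurve.eq_of_contMDiff
    (hX : ContMDiff I I.tangent ∞ (fun p => (⟨p, X p⟩ : TangentBundle I M))) {γ γ' : ℝ → M}
    (hγ : IsMIntegralCurve γ X) (hγ' : IsMIntegralCurve γ' X) {t₀ : ℝ} (h : γ t₀ = γ' t₀) :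
    γ = γ' := by
  have hcl : IsClosed {t | γ t = γ' t} := isClosed_eq hγ.continuous hγ'.continuous
  -- The coincidence set is clopen in ℝ. For openness, the chart field is C¹ on the convex set
  -- `range I`, hence Lipschitz on a relative neighbourhood, and coordinates of curves never leave
  -- `range I`; so boundary points need no separate treatment.
  have hop : IsOpen {t | γ t = γ' t} := by
    refine isOpen_iff_mem_nhds.2 fun t ht => ?_
    have ht : γ t = γ' t := ht
    set q := γ t with hq
    have hF : ContDiffWithinAt ℝ 1 (fieldRep X q) (range I) (extChartAt I q q) :=
      (contDiffWithinAt_fieldRep hX q).of_le (by exact_mod_cast le_top)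
    obtain ⟨K, s, hs, hlip⟩ := hF.exists_lipschitzOnWith I.convex_range
    have key : ∀ α : ℝ → M, IsMIntegralCurve α X → α t = q → ∀ᶠ u in 𝓝 t,
        α u ∈ (extChartAt I q).source ∧ extChartAt I q (α u) ∈ s := by
      intro α hα hαq
      have h1 : ∀ᶠ u in 𝓝 t, α u ∈ (extChartAt I q).source :=
        hα.continuous.continuousAt.eventually (by
          rw [hαq]; exact extChartAt_source_mem_nhds q)
      have h2 : Tendsto (fun u => extChartAt I q (α u)) (𝓝 t) (𝓝 (extChartAt I q q)) := by
        have : ContinuousAt (extChartAt I q) (α t) := by rw [hαq]; exact continuousAt_extChartAt q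
        have := ContinuousAt.comp (f := α) this hα.continuous.continuousAt
        simpa [ContinuousAt, hαq, Function.comp_def] using this
      have h3 : Tendsto (fun u => extChartAt I q (α u)) (𝓝 t) (𝓝[range I] (extChartAt I q q)) :=
        tendsto_nhdsWithin_iff.2 ⟨h2, h1.mono fun u hu =>
          extChartAt_target_subset_range q ((extChartAt I q).map_source hu)⟩
      exact h1.and (h3.eventually hs)
    obtain ⟨δ, hδ, hδ'⟩ := Metric.eventually_nhds_iff_ball.1
      ((key γ hγ rfl).and (key γ' hγ' ht.symm))
    rw [Real.ball_eq_Ioo] at hδ'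
    have heq := ODE_solution_unique_of_mem_Ioo (v := fun _ => fieldRep X q) (s := fun _ => s)
      (K := K) (t₀ := t) (f := fun u => extChartAt I q (γ u)) (g := fun u => extChartAt I q (γ' u))
      (fun _ _ => hlip) ⟨by linarith, by linarith⟩
      (fun u hu => ⟨IsMIntegralCurve.hasDerivAt_extChartAt hγ (hδ' u hu).1.1, (hδ' u hu).1.2⟩)
      (fun u hu => ⟨IsMIntegralCurve.hasDerivAt_extChartAt hγ' (hδ' u hu).2.1, (hδ' u hu).2.2⟩)
      (by simp only [← ht]; rfl)
    filter_upwards [Ioo_mem_nhds (show t - δ < t by linarith) (show t < t + δ by linarith)]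
      with u hu
    exact (extChartAt I q).injOn (hδ' u hu).1.1 (hδ' u hu).2.1 (heq hu)
  have huniv := IsClopen.eq_univ ⟨hcl, hop⟩ ⟨t₀, h⟩
  funext t
  exact (huniv ▸ mem_univ t : t ∈ {t | γ t = γ' t})

/-- A global flow of the vector field `X`. -/
structure IsFlow (θ : ℝ → M → M) (X : ∀ p : M, TangentSpace I p) : Prop where
  zero : ∀ p, θ 0 p = p
  integralCurve : ∀ p, IsMIntegralCurve (fun t => θ t p) X

/-- A time translate of an integral curve is an integral curve, so uniqueness of integral curves
forces the group law. -/
theorem IsFlow.add {θ : ℝ → M → M} (hθ : IsFlow θ X)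
    (hX : ContMDiff I I.tangent ∞ (fun p => (⟨p, X p⟩ : TangentBundle I M))) (s t : ℝ) (p : M) :
    θ (s + t) p = θ s (θ t p) := by
  have h1 : IsMIntegralCurve ((fun u => θ u p) ∘ (· + t)) X := (hθ.integralCurve p).comp_add t
  have := IsMIntegralCurve.eq_of_contMDiff hX h1 (hθ.integralCurve (θ t p)) (t₀ := 0)
    (by simp [hθ.zero])
  exact congrFun this s

/-- Near a point, a flow stays in the chart, with uniformly bounded coordinate speed. -/
theorem IsFlow.exists_mem_source {θ : ℝ → M → M} (hθ : IsFlow θ X)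
    (hX : ContMDiff I I.tangent ∞ (fun p => (⟨p, X p⟩ : TangentBundle I M))) (q : M) :
    ∃ r > 0, ∃ T > 0, ∃ C ≥ 0, ∀ x ∈ (extChartAt I q).source,
      extChartAt I q x ∈ ball (extChartAt I q q) r → ∀ t, |t| ≤ T →
      θ t x ∈ (extChartAt I q).source ∧
        ‖extChartAt I q (θ t x) - extChartAt I q x‖ ≤ C * |t| := by
  set e := extChartAt I q with he
  have hF := (contDiffWithinAt_fieldRep hX q).continuousWithinAt
  have h1 : ∀ᶠ z in 𝓝[range I] (e q), ‖fieldRep X q z‖ < ‖fieldRep X q (e q)‖ + 1 :=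
    hF.norm.eventually_lt_const (by linarith)
  obtain ⟨ρ, hρ, hρ'⟩ := Metric.mem_nhdsWithin_iff.1
    (h1.and (extChartAt_target_mem_nhdsWithin (I := I) q))
  set C := ‖fieldRep X q (e q)‖ + 1 with hC
  have hC0 : 0 < C := by positivity
  -- This leaves room for the closed ball of radius 2r inside the ball of radius ρ, where the field
  -- is bounded by C and the chart is defined. The time r / C is what a curve of speed C needs to
  -- travel the distance r.
  set r := ρ / 4 with hr
  have hr0 : 0 < r := by positivity
  have hT : C * (r / C) ≤ r := by rw [mul_div_cancel₀ _ hC0.ne']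
  have hclos : closedBall (e q) (2 * r) ⊆ ball (e q) ρ := closedBall_subset_ball (by linarith)
  have htgt : closedBall (e q) (2 * r) ∩ range I ⊆ e.target := fun z hz =>
    (hρ' ⟨hclos hz.1, hz.2⟩).2
  have hspeed : ∀ y ∈ e.source, e y ∈ ball (e q) (2 * r) → ‖fieldRep X q (e y)‖ ≤ C := by
    intro y hy hy'
    exact (hρ' ⟨hclos (ball_subset_closedBall hy'),
      extChartAt_target_subset_range q (e.map_source hy)⟩).1.le
  refine ⟨r, hr0, r / C, by positivity, C, hC0.le, fun x hx hxr t ht => ?_⟩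
  have hder : ∀ t, θ t x ∈ e.source →
      HasDerivAt (fun s => e (θ s x)) (fieldRep X q (e (θ t x))) t := fun t ht =>
    IsMIntegralCurve.hasDerivAt_extChartAt (hθ.integralCurve x) ht
  have hcont := (hθ.integralCurve x).continuous
  rcases le_total 0 t with h | h
  · have := mem_source_of_speed_le (γ := fun s => θ s x) hcont htgt hC0.le
      (fun s hs hs' => ⟨_, hspeed _ hs hs', hder s hs⟩) (by simpa only [hθ.zero] using hx)
      (by simpa only [hθ.zero] using hxr) hT t ⟨h, by rwa [abs_of_nonneg h] at ht⟩
    simpa only [hθ.zero, abs_of_nonneg h] using this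
  · have := mem_source_of_speed_le (γ := fun s => θ (-s) x) (hcont.comp continuous_neg) htgt hC0.le
      (fun s hs hs' => ⟨_, by simpa using hspeed _ hs hs',
        HasDerivAt.scomp (g₁ := fun s => e (θ s x)) s (hder (-s) hs) (hasDerivAt_neg s)⟩)
      (by simpa only [neg_zero, hθ.zero] using hx)
      (by simpa only [neg_zero, hθ.zero] using hxr) hT (-t) ⟨by linarith, by rwa [abs_of_nonpos h] at ht⟩
    simpa only [neg_zero, neg_neg, hθ.zero, abs_of_nonpos h] using this

/-- A flow is smooth near time zero. -/
theorem IsFlow.contMDiffAt_zero {θ : ℝ → M → M} (hθ : IsFlow θ X)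
    (hX : ContMDiff I I.tangent ∞ (fun p => (⟨p, X p⟩ : TangentBundle I M))) (q : M) :
    ContMDiffAt (𝓘(ℝ, ℝ).prod I) I ∞ (fun p : ℝ × M => θ p.1 p.2) (0, q) := by
  obtain ⟨r, hr, T, hT, C, hC, hθs⟩ := hθ.exists_mem_source hX q
  set e := extChartAt I q with he
  set S := range I with hS
  set φ : ℝ × E → E := fun p => e (θ p.1 (e.symm p.2)) with hφ
  have heq : e q ∈ S := extChartAt_target_subset_range q (mem_extChartAt_target q)
  have hmem : ((0 : ℝ), e q) ∈ univ ×ˢ S := ⟨mem_univ _, heq⟩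
  have hφ0 : φ (0, e q) = e q := by simp [hφ, hθ.zero, he]
  have hsnd : Tendsto (fun p : ℝ × E => p.2) (𝓝[univ ×ˢ S] ((0 : ℝ), e q)) (𝓝[S] (e q)) :=
    (Continuous.continuousWithinAt (by fun_prop)).tendsto_nhdsWithin fun z hz => hz.2
  have hball : ∀ᶠ p in 𝓝[univ ×ˢ S] ((0 : ℝ), e q),
      |p.1| < T ∧ p.2 ∈ e.target ∧ p.2 ∈ ball (e q) r := by
    have h1 : ∀ᶠ p in 𝓝[univ ×ˢ S] ((0 : ℝ), e q), |p.1| < T := by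
      have : ContinuousWithinAt (fun p : ℝ × E => |p.1|) (univ ×ˢ S) ((0 : ℝ), e q) :=
        Continuous.continuousWithinAt (by fun_prop)
      exact this.eventually_lt_const (by simpa using hT)
    exact h1.and ((hsnd.eventually (extChartAt_target_mem_nhdsWithin (I := I) q)).and
      (hsnd.eventually (mem_nhdsWithin_of_mem_nhds (ball_mem_nhds _ hr))))
  have hball' : ∀ᶠ p in 𝓝[univ ×ˢ S] ((0 : ℝ), e q), θ p.1 (e.symm p.2) ∈ e.source ∧
      ‖φ p - p.2‖ ≤ C * |p.1| := by
    filter_upwards [hball] with p ⟨h1, h2, h3⟩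
    have := hθs (e.symm p.2) (e.map_target h2) (by rwa [e.right_inv h2]) p.1 h1.le
    rwa [e.right_inv h2] at this
  -- Joint continuity is not part of `IsFlow`; it follows from the uniform speed bound ‖φ(t, z) - z‖
  -- ≤ C|t|.
  have hφc : ContinuousWithinAt φ (univ ×ˢ S) (0, e q) := by
    have h1 : Tendsto (fun p : ℝ × E => φ p - p.2) (𝓝[univ ×ˢ S] ((0 : ℝ), e q)) (𝓝 0) := by
      refine squeeze_zero_norm' (hball'.mono fun p hp => hp.2) ?_
      have : ContinuousWithinAt (fun p : ℝ × E => C * |p.1|) (univ ×ˢ S) ((0 : ℝ), e q) :=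
        Continuous.continuousWithinAt (by fun_prop)
      simpa [ContinuousWithinAt] using this
    have h2 := h1.add (hsnd.mono_right nhdsWithin_le_nhds)
    simp only [sub_add_cancel, zero_add] at h2
    rwa [ContinuousWithinAt, hφ0]
  have hsm : ContDiffWithinAt ℝ ∞ φ (univ ×ˢ S) (0, e q) := by
    refine contDiffWithinAt_infty.2 fun k => ?_
    refine LocalFlow.contDiffWithinAt_flow k I.isClosed_range I.convex_range
      I.nonempty_interior heq (contDiffWithinAt_fieldRep hX q) hφc ?_ ?_
    · filter_upwards [hball'] with p hp
      exact ⟨extChartAt_target_subset_range q (e.map_source hp.1),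
        IsMIntegralCurve.hasDerivAt_extChartAt (hθ.integralCurve _) hp.1⟩
    · filter_upwards [extChartAt_target_mem_nhdsWithin (I := I) q] with z hz
      simp only [hφ, hθ.zero]
      exact e.right_inv hz
  have hcont : ContinuousAt (fun p : ℝ × M => θ p.1 p.2) (0, q) := by
    have hg : Tendsto (fun p : ℝ × M => (p.1, e p.2)) (𝓝 ((0 : ℝ), q))
        (𝓝[univ ×ˢ S] ((0 : ℝ), e q)) := by
      refine tendsto_nhdsWithin_iff.2 ⟨?_, Eventually.of_forall fun p =>
        ⟨mem_univ _, ?_⟩⟩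
      · have h1 : ContinuousAt (fun p : ℝ × M => e p.2) ((0 : ℝ), q) :=
          ContinuousAt.comp (f := fun p : ℝ × M => p.2) (continuousAt_extChartAt q)
            continuousAt_snd
        exact continuousAt_fst.prodMk h1
      · simp [he, hS]
    have hsrc : ∀ᶠ p : ℝ × M in 𝓝 ((0 : ℝ), q), p.2 ∈ e.source :=
      continuousAt_snd.eventually (extChartAt_source_mem_nhds (I := I) q)
    have hev : (fun p : ℝ × M => e.symm (φ (p.1, e p.2))) =ᶠ[𝓝 ((0 : ℝ), q)]
        fun p => θ p.1 p.2 := by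
      filter_upwards [hg.eventually hball', hsrc] with p hp hp2
      simp only [hφ]
      have hp1 := hp.1
      rw [e.left_inv hp2] at hp1 ⊢
      exact e.left_inv hp1
    have hsymm : Tendsto e.symm (𝓝[S] (e q)) (𝓝 q) := by
      have := (continuousAt_extChartAt_symm (I := I) q).tendsto
      rw [extChartAt_to_inv] at this
      exact this.mono_left nhdsWithin_le_nhds
    have hφS : Tendsto (fun p : ℝ × M => φ (p.1, e p.2)) (𝓝 ((0 : ℝ), q)) (𝓝[S] (e q)) := by
      refine tendsto_nhdsWithin_iff.2 ⟨?_, Eventually.of_forall fun p => by simp [hφ, hS, he]⟩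
      have := hφc.tendsto.comp hg
      rwa [hφ0] at this
    have := (hsymm.comp hφS).congr' hev
    rw [ContinuousAt, hθ.zero]
    exact this
  refine contMDiffAt_iff.2 ⟨hcont, ?_⟩
  have hr' : range (𝓘(ℝ, ℝ).prod I) = univ ×ˢ S := by
    ext ⟨a, b⟩
    exact ⟨fun ⟨y, hy⟩ => ⟨mem_univ _, y.2, congrArg Prod.snd hy⟩,
      fun ⟨_, y, hy⟩ => ⟨(a, y), Prod.ext rfl hy⟩⟩
  rw [hr']
  simp only [hθ.zero, extChartAt_prod]
  exact hsm

/-- Smoothness near time zero spreads to all times: the times at which θ_s is C^n at p form a clopen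
set, because θ_b = θ_{b-a} ∘ θ_a with b - a small. The order n is kept finite, since being C^n at a
point then persists on a neighbourhood. -/
theorem IsFlow.contMDiff_time {θ : ℝ → M → M} (hθ : IsFlow θ X)
    (hX : ContMDiff I I.tangent ∞ (fun p => (⟨p, X p⟩ : TangentBundle I M))) (t : ℝ) :
    ContMDiff I I ∞ (θ t) := by
  intro p
  have hloc : ∀ q : M, ∀ n : ℕ, ∀ᶠ x in 𝓝 ((0 : ℝ), q),
      ContMDiffAt (𝓘(ℝ, ℝ).prod I) I n (fun p : ℝ × M => θ p.1 p.2) x := fun q n =>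
    (contMDiffAt_iff_contMDiffAt_nhds (by simp)).1
      ((hθ.contMDiffAt_zero hX q).of_le (by exact_mod_cast le_top))
  have hslice : ∀ (n : ℕ) (s : ℝ) (q : M),
      ContMDiffAt (𝓘(ℝ, ℝ).prod I) I n (fun p : ℝ × M => θ p.1 p.2) (s, q) →
      ContMDiffAt I I n (θ s) q := fun n s q h =>
    ContMDiffAt.comp (I' := 𝓘(ℝ, ℝ).prod I) q (g := fun p : ℝ × M => θ p.1 p.2)
      (f := fun x => (s, x)) h
      (contMDiffAt_const.prodMk contMDiffAt_id)
  refine contMDiffAt_infty.2 fun n => ?_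
  set A := {s : ℝ | ContMDiffAt I I n (θ s) p} with hA
  -- One neighbourhood of (0, θ_t p) serves both directions, since θ_s p stays near θ_t p. The
  -- equivalence makes both A and its complement open.
  have hlocal : ∀ t : ℝ, ∃ δ > 0, ∀ s, |s - t| < δ → (s ∈ A ↔ t ∈ A) := by
    intro t
    obtain ⟨U, hU, hU'⟩ := Filter.eventually_iff_exists_mem.1 (hloc (θ t p) n)
    rw [nhds_prod_eq, Filter.mem_prod_iff] at hU
    obtain ⟨J, hJ, V, hV, hJV⟩ := hU
    have hcV : ∀ᶠ s in 𝓝 t, θ s p ∈ V :=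
      (hθ.integralCurve p).continuous.continuousAt.eventually hV
    obtain ⟨δ₁, hδ₁, hJ'⟩ := Metric.mem_nhds_iff.1 hJ
    obtain ⟨δ₂, hδ₂, hV'⟩ := Metric.eventually_nhds_iff.1 hcV
    refine ⟨min δ₁ δ₂, by positivity, fun s hs => ?_⟩
    rw [lt_min_iff] at hs
    have step : ∀ a b : ℝ, |b - a| < δ₁ → θ a p ∈ V → a ∈ A → b ∈ A := by
      intro a b hab haV ha
      have h1 : ContMDiffAt I I n (θ (b - a)) (θ a p) :=
        hslice n _ _ (hU' _ (hJV ⟨hJ' (by simpa [Real.dist_eq] using hab), haV⟩))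
      have h2 : θ b = fun x => θ (b - a) (θ a x) := by
        funext x
        rw [← hθ.add hX, sub_add_cancel]
      change ContMDiffAt I I n (θ b) p
      rw [h2]
      exact ContMDiffAt.comp (I' := I) p (g := θ (b - a)) (f := θ a) h1 ha
    exact ⟨step s t (by rw [abs_sub_comm]; exact hs.1)
      (hV' (by simpa [Real.dist_eq] using hs.2)), step t s hs.1 (mem_of_mem_nhds hV)⟩
  have hop : IsOpen A := isOpen_iff_mem_nhds.2 fun t ht => by
    obtain ⟨δ, hδ, h⟩ := hlocal t
    exact Metric.mem_nhds_iff.2 ⟨δ, hδ, fun s hs => (h s (by simpa [Real.dist_eq] using hs)).2 ht⟩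
  have hcl : IsClosed A := isOpen_compl_iff.1 <| isOpen_iff_mem_nhds.2 fun t ht => by
    obtain ⟨δ, hδ, h⟩ := hlocal t
    exact Metric.mem_nhds_iff.2 ⟨δ, hδ, fun s hs hs' =>
      ht ((h s (by simpa [Real.dist_eq] using hs)).1 hs')⟩
  have h0 : (0 : ℝ) ∈ A := by
    have : θ 0 = id := funext hθ.zero
    change ContMDiffAt I I n (θ 0) p
    rw [this]
    exact contMDiffAt_id
  have huniv := IsClopen.eq_univ ⟨hcl, hop⟩ ⟨0, h0⟩
  exact (huniv ▸ mem_univ t : t ∈ A)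

/-- The flow of a smooth complete vector field is smooth. -/
theorem IsFlow.contMDiff {θ : ℝ → M → M} (hθ : IsFlow θ X)
    (hX : ContMDiff I I.tangent ∞ (fun p => (⟨p, X p⟩ : TangentBundle I M))) :
    ContMDiff (𝓘(ℝ, ℝ).prod I) I ∞ (fun p : ℝ × M => θ p.1 p.2) := by
  rintro ⟨t, p⟩
  have h : (fun x : ℝ × M => θ x.1 x.2) = fun x => θ (x.1 - t) (θ t x.2) := by
    funext x
    rw [← hθ.add hX, sub_add_cancel]
  rw [h]
  refine ContMDiffAt.comp (I' := 𝓘(ℝ, ℝ).prod I) (t, p) (g := fun p : ℝ × M => θ p.1 p.2)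
    (f := fun x : ℝ × M => (x.1 - t, θ t x.2)) ?_ ?_
  · simpa using hθ.contMDiffAt_zero hX (θ t p)
  · exact (contMDiffAt_fst.sub contMDiffAt_const).prodMk
      ((hθ.contMDiff_time hX t _).comp (t, p) contMDiffAt_snd)

/-- The time-`t` diffeomorphism of a flow. -/
def IsFlow.diffeomorph {θ : ℝ → M → M} (hθ : IsFlow θ X)
    (hX : ContMDiff I I.tangent ∞ (fun p => (⟨p, X p⟩ : TangentBundle I M))) (t : ℝ) :
    M ≃ₘ^∞⟮I, I⟯ M where
  toFun := θ t
  invFun := θ (-t)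
  left_inv p := by rw [← hθ.add hX, neg_add_cancel, hθ.zero]
  right_inv p := by rw [← hθ.add hX, add_neg_cancel, hθ.zero]
  contMDiff_toFun := hθ.contMDiff_time hX t
  contMDiff_invFun := hθ.contMDiff_time hX (-t)

/-- A vector field is invariant under its flow. -/
theorem IsFlow.mfderiv_apply {θ : ℝ → M → M} (hθ : IsFlow θ X)
    (hX : ContMDiff I I.tangent ∞ (fun p => (⟨p, X p⟩ : TangentBundle I M))) (t : ℝ) (p : M) :
    mfderiv I I (θ t) p (X p) = X (θ t p) := by
  have h0 : θ 0 p = p := hθ.zero p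
  have h1 : HasMFDerivAt I I (θ t) (θ 0 p) (mfderiv I I (θ t) (θ 0 p)) :=
    ((hθ.contMDiff_time hX t).mdifferentiable (by simp) _).hasMFDerivAt
  have h2 := h1.comp (0 : ℝ) (hθ.integralCurve p 0)
  have h3 := (hθ.integralCurve (θ t p)) 0
  -- Differentiating θ_t ∘ θ_s = θ_s ∘ θ_t at s = 0 gives the invariance.
  have h4 : (θ t ∘ fun s => θ s p) = fun s => θ s (θ t p) := by
    funext s
    simp only [Function.comp_apply]
    rw [← hθ.add hX, ← hθ.add hX, add_comm]
  rw [h4] at h2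
  have h5 := DFunLike.congr_fun (hasMFDerivAt_unique h2 h3) (1 : ℝ)
  have h6 : ((1 : ℝ) • X (θ 0 p) : E) = X (θ 0 p) := one_smul _ _
  have h7 : ((1 : ℝ) • X (θ 0 (θ t p)) : E) = X (θ 0 (θ t p)) := one_smul _ _
  have h8 : (mfderiv I I (θ t) (θ 0 p) : E →L[ℝ] E) (X (θ 0 p) : E) = (X (θ 0 (θ t p)) : E) := by
    rw [← h7, ← h6]
    exact h5
  rw [h0, hθ.zero] at h8
  exact h8

end ManifoldFlow
end

/-! ### Transformation laws of Christoffel symbols and curvature -/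

noncomputable section

open Filter Topology

namespace WeightedYamabe

/-! Shortcuts for instance search on spaces of multilinear maps. -/

section Shortcuts

variable {V : Type*} [NormedAddCommGroup V] [NormedSpace ℝ V]

instance : NormedAddCommGroup (V →L[ℝ] ℝ) := ContinuousLinearMap.toNormedAddCommGroup
instance : NormedSpace ℝ (V →L[ℝ] ℝ) := ContinuousLinearMap.toNormedSpace
instance : AddCommGroup (V →L[ℝ] ℝ) := ContinuousLinearMap.addCommGroup
instance : Module ℝ (V →L[ℝ] ℝ) := ContinuousLinearMap.module
instance : NormedAddCommGroup (V →L[ℝ] V →L[ℝ] ℝ) := ContinuousLinearMap.toNormedAddCommGroup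
instance : NormedSpace ℝ (V →L[ℝ] V →L[ℝ] ℝ) := ContinuousLinearMap.toNormedSpace
instance : AddCommGroup (V →L[ℝ] V →L[ℝ] ℝ) := ContinuousLinearMap.addCommGroup
instance : Module ℝ (V →L[ℝ] V →L[ℝ] ℝ) := ContinuousLinearMap.module
instance : NormedAddCommGroup (V →L[ℝ] V →L[ℝ] V →L[ℝ] ℝ) := ContinuousLinearMap.toNormedAddCommGroup
instance : NormedSpace ℝ (V →L[ℝ] V →L[ℝ] V →L[ℝ] ℝ) := ContinuousLinearMap.toNormedSpace
instance : AddCommGroup (V →L[ℝ] V →L[ℝ] V →L[ℝ] ℝ) := ContinuousLinearMap.addCommGroup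
instance : Module ℝ (V →L[ℝ] V →L[ℝ] V →L[ℝ] ℝ) := ContinuousLinearMap.module
instance : NormedAddCommGroup (V →L[ℝ] V) := ContinuousLinearMap.toNormedAddCommGroup
instance : NormedSpace ℝ (V →L[ℝ] V) := ContinuousLinearMap.toNormedSpace
instance : AddCommGroup (V →L[ℝ] V) := ContinuousLinearMap.addCommGroup
instance : Module ℝ (V →L[ℝ] V) := ContinuousLinearMap.module
instance : NormedAddCommGroup (V →L[ℝ] V →L[ℝ] V) := ContinuousLinearMap.toNormedAddCommGroup
instance : NormedSpace ℝ (V →L[ℝ] V →L[ℝ] V) := ContinuousLinearMap.toNormedSpace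
instance : AddCommGroup (V →L[ℝ] V →L[ℝ] V) := ContinuousLinearMap.addCommGroup
instance : Module ℝ (V →L[ℝ] V →L[ℝ] V) := ContinuousLinearMap.module

end Shortcuts

variable {E : Type*} [NormedAddCommGroup E] [NormedSpace ℝ E]

/-- The Christoffel symbols as a bilinear map. -/
def christoffelCLM (S : Set (E)) (G : E → E →L[ℝ] E →L[ℝ] ℝ)
    (z : E) : E →L[ℝ] E →L[ℝ] E :=
  ContinuousLinearMap.compL ℝ (E) (E →L[ℝ] ℝ) (E) (G z).inverse ∘L
    ((1 / 2 : ℝ) • (fderivWithin ℝ G S z + (fderivWithin ℝ G S z).flip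
      - (ContinuousLinearMap.flipₗᵢ ℝ (E) (E) ℝ :
          (E →L[ℝ] E →L[ℝ] ℝ) →L[ℝ] (E →L[ℝ] E →L[ℝ] ℝ)) ∘L
        (fderivWithin ℝ G S z).flip))

theorem christoffelCLM_apply {n : ℕ} (S : Set (Coord n))
    (G : Coord n → Coord n →L[ℝ] Coord n →L[ℝ] ℝ) (z u v : Coord n) :
    christoffelCLM S G z u v = christoffel S G z u v := by
  rfl

theorem contDiffWithinAt_christoffelCLM {S : Set (E)}
    {G : E → E →L[ℝ] E →L[ℝ] ℝ} {z : E} (hS : UniqueDiffOn ℝ S) [CompleteSpace E]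
    (hz : z ∈ S) (hG : ContDiffWithinAt ℝ 2 G S z) (hi : (G z).IsInvertible) :
    ContDiffWithinAt ℝ 1 (christoffelCLM S G) S z := by
  have h1 : ContDiffWithinAt ℝ 1 (fderivWithin ℝ G S) S z :=
    hG.fderivWithin_right (m := 1) hS (by norm_num [one_add_one_eq_two]) hz
  have h2 : ContDiffWithinAt ℝ 1 (fun y => (G y).inverse) S z := by
    have : ContDiffAt ℝ 1 ContinuousLinearMap.inverse (G z) := hi.contDiffAt_map_inverse
    exact this.comp_contDiffWithinAt z (hG.of_le (by norm_num))
  have h3 : ContDiffWithinAt ℝ 1 (fun y => (fderivWithin ℝ G S y).flip) S z :=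
    (ContinuousLinearMap.flipₗᵢ ℝ (E) (E)
      (E →L[ℝ] ℝ)).contDiff.contDiffAt.comp_contDiffWithinAt z h1
  have h4 := (ContinuousLinearMap.compL ℝ (E) (E →L[ℝ] ℝ)
    (E)).contDiff.contDiffAt.comp_contDiffWithinAt (n := 1) z h2
  exact h4.clm_comp (((h1.add h3).sub (contDiffWithinAt_const.clm_comp h3)).const_smul (1 / 2 : ℝ))

/-- The curvature as a linear map in its first argument. -/
def riemannCLM (S : Set (E)) (G : E → E →L[ℝ] E →L[ℝ] ℝ)
    (z v w : E) : E →L[ℝ] E :=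
  ((fderivWithin ℝ (christoffelCLM S G) S z).flip v).flip w
    - (fderivWithin ℝ (christoffelCLM S G) S z v).flip w
    + (christoffelCLM S G z).flip (christoffelCLM S G z v w)
    - christoffelCLM S G z v ∘L (christoffelCLM S G z).flip w

theorem fderivWithin_apply_apply
    {F : Type*} [NormedAddCommGroup F] [NormedSpace ℝ F] {K L : Type*} [NormedAddCommGroup K]
    [NormedSpace ℝ K] [NormedAddCommGroup L] [NormedSpace ℝ L] {B : E → K →L[ℝ] L →L[ℝ] F}
    {S : Set E} {z : E} (hS : UniqueDiffWithinAt ℝ S z) (hB : DifferentiableWithinAt ℝ B S z)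
    (v : K) (w : L) (u : E) :
    fderivWithin ℝ (fun y => B y v w) S z u = fderivWithin ℝ B S z u v w := by
  have h := (hB.hasFDerivWithinAt.clm_apply (hasFDerivWithinAt_const v z S)).clm_apply
    (hasFDerivWithinAt_const w z S)
  rw [h.fderivWithin hS]
  simp

theorem riemannCLM_apply {n : ℕ} {S : Set (Coord n)} {G : Coord n → Coord n →L[ℝ] Coord n →L[ℝ] ℝ}
    {z : Coord n} (hS : UniqueDiffWithinAt ℝ S z)
    (hΓ : DifferentiableWithinAt ℝ (christoffelCLM S G) S z) (u v w : Coord n) :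
    riemannCLM S G z v w u = riemann S G z u v w := by
  have h1 := fderivWithin_apply_apply hS hΓ v w u
  have h2 := fderivWithin_apply_apply hS hΓ u w v
  simp only [christoffelCLM_apply] at h1 h2
  rw [riemann, h1, h2]
  rfl

/-- Near `y`, the metric `G'` is `c` times the pullback of the metric `G` by the local
diffeomorphism `f` of `S`. -/
structure IsPullbackAt (S : Set (E)) (f : E → E)
    (G G' : E → E →L[ℝ] E →L[ℝ] ℝ) (c : ℝ) (y : E) : Prop where
  mem : y ∈ S
  maps : ∀ᶠ w in 𝓝[S] y, f w ∈ S
  contDiff_f : ContDiffWithinAt ℝ 3 f S y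
  contDiff_G : ContDiffWithinAt ℝ 2 G S (f y)
  symm : ∀ u v, G (f y) u v = G (f y) v u
  inv_G : (G (f y)).IsInvertible
  inv_G' : (G' y).IsInvertible
  inv_f : (fderivWithin ℝ f S y).IsInvertible
  eq : G' =ᶠ[𝓝[S] y] fun w =>
    c • (G (f w)).bilinearComp (fderivWithin ℝ f S w) (fderivWithin ℝ f S w)

namespace IsPullbackAt

variable {S : Set E} {f : E → E}
  {G G' : E → E →L[ℝ] E →L[ℝ] ℝ} {c : ℝ} {y : E}

theorem tendsto (h : IsPullbackAt S f G G' c y) : Tendsto f (𝓝[S] y) (𝓝[S] (f y)) :=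
  tendsto_nhdsWithin_iff.2 ⟨h.contDiff_f.continuousWithinAt, h.maps⟩

theorem map_mem (h : IsPullbackAt S f G G' c y) : f y ∈ S := h.maps.self_of_nhdsWithin h.mem

theorem hasFDerivWithinAt (h : IsPullbackAt S f G G' c y) :
    HasFDerivWithinAt f (fderivWithin ℝ f S y) S y :=
  (h.contDiff_f.differentiableWithinAt (by norm_num)).hasFDerivWithinAt

theorem contDiff_fderiv (h : IsPullbackAt S f G G' c y) (hS : UniqueDiffOn ℝ S) :
    ContDiffWithinAt ℝ 2 (fderivWithin ℝ f S) S y :=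
  h.contDiff_f.fderivWithin_right (m := 2) hS (by norm_num [two_add_one_eq_three]) h.mem

theorem hasFDerivWithinAt_fderiv (h : IsPullbackAt S f G G' c y) (hS : UniqueDiffOn ℝ S) :
    HasFDerivWithinAt (fderivWithin ℝ f S) (fderivWithin ℝ (fderivWithin ℝ f S) S y) S y :=
  ((h.contDiff_fderiv hS).differentiableWithinAt (by norm_num)).hasFDerivWithinAt

theorem contDiff_comp {F : Type*} [NormedAddCommGroup F] [NormedSpace ℝ F] {m : WithTop ℕ∞}
    (h : IsPullbackAt S f G G' c y) (hm : m ≤ 3) {g : E → F}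
    (hg : ContDiffWithinAt ℝ m g S (f y)) : ContDiffWithinAt ℝ m (fun w => g (f w)) S y :=
  hg.comp_of_preimage_mem_nhdsWithin y (h.contDiff_f.of_le hm) h.maps

theorem hasFDerivWithinAt_comp {F : Type*} [NormedAddCommGroup F] [NormedSpace ℝ F]
    (h : IsPullbackAt S f G G' c y) {g : E → F}
    (hg : DifferentiableWithinAt ℝ g S (f y)) :
    HasFDerivWithinAt (fun w => g (f w)) (fderivWithin ℝ g S (f y) ∘L fderivWithin ℝ f S y) S y :=
  hg.hasFDerivWithinAt.comp_of_tendsto y h.hasFDerivWithinAt h.tendsto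

/-- Schwarz's theorem, valid up to the boundary because S lies in the closure of its interior. -/
theorem symm_snd (h : IsPullbackAt S f G G' c y) (hS : UniqueDiffOn ℝ S)
    (hS' : S ⊆ closure (interior S)) (u v : E) :
    fderivWithin ℝ (fderivWithin ℝ f S) S y u v = fderivWithin ℝ (fderivWithin ℝ f S) S y v u :=
  (h.contDiff_f.isSymmSndFDerivWithinAt (by simp; norm_num) hS (hS' h.mem) h.mem).eq u v

theorem symm_thd (h : IsPullbackAt S f G G' c y) (hS : UniqueDiffOn ℝ S)
    (hS' : S ⊆ closure (interior S)) (u v w : E) :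
    fderivWithin ℝ (fderivWithin ℝ (fderivWithin ℝ f S) S) S y u v w =
      fderivWithin ℝ (fderivWithin ℝ (fderivWithin ℝ f S) S) S y v u w :=
  DFunLike.congr_fun (((h.contDiff_fderiv hS).isSymmSndFDerivWithinAt (by simp) hS (hS' h.mem)
    h.mem).eq u v) w

theorem apply_eq (h : IsPullbackAt S f G G' c y) (v w : E) :
    G' y v w = c * G (f y) (fderivWithin ℝ f S y v) (fderivWithin ℝ f S y w) := by
  rw [h.eq.self_of_nhdsWithin h.mem]
  simp

/-- The product rule on fixed vectors `v`, `w`, where only scalar functions are differentiated. The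
derivative is left existential and described by its values, which is all that the Koszul formula
needs. -/
theorem hasFDerivWithinAt_apply (h : IsPullbackAt S f G G' c y) (hS : UniqueDiffOn ℝ S)
    (v w : E) : ∃ L : E →L[ℝ] ℝ, HasFDerivWithinAt (fun x => G' x v w) L S y ∧
      ∀ u, L u = c * (fderivWithin ℝ G S (f y) (fderivWithin ℝ f S y u) (fderivWithin ℝ f S y v)
          (fderivWithin ℝ f S y w) +
        G (f y) (fderivWithin ℝ (fderivWithin ℝ f S) S y u v) (fderivWithin ℝ f S y w) +
        G (f y) (fderivWithin ℝ f S y v) (fderivWithin ℝ (fderivWithin ℝ f S) S y u w)) := by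
  have hG := h.hasFDerivWithinAt_comp (h.contDiff_G.differentiableWithinAt (by norm_num))
  have hD := h.hasFDerivWithinAt_fderiv hS
  have key := ((hG.clm_apply (hD.clm_apply (hasFDerivWithinAt_const v y S))).clm_apply
    (hD.clm_apply (hasFDerivWithinAt_const w y S))).const_mul c
  refine ⟨_, key.congr_of_eventuallyEq (h.eq.mono fun x hx => by simp [hx]) ?_, fun u => ?_⟩
  · simp [h.apply_eq]
  · simp
    ring

theorem differentiable_G' [FiniteDimensional ℝ E] (h : IsPullbackAt S f G G' c y) (hS : UniqueDiffOn ℝ S) :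
    DifferentiableWithinAt ℝ G' S y := by
  have key : ContDiffWithinAt ℝ 1 G' S y := by
    refine LocalFlow.contDiffWithinAt_of_forall_apply fun v =>
      LocalFlow.contDiffWithinAt_of_forall_apply fun w => ?_
    have hG : ContDiffWithinAt ℝ 1 (fun x => G (f x)) S y :=
      h.contDiff_comp (m := 1) (by norm_num) (h.contDiff_G.of_le (by norm_num))
    have hD := (h.contDiff_fderiv hS).of_le (m := 1) (by norm_num)
    refine ContDiffWithinAt.congr_of_eventuallyEq (contDiffWithinAt_const.mul
      ((hG.clm_apply (hD.clm_apply contDiffWithinAt_const)).clm_apply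
      (hD.clm_apply contDiffWithinAt_const))) (h.eq.mono fun x hx => ?_) (h.apply_eq v w)
    simp [hx]
  exact key.differentiableWithinAt (by norm_num)

theorem fderivWithin_G' [FiniteDimensional ℝ E] (h : IsPullbackAt S f G G' c y) (hS : UniqueDiffOn ℝ S)
    (u v w : E) : fderivWithin ℝ G' S y u v w =
      c * (fderivWithin ℝ G S (f y) (fderivWithin ℝ f S y u) (fderivWithin ℝ f S y v)
          (fderivWithin ℝ f S y w) +
        G (f y) (fderivWithin ℝ (fderivWithin ℝ f S) S y u v) (fderivWithin ℝ f S y w) +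
        G (f y) (fderivWithin ℝ f S y v) (fderivWithin ℝ (fderivWithin ℝ f S) S y u w)) := by
  obtain ⟨L, hL, hL'⟩ := h.hasFDerivWithinAt_apply hS v w
  rw [← hL', ← hL.fderivWithin (hS y h.mem), fderivWithin_apply_apply (hS y h.mem)
    (h.differentiable_G' hS)]

theorem _root_.WeightedYamabe.apply_christoffelCLM (hi : (G y).IsInvertible) (u v w : E) :
    G y (christoffelCLM S G y u v) w = 1 / 2 * (fderivWithin ℝ G S y u v w +
      fderivWithin ℝ G S y v u w - fderivWithin ℝ G S y w u v) := by
  simp [christoffelCLM, hi.self_apply_inverse]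

/-- The transformation law of the Christoffel symbols. -/
theorem christoffel_eq [FiniteDimensional ℝ E] (h : IsPullbackAt S f G G' c y) (hc : c ≠ 0)
    (hS : UniqueDiffOn ℝ S) (hS' : S ⊆ closure (interior S)) (u v : E) :
    fderivWithin ℝ f S y (christoffelCLM S G' y u v) =
      christoffelCLM S G (f y) (fderivWithin ℝ f S y u) (fderivWithin ℝ f S y v) +
        fderivWithin ℝ (fderivWithin ℝ f S) S y u v := by
  -- Both sides are paired with Df(w), which is arbitrary since Df is onto. In the Koszul formula
  -- for G' six second-derivative terms occur; by symmetry four cancel and two add up to G(D²f(u,v),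
  -- Df w).
  refine h.inv_G.injective ?_
  ext w'
  obtain ⟨w, rfl⟩ := h.inv_f.surjective w'
  rw [map_add, add_apply, apply_christoffelCLM h.inv_G]
  have h1 := h.apply_eq (christoffelCLM S G' y u v) w
  rw [apply_christoffelCLM h.inv_G', h.fderivWithin_G' hS, h.fderivWithin_G' hS,
    h.fderivWithin_G' hS, h.symm_snd hS hS' v u, h.symm_snd hS hS' w u, h.symm_snd hS hS' w v,
    h.symm (fderivWithin ℝ (fderivWithin ℝ f S) S y u w)] at h1
  refine mul_left_cancel₀ hc (h1.symm.trans ?_)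
  ring

end IsPullbackAt

/-- The curvature is a tensor. -/
theorem riemannCLM_eq [FiniteDimensional ℝ E] {S : Set E} {f : E → E}
    {G G' : E → E →L[ℝ] E →L[ℝ] ℝ} {c : ℝ} {z : E} (hz : z ∈ S)
    (h : ∀ᶠ y in 𝓝[S] z, IsPullbackAt S f G G' c y) (hc : c ≠ 0)
    (hS : UniqueDiffOn ℝ S) (hS' : S ⊆ closure (interior S))
    (hG' : ContDiffWithinAt ℝ 2 G' S z) (a b w : E) :
    fderivWithin ℝ f S z (riemannCLM S G' z b w a) =
      riemannCLM S G (f z) (fderivWithin ℝ f S z b) (fderivWithin ℝ f S z w)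
        (fderivWithin ℝ f S z a) := by
  have hcomplete : CompleteSpace E := FiniteDimensional.complete ℝ E
  have h0 : IsPullbackAt S f G G' c z := h.self_of_nhdsWithin hz
  have hΓ : DifferentiableWithinAt ℝ (christoffelCLM S G) S (f z) :=
    (contDiffWithinAt_christoffelCLM hS h0.map_mem h0.contDiff_G h0.inv_G).differentiableWithinAt
      (by norm_num)
  have hΓ' : DifferentiableWithinAt ℝ (christoffelCLM S G') S z :=
    (contDiffWithinAt_christoffelCLM hS hz hG' h0.inv_G').differentiableWithinAt (by norm_num)
  have hD := h0.hasFDerivWithinAt_fderiv hS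
  have hD2 : HasFDerivWithinAt (fderivWithin ℝ (fderivWithin ℝ f S) S)
      (fderivWithin ℝ (fderivWithin ℝ (fderivWithin ℝ f S) S) S z) S z :=
    (((h0.contDiff_fderiv hS).fderivWithin_right (m := 1) hS (by norm_num [one_add_one_eq_two])
      hz).differentiableWithinAt (by norm_num)).hasFDerivWithinAt
  have hΓf := h0.hasFDerivWithinAt_comp hΓ
  -- The transformation law of the Christoffel symbols, which holds at all points near `z`,
  -- differentiated in the direction `a`.
  have key : ∀ a b : E, fderivWithin ℝ (fderivWithin ℝ f S) S z a (christoffelCLM S G' z b w) +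
      fderivWithin ℝ f S z (fderivWithin ℝ (christoffelCLM S G') S z a b w) =
      fderivWithin ℝ (christoffelCLM S G) S (f z) (fderivWithin ℝ f S z a)
        (fderivWithin ℝ f S z b) (fderivWithin ℝ f S z w) +
      christoffelCLM S G (f z) (fderivWithin ℝ (fderivWithin ℝ f S) S z a b)
        (fderivWithin ℝ f S z w) +
      christoffelCLM S G (f z) (fderivWithin ℝ f S z b)
        (fderivWithin ℝ (fderivWithin ℝ f S) S z a w) +
      fderivWithin ℝ (fderivWithin ℝ (fderivWithin ℝ f S) S) S z a b w := by
    intro a b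
    have hl := hD.clm_apply ((hΓ'.hasFDerivWithinAt.clm_apply
      (hasFDerivWithinAt_const b z S)).clm_apply (hasFDerivWithinAt_const w z S))
    have hr := ((hΓf.clm_apply (hD.clm_apply (hasFDerivWithinAt_const b z S))).clm_apply
      (hD.clm_apply (hasFDerivWithinAt_const w z S))).add ((hD2.clm_apply
        (hasFDerivWithinAt_const b z S)).clm_apply (hasFDerivWithinAt_const w z S))
    have hl' := hl.congr_of_eventuallyEq
      (h.mono fun y hy => (hy.christoffel_eq hc hS hS' b w).symm)
      (h0.christoffel_eq hc hS hS' b w).symm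
    have := DFunLike.congr_fun ((hS z hz).eq hl' hr) a
    simp only [add_apply, ContinuousLinearMap.comp_apply, ContinuousLinearMap.flip_apply,
      zero_apply, map_zero, zero_add] at this
    rw [add_comm, this]
    abel
  have c1 := h0.christoffel_eq hc hS hS'
  simp only [riemannCLM, add_apply, sub_apply,
    ContinuousLinearMap.flip_apply, ContinuousLinearMap.comp_apply, map_add, map_sub]
  -- Antisymmetrising in `a` and `b` removes the third derivatives of f, and the second-derivative
  -- terms cancel against those produced by the quadratic terms in Γ.
  have k1 := key a b
  have k2 := key b a
  rw [c1 a, c1 b w, c1 b, c1 a w, eq_sub_of_add_eq' k1, eq_sub_of_add_eq' k2,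
    h0.symm_snd hS hS' b a, h0.symm_thd hS hS' b a, map_add, map_add]
  abel

end WeightedYamabe
end

/-! ### Naturality of Ricci, scalar curvature, Hessian and gradient -/

noncomputable section

open Filter Topology

namespace WeightedYamabe

theorem coordVec_apply {n : ℕ} (i j : Fin n) : coordVec i j = if j = i then (1 : ℝ) else 0 := by
  simp [coordVec]

theorem sum_coordVec {n : ℕ} (v : Coord n) : ∑ k, v k • coordVec k = v := by
  ext j
  simp [coordVec_apply]

/-- As a basis-free trace, the Ricci curvature is invariant under conjugation by the derivative of a
coordinate change. -/
theorem ricci_eq_trace {n : ℕ} {S : Set (Coord n)} {G : Coord n → Coord n →L[ℝ] Coord n →L[ℝ] ℝ}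
    {z : Coord n} (hS : UniqueDiffWithinAt ℝ S z)
    (hΓ : DifferentiableWithinAt ℝ (christoffelCLM S G) S z) (v w : Coord n) :
    ricci S G z v w = LinearMap.trace ℝ (Coord n) (riemannCLM S G z v w) := by
  rw [LinearMap.trace_eq_matrix_trace ℝ (EuclideanSpace.basisFun (Fin n) ℝ).toBasis, ricci,
    Matrix.trace]
  refine Finset.sum_congr rfl fun i _ => ?_
  rw [← riemannCLM_apply hS hΓ]
  simp [LinearMap.toMatrix_apply, coordVec]

/-- `metricTrace` takes arbitrary functions of two vectors, so bilinearity has to be supplied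
separately before its transformation law `metricTrace_eq` applies. -/
theorem isLinearMap_ricci_left {n : ℕ} {S : Set (Coord n)}
    {G : Coord n → Coord n →L[ℝ] Coord n →L[ℝ] ℝ}
    {z : Coord n} (hS : UniqueDiffWithinAt ℝ S z)
    (hΓ : DifferentiableWithinAt ℝ (christoffelCLM S G) S z) (w : Coord n) :
    IsLinearMap ℝ (fun v => ricci S G z v w) := by
  have h : (fun v => ricci S G z v w) = fun v => ∑ i, riemannCLM S G z v w (coordVec i) i := by
    funext v
    exact Finset.sum_congr rfl fun i _ => by rw [riemannCLM_apply hS hΓ]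
  rw [h]
  constructor
  · intro a b
    rw [← Finset.sum_add_distrib]
    refine Finset.sum_congr rfl fun i _ => ?_
    simp [riemannCLM]
    ring
  · intro a b
    rw [Finset.smul_sum]
    refine Finset.sum_congr rfl fun i _ => ?_
    simp [riemannCLM]
    ring

theorem isLinearMap_ricci_right {n : ℕ} {S : Set (Coord n)}
    {G : Coord n → Coord n →L[ℝ] Coord n →L[ℝ] ℝ}
    {z : Coord n} (hS : UniqueDiffWithinAt ℝ S z)
    (hΓ : DifferentiableWithinAt ℝ (christoffelCLM S G) S z) (v : Coord n) :
    IsLinearMap ℝ (ricci S G z v) := by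
  have h : ricci S G z v = fun w => ∑ i, riemannCLM S G z v w (coordVec i) i := by
    funext w
    exact Finset.sum_congr rfl fun i _ => by rw [riemannCLM_apply hS hΓ]
  rw [h]
  constructor
  · intro a b
    rw [← Finset.sum_add_distrib]
    refine Finset.sum_congr rfl fun i _ => ?_
    simp [riemannCLM]
    ring
  · intro a b
    rw [Finset.smul_sum]
    refine Finset.sum_congr rfl fun i _ => ?_
    simp [riemannCLM]
    ring

/-- The trace is natural under a linear isomorphism which maps the spans of coordinate vectors
to each other. -/
theorem metricTrace_eq {n : ℕ} {ι : Type} [Fintype ι] [DecidableEq ι] {e : ι → Fin n}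
    (he : Function.Injective e) {g g' : Coord n →L[ℝ] Coord n →L[ℝ] ℝ}
    {B B' : Coord n → Coord n → ℝ} {D D' : Coord n →L[ℝ] Coord n} {a c : ℝ} (hc : c ≠ 0)
    (hDD' : ∀ v, D (D' v) = v)
    (hD : ∀ i, ∀ k ∉ range e, D (coordVec (e i)) k = 0)
    (hD' : ∀ i, ∀ k ∉ range e, D' (coordVec (e i)) k = 0)
    (hB1 : ∀ v, IsLinearMap ℝ (fun u => B u v)) (hB2 : ∀ u, IsLinearMap ℝ (B u))
    (hg : ∀ u v, g' u v = c * g (D u) (D v))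
    (hB : ∀ i j, B' (coordVec (e i)) (coordVec (e j)) =
      a * B (D (coordVec (e i))) (D (coordVec (e j)))) :
    metricTrace g' (fun i => coordVec (e i)) B' =
      a * c⁻¹ * metricTrace g (fun i => coordVec (e i)) B := by
  have expand : ∀ v : Coord n, (∀ k ∉ range e, v k = 0) → v = ∑ k, v (e k) • coordVec (e k) := by
    intro v hv
    conv_lhs => rw [← sum_coordVec v]
    rw [← Finset.sum_image (f := fun k => v k • coordVec k) (g := e) (s := Finset.univ)
      (fun _ _ _ _ h => he h)]
    refine (Finset.sum_subset (Finset.subset_univ _) fun k _ hk => ?_).symm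
    rw [hv k (by simpa using hk), zero_smul]
  -- P and Q are the matrices of D and D' on the span of the chosen coordinate vectors. The family
  -- is general so as to cover both the full basis and the tangential vectors at the boundary.
  let P : Matrix ι ι ℝ := Matrix.of fun k i => D (coordVec (e i)) (e k)
  let Q : Matrix ι ι ℝ := Matrix.of fun k i => D' (coordVec (e i)) (e k)
  have hP : ∀ i, D (coordVec (e i)) = ∑ k, P k i • coordVec (e k) := fun i => expand _ (hD i)
  have hQ : ∀ i, D' (coordVec (e i)) = ∑ k, Q k i • coordVec (e k) := fun i => expand _ (hD' i)
  have hPQ : P * Q = 1 := by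
    ext l j
    have h1 := congrArg (fun v : Coord n => v (e l)) (hDD' (coordVec (e j)))
    simp only [hQ, map_sum, map_smul] at h1
    rw [Matrix.mul_apply, Matrix.one_apply]
    have h2 : (coordVec (e j) : Coord n) (e l) = if l = j then 1 else 0 := by
      rw [coordVec_apply]
      simp [he.eq_iff]
    rw [← h2, ← h1]
    simp [P, mul_comm]
  let Γ : Matrix ι ι ℝ := Matrix.of fun k l => g (coordVec (e k)) (coordVec (e l))
  let β : Matrix ι ι ℝ := Matrix.of fun k l => B (coordVec (e k)) (coordVec (e l))
  have bil : ∀ (b : Coord n → Coord n → ℝ), (∀ v, IsLinearMap ℝ (fun u => b u v)) →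
      (∀ u, IsLinearMap ℝ (b u)) → ∀ i j, b (D (coordVec (e i))) (D (coordVec (e j))) =
        (P.transpose * (Matrix.of fun k l => b (coordVec (e k)) (coordVec (e l))) * P) i j := by
    intro b hb1 hb2 i j
    have l1 : ∀ v (s : ι → ℝ), b (∑ k, s k • coordVec (e k)) v =
        ∑ k, s k * b (coordVec (e k)) v := by
      intro v s
      have := map_sum (IsLinearMap.mk' _ (hb1 v)) (fun k => s k • coordVec (e k)) Finset.univ
      simpa only [IsLinearMap.mk'_apply, map_smul, smul_eq_mul] using this
    have l2 : ∀ u (s : ι → ℝ), b u (∑ k, s k • coordVec (e k)) =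
        ∑ k, s k * b u (coordVec (e k)) := by
      intro v s
      have := map_sum (IsLinearMap.mk' _ (hb2 v)) (fun k => s k • coordVec (e k)) Finset.univ
      simpa only [IsLinearMap.mk'_apply, map_smul, smul_eq_mul] using this
    rw [hP, hP, l2, Matrix.mul_apply]
    refine Finset.sum_congr rfl fun l _ => ?_
    rw [l1, Matrix.mul_apply, mul_comm]
    rfl
  have hΓ' : (Matrix.of fun k l => g' (coordVec (e k)) (coordVec (e l))) =
      (c • (1 : Matrix ι ι ℝ)) * (P.transpose * Γ * P) := by
    ext i j
    simp only [Matrix.smul_mul, one_mul, Matrix.smul_apply, Matrix.of_apply, hg, smul_eq_mul]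
    rw [bil (fun u v => g u v) (fun v => ⟨by simp, by simp⟩) (fun v => ⟨by simp, by simp⟩)]
  have hβ' : (Matrix.of fun k l => B' (coordVec (e k)) (coordVec (e l))) =
      a • (P.transpose * β * P) := by
    ext i j
    simp only [Matrix.smul_apply, Matrix.of_apply, hB, smul_eq_mul]
    rw [bil B hB1 hB2]
  have tr : ∀ (g : Coord n →L[ℝ] Coord n →L[ℝ] ℝ) (B : Coord n → Coord n → ℝ),
      metricTrace g (fun i => coordVec (e i)) B =
      ((Matrix.of fun k l => g (coordVec (e k)) (coordVec (e l)))⁻¹ *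
        (Matrix.of fun k l => B (coordVec (e k)) (coordVec (e l))).transpose).trace := by
    intro g B
    simp [metricTrace, Matrix.trace, Matrix.mul_apply]
  have hQP : Q * P = 1 := mul_eq_one_comm.1 hPQ
  have hPi : P⁻¹ = Q := Matrix.inv_eq_right_inv hPQ
  have hPt : P.transpose⁻¹ = Q.transpose := by rw [← Matrix.transpose_nonsing_inv, hPi]
  have hci : (c • (1 : Matrix ι ι ℝ))⁻¹ = c⁻¹ • 1 :=
    Matrix.inv_eq_right_inv (by simp [smul_smul, hc])
  -- The Gram matrix becomes c PᵀΓP and the form becomes a PᵀβP, so the change of basis cancels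
  -- under the trace. Invertibility of Γ is not needed, as `Matrix.mul_inv_rev` holds for the total
  -- matrix inverse.
  rw [tr, tr, hΓ', hβ', Matrix.mul_inv_rev, Matrix.mul_inv_rev, Matrix.mul_inv_rev, hci, hPi, hPt]
  change _ = a * c⁻¹ * (Γ⁻¹ * β.transpose).trace
  have h3 : Q * (Γ⁻¹ * Q.transpose) * c⁻¹ • (1 : Matrix ι ι ℝ) *
      (a • (P.transpose * β * P)).transpose =
      (a * c⁻¹) • (Q * (Γ⁻¹ * β.transpose * P)) := by
    have h4 : Q.transpose * P.transpose = 1 := by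
      rw [← Matrix.transpose_mul, hPQ, Matrix.transpose_one]
    simp only [Matrix.transpose_smul, Matrix.transpose_mul, Matrix.transpose_transpose,
      Matrix.mul_smul, Matrix.smul_mul, mul_one, smul_smul]
    congr 1
    calc Q * (Γ⁻¹ * Q.transpose) * (P.transpose * (β.transpose * P))
        = Q * (Γ⁻¹ * (Q.transpose * P.transpose) * (β.transpose * P)) := by
          simp only [Matrix.mul_assoc]
      _ = _ := by rw [h4, mul_one, Matrix.mul_assoc]
  rw [h3, Matrix.trace_smul, Matrix.trace_mul_comm, Matrix.mul_assoc, hPQ, mul_one, smul_eq_mul]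

section Pullback

variable {n : ℕ} {S : Set (Coord n)} {f : Coord n → Coord n}
  {G G' : Coord n → Coord n →L[ℝ] Coord n →L[ℝ] ℝ} {c : ℝ} {z : Coord n}

/-- By tensoriality, Df conjugates the endomorphism u ↦ R'(u,v)w into its counterpart for G, and
conjugate endomorphisms have equal traces. The factor c drops out. -/
theorem ricci_pullback (hz : z ∈ S)
    (h : ∀ᶠ y in 𝓝[S] z, IsPullbackAt S f G G' c y) (hc : c ≠ 0)
    (hS : UniqueDiffOn ℝ S) (hS' : S ⊆ closure (interior S))
    (hG' : ContDiffWithinAt ℝ 2 G' S z) (v w : Coord n) :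
    ricci S G' z v w = ricci S G (f z) (fderivWithin ℝ f S z v) (fderivWithin ℝ f S z w) := by
  have h0 : IsPullbackAt S f G G' c z := h.self_of_nhdsWithin hz
  have hΓ : DifferentiableWithinAt ℝ (christoffelCLM S G) S (f z) :=
    (contDiffWithinAt_christoffelCLM hS h0.map_mem h0.contDiff_G h0.inv_G).differentiableWithinAt
      (by norm_num)
  have hΓ' : DifferentiableWithinAt ℝ (christoffelCLM S G') S z :=
    (contDiffWithinAt_christoffelCLM hS hz hG' h0.inv_G').differentiableWithinAt (by norm_num)
  rw [ricci_eq_trace (hS z hz) hΓ', ricci_eq_trace (hS _ h0.map_mem) hΓ]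
  obtain ⟨e, he⟩ := h0.inv_f
  rw [← LinearMap.trace_conj' _ e.toLinearEquiv]
  congr 1
  ext x : 1
  rw [LinearEquiv.conj_apply]
  have h1 := riemannCLM_eq hz h hc hS hS' hG' (e.symm x) v w
  rw [← he] at h1 ⊢
  refine Eq.trans ?_ (h1.trans ?_)
  · rfl
  · simp

theorem metricTrace_pullback {B B' : Coord n → Coord n → ℝ} (h : IsPullbackAt S f G G' c z)
    (hc : c ≠ 0) (hB1 : ∀ v, IsLinearMap ℝ (fun u => B u v)) (hB2 : ∀ u, IsLinearMap ℝ (B u))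
    (hB : ∀ u v, B' u v = B (fderivWithin ℝ f S z u) (fderivWithin ℝ f S z v)) :
    metricTrace (G' z) coordVec B' = c⁻¹ * metricTrace (G (f z)) coordVec B := by
  have := metricTrace_eq (e := id) (a := 1) (g := G (f z)) (g' := G' z) (B := B) (B' := B')
    (D := fderivWithin ℝ f S z) (D' := (fderivWithin ℝ f S z).inverse) Function.injective_id hc
    (fun v => h.inv_f.self_apply_inverse v) (by simp) (by simp) hB1 hB2 h.apply_eq
    (fun i j => by rw [one_mul, hB])
  simpa using this

theorem scalar_pullback (hz : z ∈ S)
    (h : ∀ᶠ y in 𝓝[S] z, IsPullbackAt S f G G' c y) (hc : c ≠ 0)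
    (hS : UniqueDiffOn ℝ S) (hS' : S ⊆ closure (interior S))
    (hG' : ContDiffWithinAt ℝ 2 G' S z) :
    metricTrace (G' z) coordVec (ricci S G' z) =
      c⁻¹ * metricTrace (G (f z)) coordVec (ricci S G (f z)) := by
  have h0 : IsPullbackAt S f G G' c z := h.self_of_nhdsWithin hz
  have hΓ : DifferentiableWithinAt ℝ (christoffelCLM S G) S (f z) :=
    (contDiffWithinAt_christoffelCLM hS h0.map_mem h0.contDiff_G h0.inv_G).differentiableWithinAt
      (by norm_num)
  exact metricTrace_pullback h0 hc (isLinearMap_ricci_left (hS _ h0.map_mem) hΓ)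
    (isLinearMap_ricci_right (hS _ h0.map_mem) hΓ) (ricci_pullback hz h hc hS hS' hG')

variable {φ φ' : Coord n → ℝ} {r : ℝ}

theorem fderivWithin_pullback (h : IsPullbackAt S f G G' c z) (hS : UniqueDiffOn ℝ S)
    (hφ : DifferentiableWithinAt ℝ φ S (f z)) (hφ' : φ' =ᶠ[𝓝[S] z] fun y => φ (f y) - r)
    (v : Coord n) :
    fderivWithin ℝ φ' S z v = fderivWithin ℝ φ S (f z) (fderivWithin ℝ f S z v) := by
  have h1 := ((h.hasFDerivWithinAt_comp hφ).sub_const r).congr_of_eventuallyEq hφ'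
    (hφ'.self_of_nhdsWithin h.mem)
  rw [h1.fderivWithin (hS z h.mem)]
  rfl

/-- The chain rule produces the extra term dφ(D²f(u,v)), which is exactly cancelled by the
inhomogeneous term of the Christoffel transformation law. -/
theorem hessian_pullback (hz : z ∈ S)
    (h : ∀ᶠ y in 𝓝[S] z, IsPullbackAt S f G G' c y) (hc : c ≠ 0)
    (hS : UniqueDiffOn ℝ S) (hS' : S ⊆ closure (interior S))
    (hφ : ContDiffWithinAt ℝ 2 φ S (f z)) (hφ' : φ' =ᶠ[𝓝[S] z] fun y => φ (f y) - r)
    (u v : Coord n) :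
    hessian S G' φ' z u v =
      hessian S G φ (f z) (fderivWithin ℝ f S z u) (fderivWithin ℝ f S z v) := by
  have h0 : IsPullbackAt S f G G' c z := h.self_of_nhdsWithin hz
  have hd : ∀ᶠ y in 𝓝[S] (f z), DifferentiableWithinAt ℝ φ S y := by
    have := hφ.eventually (by simp)
    rw [insert_eq_of_mem h0.map_mem] at this
    exact this.mono fun y hy => hy.differentiableWithinAt (by norm_num)
  have h1 : (fun y => fderivWithin ℝ φ' S y v) =ᶠ[𝓝[S] z]
      fun y => fderivWithin ℝ φ S (f y) (fderivWithin ℝ f S y v) := by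
    filter_upwards [h, h0.tendsto.eventually hd, eventually_eventually_nhdsWithin.2 hφ',
      self_mem_nhdsWithin] with y hy1 hy2 hy3 hy4
    exact fderivWithin_pullback hy1 hS hy2 hy3 v
  have h2 : DifferentiableWithinAt ℝ (fderivWithin ℝ φ S) S (f z) :=
    (hφ.fderivWithin_right (m := 1) hS (by norm_num [one_add_one_eq_two])
      h0.map_mem).differentiableWithinAt (by norm_num)
  have h3 := (h0.hasFDerivWithinAt_comp h2).clm_apply
    ((h0.hasFDerivWithinAt_fderiv hS).clm_apply (hasFDerivWithinAt_const v z S))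
  have h4 := (h3.congr_of_eventuallyEq h1 (h1.self_of_nhdsWithin hz)).fderivWithin (hS z hz)
  have h5 : fderivWithin ℝ (fun y => fderivWithin ℝ φ S y (fderivWithin ℝ f S z v)) S (f z)
      (fderivWithin ℝ f S z u) = fderivWithin ℝ (fderivWithin ℝ φ S) S (f z)
        (fderivWithin ℝ f S z u) (fderivWithin ℝ f S z v) := by
    rw [(h2.hasFDerivWithinAt.clm_apply (hasFDerivWithinAt_const _ _ S)).fderivWithin
      (hS _ h0.map_mem)]
    simp
  rw [hessian, hessian, h4, h5,
    fderivWithin_pullback h0 hS (hφ.differentiableWithinAt (by norm_num)) hφ',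
    ← christoffelCLM_apply, ← christoffelCLM_apply, h0.christoffel_eq hc hS hS', map_add]
  simp
  ring

theorem isLinearMap_hessian_left (v : Coord n) :
    IsLinearMap ℝ (fun u => hessian S G φ z u v) := by
  constructor <;> intros <;>
  simp only [hessian, ← christoffelCLM_apply, map_add, add_apply, map_smul, smul_apply,
    smul_eq_mul] <;> ring

/-- In contrast to the left slot, `v` sits inside the function being differentiated; C² regularity
allows it to be moved outside. -/
theorem isLinearMap_hessian_right (hS : UniqueDiffOn ℝ S) (hz : z ∈ S)
    (hφ : ContDiffWithinAt ℝ 2 φ S z) (u : Coord n) :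
    IsLinearMap ℝ (hessian S G φ z u) := by
  have h2 : DifferentiableWithinAt ℝ (fderivWithin ℝ φ S) S z :=
    (hφ.fderivWithin_right (m := 1) hS (by norm_num [one_add_one_eq_two])
      hz).differentiableWithinAt (by norm_num)
  have h5 : ∀ v, fderivWithin ℝ (fun y => fderivWithin ℝ φ S y v) S z u =
      fderivWithin ℝ (fderivWithin ℝ φ S) S z u v := by
    intro v
    rw [(h2.hasFDerivWithinAt.clm_apply (hasFDerivWithinAt_const _ _ S)).fderivWithin
      (hS _ hz)]
    simp
  have h6 : hessian S G φ z u = fun v => fderivWithin ℝ (fderivWithin ℝ φ S) S z u v -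
      fderivWithin ℝ φ S z (christoffelCLM S G z u v) := by
    funext v
    rw [hessian, h5, christoffelCLM_apply]
  rw [h6]
  constructor <;> intros <;> simp only [map_add, map_smul, smul_eq_mul] <;> ring

theorem laplacian_pullback (hz : z ∈ S)
    (h : ∀ᶠ y in 𝓝[S] z, IsPullbackAt S f G G' c y) (hc : c ≠ 0)
    (hS : UniqueDiffOn ℝ S) (hS' : S ⊆ closure (interior S))
    (hφ : ContDiffWithinAt ℝ 2 φ S (f z)) (hφ' : φ' =ᶠ[𝓝[S] z] fun y => φ (f y) - r) :
    metricTrace (G' z) coordVec (hessian S G' φ' z) =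
      c⁻¹ * metricTrace (G (f z)) coordVec (hessian S G φ (f z)) := by
  have h0 : IsPullbackAt S f G G' c z := h.self_of_nhdsWithin hz
  exact metricTrace_pullback h0 hc isLinearMap_hessian_left
    (isLinearMap_hessian_right hS h0.map_mem hφ) (hessian_pullback hz h hc hS hS' hφ hφ')

theorem gradNormSq_pullback (h : IsPullbackAt S f G G' c z) (hc : c ≠ 0)
    (hS : UniqueDiffOn ℝ S)
    (hφ : DifferentiableWithinAt ℝ φ S (f z)) (hφ' : φ' =ᶠ[𝓝[S] z] fun y => φ (f y) - r) :
    metricTrace (G' z) coordVec (fun u v => fderivWithin ℝ φ' S z u * fderivWithin ℝ φ' S z v) =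
      c⁻¹ * metricTrace (G (f z)) coordVec
        (fun u v => fderivWithin ℝ φ S (f z) u * fderivWithin ℝ φ S (f z) v) := by
  refine metricTrace_pullback h hc (fun v => ?_) (fun v => ?_)
    (fun u v => by simp only [fderivWithin_pullback h hS hφ hφ'])
  · constructor <;> intros <;> simp <;> ring
  · constructor <;> intros <;> simp <;> ring

end Pullback

end WeightedYamabe
end

/-! ### The outward normal and the mean curvature -/

noncomputable section

open Filter Topology

namespace WeightedYamabe

section Boundary

variable {n : ℕ} [NeZero n]

/-- The inward coordinate of the half-space as a linear form. -/
abbrev inwardCoord (n : ℕ) [NeZero n] : Coord n →L[ℝ] ℝ := EuclideanSpace.proj 0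

/-- The outward unit normal of the half-space with respect to an inner product. -/
def unitNormal (g : Coord n →L[ℝ] Coord n →L[ℝ] ℝ) : Coord n :=
  -(Real.sqrt (inwardCoord n (g.inverse (inwardCoord n))))⁻¹ • g.inverse (inwardCoord n)

/-- The normal is a multiple of the gradient of x₀, so pairing with it sees only the zeroth
coordinate and annihilates tangential vectors. -/
theorem apply_unitNormal {g : Coord n →L[ℝ] Coord n →L[ℝ] ℝ} (hg : g.IsInvertible) (v : Coord n) :
    g (unitNormal g) v =
      -(Real.sqrt (inwardCoord n (g.inverse (inwardCoord n))))⁻¹ * v 0 := by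
  rw [unitNormal, map_smul, hg.self_apply_inverse]
  simp

/-- The normal vector is natural under maps which preserve the boundary direction. -/
theorem map_unitNormal {g g' : Coord n →L[ℝ] Coord n →L[ℝ] ℝ} {D : Coord n →L[ℝ] Coord n}
    {a c : ℝ} (ha : 0 < a) (hc : 0 < c) (hg : g.IsInvertible) (hg' : g'.IsInvertible)
    (hD : D.IsInvertible) (h : ∀ u v, g' u v = c * g (D u) (D v))
    (hDa : ∀ v, D v 0 = a * v 0) :
    D (unitNormal g') = (Real.sqrt c)⁻¹ • unitNormal g := by
  have h1 : D (g'.inverse (inwardCoord n)) = (c * a)⁻¹ • g.inverse (inwardCoord n) := by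
    refine hg.injective ?_
    ext w
    obtain ⟨v, rfl⟩ := hD.surjective w
    have h2 := h (g'.inverse (inwardCoord n)) v
    rw [hg'.self_apply_inverse] at h2
    rw [map_smul, hg.self_apply_inverse]
    have h3 : v 0 = c * g (D (g'.inverse (inwardCoord n))) (D v) := h2
    have h4 : (c * a)⁻¹ * D v 0 = g (D (g'.inverse (inwardCoord n))) (D v) := by
      rw [hDa, h3]
      field_simp
    exact h4.symm
  -- This is |∇x₀|² for g'. On normalising, the factor a, which measures how D stretches x₀, cancels
  -- and only c^(-1/2) remains.
  have h5 : inwardCoord n (g'.inverse (inwardCoord n)) =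
      (c * a ^ 2)⁻¹ * inwardCoord n (g.inverse (inwardCoord n)) := by
    have h6 := hDa (g'.inverse (inwardCoord n))
    rw [h1] at h6
    have h7 : (c * a)⁻¹ * inwardCoord n (g.inverse (inwardCoord n)) =
      a * inwardCoord n (g'.inverse (inwardCoord n)) := h6
    rw [mul_inv, pow_two, mul_inv, ← mul_assoc, ← mul_inv, mul_right_comm, h7]
    field_simp
  rw [unitNormal, map_smul, h1, h5, unitNormal, smul_smul, smul_smul,
    Real.sqrt_mul (by positivity), Real.sqrt_inv, Real.sqrt_mul hc.le, Real.sqrt_sq ha.le]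
  congr 1
  rw [mul_inv, inv_inv]
  have hs : Real.sqrt c * Real.sqrt c = c := Real.mul_self_sqrt hc.le
  have hs0 : Real.sqrt c ≠ 0 := (Real.sqrt_pos.2 hc).ne'
  have hs1 : c⁻¹ = (Real.sqrt c)⁻¹ * (Real.sqrt c)⁻¹ := by rw [← mul_inv, hs]
  rw [mul_inv, hs1]
  field_simp

variable {S : Set (Coord n)}

/-- Along the line y + t v, which stays in the boundary hyperplane, the zeroth coordinate of g
vanishes near t = 0. It is applied to f and also to y ↦ Df_y(v), which shows that D²f(u,v) is
tangential for tangential u, v. -/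
theorem fderiv_apply_zero_of_tangent (hS0 : S = {y : Coord n | 0 ≤ y 0}) {g : Coord n → Coord n}
    {L : Coord n →L[ℝ] Coord n} {y v : Coord n} (hg : HasFDerivWithinAt g L S y)
    (h : ∀ᶠ w in 𝓝[S] y, w 0 = 0 → g w 0 = 0) (hy : y 0 = 0) (hv : v 0 = 0) : L v 0 = 0 := by
  let γ : ℝ → Coord n := fun t => y + t • v
  have hγ0 : ∀ t, γ t 0 = 0 := fun t => by simp [γ, hy, hv]
  have hγS : ∀ t, γ t ∈ S := fun t => by rw [hS0]; exact (hγ0 t).ge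
  have hγ : HasDerivAt γ v 0 := by
    simpa [γ] using ((hasDerivAt_id (0 : ℝ)).smul_const v).const_add y
  have hγ1 : γ 0 = y := by simp [γ]
  have h1 : HasDerivAt (g ∘ γ) (L v) 0 := by
    rw [← hγ1] at hg
    exact hg.comp_hasDerivAt 0 hγ (Eventually.of_forall hγS)
  have h2 : HasDerivAt (fun t => inwardCoord n (g (γ t))) (inwardCoord n (L v)) 0 :=
    (inwardCoord n).hasFDerivAt.comp_hasDerivAt 0 h1
  have h3 : Tendsto γ (𝓝 0) (𝓝[S] y) := by
    rw [← hγ1]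
    exact tendsto_nhdsWithin_iff.2 ⟨hγ.continuousAt, Eventually.of_forall hγS⟩
  have h4 : (fun t => inwardCoord n (g (γ t))) =ᶠ[𝓝 0] fun _ => 0 :=
    (h3.eventually h).mono fun t ht => ht (hγ0 t)
  exact h2.unique ((hasDerivAt_const 0 (0 : ℝ)).congr_of_eventuallyEq h4)

namespace IsPullbackAt

variable {f : Coord n → Coord n}
  {G G' : Coord n → Coord n →L[ℝ] Coord n →L[ℝ] ℝ} {c : ℝ} {z : Coord n}

theorem fderiv_zero_of_tangent (h : IsPullbackAt S f G G' c z)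
    (hS0 : S = {y : Coord n | 0 ≤ y 0}) (hbd : ∀ᶠ y in 𝓝[S] z, y 0 = 0 → f y 0 = 0)
    (hz0 : z 0 = 0) {v : Coord n} (hv : v 0 = 0) : fderivWithin ℝ f S z v 0 = 0 :=
  fderiv_apply_zero_of_tangent hS0 h.hasFDerivWithinAt hbd hz0 hv

/-- Df preserves the kernel of dx₀, so dx₀ ∘ Df = a dx₀. Surjectivity of Df gives a ≠ 0, and a ≥ 0
because x₀ ∘ f attains its minimum 0 over S near z at z itself. The sign is what sends outward
normals to outward normals. -/
theorem exists_pos_inwardCoord (h : IsPullbackAt S f G G' c z)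
    (hS0 : S = {y : Coord n | 0 ≤ y 0}) (hbd : ∀ᶠ y in 𝓝[S] z, y 0 = 0 → f y 0 = 0)
    (hz0 : z 0 = 0) : ∃ a > 0, ∀ v, fderivWithin ℝ f S z v 0 = a * v 0 := by
  set D := fderivWithin ℝ f S z with hD
  have h0 : ∀ v : Coord n, v 0 = 0 → D v 0 = 0 := fun v hv =>
    h.fderiv_zero_of_tangent hS0 hbd hz0 hv
  have h1 : ∀ v, D v 0 = D (coordVec 0) 0 * v 0 := by
    intro v
    have h2 := h0 (v - v 0 • coordVec 0) (by simp [coordVec_apply])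
    rw [map_sub, map_smul] at h2
    have h3 : D v 0 - v 0 * D (coordVec 0) 0 = 0 := h2
    linarith
  have hne : D (coordVec 0) 0 ≠ 0 := by
    intro h2
    obtain ⟨w, hw⟩ := h.inv_f.surjective (coordVec 0)
    have h3 := h1 w
    rw [hD, hw, ← hD, h2, zero_mul, coordVec_apply, if_pos rfl] at h3
    exact one_ne_zero h3
  have hmin : IsLocalMinOn (fun y => inwardCoord n (f y)) S z := by
    filter_upwards [h.maps] with y hy
    have h2 : f z 0 = 0 := hbd.self_of_nhdsWithin h.mem hz0
    rw [hS0] at hy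
    change f z 0 ≤ f y 0
    rw [h2]
    exact hy
  have hder : HasFDerivWithinAt (fun y => inwardCoord n (f y)) (inwardCoord n ∘L D) S z :=
    (inwardCoord n).hasFDerivAt.comp_hasFDerivWithinAt z h.hasFDerivWithinAt
  have hcone : (coordVec 0 : Coord n) ∈ posTangentConeAt S z := by
    refine mem_posTangentConeAt_of_segment_subset ?_
    rintro _ ⟨a, b, ha, hb, hab, rfl⟩
    rw [hS0]
    change 0 ≤ (a • z + b • (z + coordVec 0) : Coord n) 0
    simp [hz0, coordVec_apply, hb]
  have hnn : 0 ≤ D (coordVec 0) 0 := hmin.hasFDerivWithinAt_nonneg hder hcone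
  exact ⟨_, lt_of_le_of_ne hnn hne.symm, h1⟩

theorem map_unitNormal (h : IsPullbackAt S f G G' c z) (hc : 0 < c)
    (hS0 : S = {y : Coord n | 0 ≤ y 0}) (hbd : ∀ᶠ y in 𝓝[S] z, y 0 = 0 → f y 0 = 0)
    (hz0 : z 0 = 0) :
    fderivWithin ℝ f S z (unitNormal (G' z)) = (Real.sqrt c)⁻¹ • unitNormal (G (f z)) := by
  obtain ⟨a, ha, hDa⟩ := h.exists_pos_inwardCoord hS0 hbd hz0
  exact WeightedYamabe.map_unitNormal ha hc h.inv_G h.inv_G' h.inv_f h.apply_eq hDa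

end IsPullbackAt

/-- The mean curvature of the boundary is natural. -/
theorem mean_pullback {f : Coord n → Coord n}
    {G G' : Coord n → Coord n →L[ℝ] Coord n →L[ℝ] ℝ} {c : ℝ} {z : Coord n} (hz : z ∈ S)
    (h : ∀ᶠ y in 𝓝[S] z, IsPullbackAt S f G G' c y) (hc : 0 < c)
    (hS : UniqueDiffOn ℝ S) (hS' : S ⊆ closure (interior S))
    (hS0 : S = {y : Coord n | 0 ≤ y 0}) (hbd : ∀ᶠ y in 𝓝[S] z, y 0 = 0 → f y 0 = 0)
    (hz0 : z 0 = 0) :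
    metricTrace (G' z) (fun i : {i : Fin n // i ≠ 0} => coordVec i.1)
      (fun u v => -(G' z (unitNormal (G' z)) (christoffel S G' z u v))) =
    (Real.sqrt c)⁻¹ * metricTrace (G (f z)) (fun i : {i : Fin n // i ≠ 0} => coordVec i.1)
      (fun u v => -(G (f z) (unitNormal (G (f z))) (christoffel S G (f z) u v))) := by
  have h0 : IsPullbackAt S f G G' c z := h.self_of_nhdsWithin hz
  obtain ⟨a, ha, hDa⟩ := h0.exists_pos_inwardCoord hS0 hbd hz0
  -- The inhomogeneous term of the Christoffel law is tangential, hence invisible to the second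
  -- fundamental form.
  have hsnd : ∀ u v : Coord n, u 0 = 0 → v 0 = 0 →
      fderivWithin ℝ (fderivWithin ℝ f S) S z u v 0 = 0 := by
    intro u v hu hv
    have h1 := (h0.hasFDerivWithinAt_fderiv hS).clm_apply (hasFDerivWithinAt_const v z S)
    have h2 := fderiv_apply_zero_of_tangent hS0 h1 (v := u) ?_ hz0 hu
    · simpa using h2
    · filter_upwards [h, eventually_eventually_nhdsWithin.2 hbd] with y hy hy' hy0
      exact hy.fderiv_zero_of_tangent hS0 hy' hy0 hv
  have hne : ∀ i : {i : Fin n // i ≠ 0}, (coordVec i.1 : Coord n) 0 = 0 := fun i => by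
    rw [coordVec_apply, if_neg i.2.symm]
  have hrange : ∀ k : Fin n, k ∉ range (Subtype.val : {i : Fin n // i ≠ 0} → Fin n) → k = 0 := by
    intro k hk
    by_contra h1
    exact hk ⟨⟨k, h1⟩, rfl⟩
  -- The factors come from the metric in the second fundamental form (c), from the unit normal
  -- (c^(-1/2)) and from the trace (c⁻¹).
  have hsc : c * (Real.sqrt c)⁻¹ * c⁻¹ = (Real.sqrt c)⁻¹ := by field_simp
  rw [← hsc]
  refine metricTrace_eq (e := Subtype.val) (D := fderivWithin ℝ f S z)
    (D' := (fderivWithin ℝ f S z).inverse) Subtype.val_injective hc.ne'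
    (fun v => h0.inv_f.self_apply_inverse v) (fun i k hk => ?_) (fun i k hk => ?_)
    (fun v => ?_) (fun v => ?_) h0.apply_eq (fun i j => ?_)
  · rw [hrange k hk, hDa, hne, mul_zero]
  · have h1 := hDa ((fderivWithin ℝ f S z).inverse (coordVec i.1))
    rw [h0.inv_f.self_apply_inverse, hne] at h1
    rw [hrange k hk]
    exact (mul_eq_zero.1 h1.symm).resolve_left ha.ne'
  · constructor <;> intros <;>
    simp only [← christoffelCLM_apply, map_add, add_apply, map_smul, smul_apply, smul_eq_mul] <;>
    ring
  · constructor <;> intros <;>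
    simp only [← christoffelCLM_apply, map_add, map_smul, smul_eq_mul] <;> ring
  · rw [h0.apply_eq, h0.map_unitNormal hc hS0 hbd hz0, ← christoffelCLM_apply,
      ← christoffelCLM_apply, h0.christoffel_eq hc.ne' hS hS', map_add, map_smul, smul_apply,
      smul_apply, apply_unitNormal h0.inv_G _, apply_unitNormal h0.inv_G _, hsnd _ _ (hne i) (hne j),
      smul_eq_mul, smul_eq_mul]
    ring

end Boundary

end WeightedYamabe
end

/-! ### Fields of bilinear forms in charts and their pullbacks -/

noncomputable section

open Filter Topology

namespace WeightedYamabe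

section ChartForms

variable {E : Type*} [NormedAddCommGroup E] [NormedSpace ℝ E]
  {H : Type*} [TopologicalSpace H] {I : ModelWithCorners ℝ E H}
  {M : Type*} [TopologicalSpace M] [ChartedSpace H M]

/-- A field of bilinear forms on the tangent spaces, in the preferred chart at `p`. -/
def formRep (B : ∀ p : M, TangentSpace I p →L[ℝ] TangentSpace I p →L[ℝ] ℝ) (p : M) (z : E) :
    E →L[ℝ] E →L[ℝ] ℝ :=
  let b : E →L[ℝ] E →L[ℝ] ℝ := B ((extChartAt I p).symm z)
  let D : E →L[ℝ] E := mfderivWithin 𝓘(ℝ, E) I (extChartAt I p).symm (range I) z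
  b.bilinearComp D D

/-- The inverse of the preferred chart at `p` has this derivative at the coordinates `z`. -/
def chartSymmDeriv (I : ModelWithCorners ℝ E H) (p : M) (z : E) : E →L[ℝ] E :=
  mfderivWithin 𝓘(ℝ, E) I (extChartAt I p).symm (range I) z

theorem isInvertible_chartSymmDeriv [IsManifold I 1 M] {p : M} {z : E}
    (hz : z ∈ (extChartAt I p).target) : (chartSymmDeriv I p z).IsInvertible :=
  isInvertible_mfderivWithin_extChartAt_symm hz

theorem chartSymmDeriv_self [IsManifold I 1 M] (p : M) :
    chartSymmDeriv I p (extChartAt I p p) = ContinuousLinearMap.id ℝ E :=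
  mfderivWithin_range_extChartAt_symm

/-- The point obtained by going through a chart and back is only propositionally the original one.
Since every tangent space is the same type E, values over the two can be compared without casts. -/
theorem form_congr (B : ∀ p : M, TangentSpace I p →L[ℝ] TangentSpace I p →L[ℝ] ℝ) {p q : M}
    (h : p = q) (a b : E) :
    (B p : E →L[ℝ] E →L[ℝ] ℝ) a b = (B q : E →L[ℝ] E →L[ℝ] ℝ) a b := by
  subst h
  rfl

theorem formRep_extChartAt_apply
    (B : ∀ p : M, TangentSpace I p →L[ℝ] TangentSpace I p →L[ℝ] ℝ) {p q : M}
    (hq : q ∈ (extChartAt I p).source) (u v : E) :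
    formRep B p (extChartAt I p q) u v = (B q : E →L[ℝ] E →L[ℝ] ℝ)
      (chartSymmDeriv I p (extChartAt I p q) u) (chartSymmDeriv I p (extChartAt I p q) v) :=
  form_congr B ((extChartAt I p).left_inv hq) _ _

/-- The trivialisation of the tangent bundle at p is the derivative of the chart at p, so the
induced trivialisation of the bundle of forms reads off `formRep`. This links the bundled smoothness
of metrics with calculus in coordinates. -/
theorem contMDiffAt_form_iff [IsManifold I ∞ M]
    (B : ∀ p : M, TangentSpace I p →L[ℝ] TangentSpace I p →L[ℝ] ℝ) (p : M) :
    ContMDiffAt I (I.prod 𝓘(ℝ, E →L[ℝ] E →L[ℝ] ℝ)) ∞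
      (fun b ↦ TotalSpace.mk' (E →L[ℝ] E →L[ℝ] ℝ)
        (E := fun b : M => TangentSpace I b →L[ℝ] TangentSpace I b →L[ℝ] ℝ) b (B b)) p ↔
    ContDiffWithinAt ℝ ∞ (formRep B p) (range I) (extChartAt I p p) := by
  have : IsManifold I 1 M := .of_le (n := ∞) (by simp)
  rw [contMDiffAt_section]
  have h1 : (fun q => formRep B p (extChartAt I p q)) =ᶠ[𝓝 p]
      fun x => (trivializationAt (E →L[ℝ] E →L[ℝ] ℝ)
        (fun b : M => TangentSpace I b →L[ℝ] TangentSpace I b →L[ℝ] ℝ) p ⟨x, B x⟩).2 := by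
    filter_upwards [extChartAt_source_mem_nhds (I := I) p] with q hq
    have hq' : q ∈ (chartAt H p).source := by rwa [extChartAt_source] at hq
    have hb : q ∈ (trivializationAt E (TangentSpace I) p).baseSet := by
      simpa using hq'
    have hs : ∀ u : E, (trivializationAt E (TangentSpace I) p).symm q u =
        mfderivWithin 𝓘(ℝ, E) I (extChartAt I p).symm (range I) (extChartAt I p q) u := by
      intro u
      rw [← TangentBundle.symmL_trivializationAt hq']
      exact (Trivialization.symmL_apply _ hb u).symm
    rw [hom_trivializationAt_apply]
    ext u v
    rw [formRep_extChartAt_apply B hq]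
    refine Eq.trans ?_ (inCoordinates_apply_eq₂ (v := u) (w := v) hb hb (mem_univ _)).symm
    simp only [Trivial.fiberBundle_trivializationAt', Trivial.linearMapAt_trivialization,
      LinearMap.id_coe, id_eq]
    rw [hs, hs]
    rfl
  constructor
  · intro h
    have h2 : ContMDiffWithinAt 𝓘(ℝ, E) 𝓘(ℝ, E →L[ℝ] E →L[ℝ] ℝ) ∞
        (fun z => formRep B p (extChartAt I p ((extChartAt I p).symm z))) (range I)
        (extChartAt I p p) := by
      have h3 := h.congr_of_eventuallyEq h1
      rw [← contMDiffWithinAt_univ] at h3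
      exact h3.comp_of_eq (contMDiffWithinAt_extChartAt_symm_range_self p) (mapsTo_univ _ _)
        (extChartAt_to_inv p)
    refine h2.contDiffWithinAt.congr_of_eventuallyEq ?_ (by simp)
    filter_upwards [extChartAt_target_mem_nhdsWithin (I := I) p] with z hz
    rw [(extChartAt I p).right_inv hz]
  · intro h
    refine ContMDiffAt.congr_of_eventuallyEq ?_ h1.symm
    rw [← contMDiffWithinAt_univ]
    exact h.contMDiffWithinAt.comp p (contMDiffAt_extChartAt (I := I) (x := p)).contMDiffWithinAt
      fun q _ => mem_range_self _

/-- The derivative of a map in coordinates is the derivative of the map. -/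
theorem mfderiv_comp_chartSymmDeriv [IsManifold I 1 M] {ψ : M → M} {p q : M} {z : E}
    (hz : z ∈ (extChartAt I p).target)
    (hψ : MDifferentiableAt I I ψ ((extChartAt I p).symm z))
    (hq : ψ ((extChartAt I p).symm z) ∈ (extChartAt I q).source) (u : E) :
    (mfderiv I I ψ ((extChartAt I p).symm z) : E →L[ℝ] E) (chartSymmDeriv I p z u) =
      chartSymmDeriv I q (extChartAt I q (ψ ((extChartAt I p).symm z)))
        (fderivWithin ℝ (fun y => extChartAt I q (ψ ((extChartAt I p).symm y))) (range I) z u) := by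
  have h1 := (mdifferentiableWithinAt_extChartAt_symm (I := I) hz).hasMFDerivWithinAt
  have h2 := hψ.hasMFDerivAt.comp_hasMFDerivWithinAt z h1
  have h3 := (mdifferentiableAt_extChartAt (I := I) (x := q)
    (by rwa [← extChartAt_source I])).hasMFDerivAt.comp_hasMFDerivWithinAt z h2
  let D : E →L[ℝ] E := mfderiv I 𝓘(ℝ, E) (extChartAt I q) (ψ ((extChartAt I p).symm z))
  let D' : E →L[ℝ] E := mfderiv I I ψ ((extChartAt I p).symm z)
  have h4 : HasFDerivWithinAt (fun y => extChartAt I q (ψ ((extChartAt I p).symm y)))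
      (D ∘L (D' ∘L chartSymmDeriv I p z)) (range I) z := h3.hasFDerivWithinAt
  rw [h4.fderivWithin (I.uniqueDiffOn z (extChartAt_target_subset_range p hz))]
  have h5 : chartSymmDeriv I q (extChartAt I q (ψ ((extChartAt I p).symm z))) ∘L D =
      ContinuousLinearMap.id ℝ E :=
    mfderivWithin_extChartAt_symm_comp_mfderiv_extChartAt' hq
  exact (DFunLike.congr_fun h5 (D' (chartSymmDeriv I p z u))).symm

/-- Positivity makes the map into the dual injective, and the dual has the same finite dimension. -/
theorem isInvertible_of_pos [FiniteDimensional ℝ E] {b : E →L[ℝ] E →L[ℝ] ℝ}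
    (hb : ∀ v, v ≠ 0 → 0 < b v v) : b.IsInvertible := by
  have hcomplete : CompleteSpace E := FiniteDimensional.complete ℝ E
  have hinj : Function.Injective b := by
    rw [injective_iff_map_eq_zero]
    intro v hv
    by_contra hne
    have := hb v hne
    rw [hv] at this
    exact lt_irrefl _ this
  have hrank : Module.finrank ℝ E = Module.finrank ℝ (E →L[ℝ] ℝ) := by
    rw [← (LinearMap.toContinuousLinearMap (𝕜 := ℝ) (E := E) (F' := ℝ)).finrank_eq]
    exact (Subspace.dual_finrank_eq (K := ℝ) (V := E)).symm
  exact ⟨(LinearEquiv.ofInjectiveOfFinrankEq b.toLinearMap hinj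
    hrank).toContinuousLinearEquiv, by ext; rfl⟩

theorem formRep_isInvertible [FiniteDimensional ℝ E] [IsManifold I 1 M]
    {B : ∀ p : M, TangentSpace I p →L[ℝ] TangentSpace I p →L[ℝ] ℝ}
    (hB : ∀ p (v : TangentSpace I p), v ≠ 0 → 0 < B p v v) {p : M} {z : E}
    (hz : z ∈ (extChartAt I p).target) : (formRep B p z).IsInvertible := by
  refine isInvertible_of_pos fun v hv => hB _ (chartSymmDeriv I p z v) fun h0 => hv ?_
  exact (isInvertible_chartSymmDeriv hz).injective (h0.trans (map_zero (chartSymmDeriv I p z)).symm)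

/-- The field of forms `B'` is `c` times the pullback of `B` by `ψ`. -/
def IsPullbackForm (ψ : M → M) (c : ℝ)
    (B B' : ∀ p : M, TangentSpace I p →L[ℝ] TangentSpace I p →L[ℝ] ℝ) : Prop :=
  ∀ p (u v : TangentSpace I p), B' p u v = c * B (ψ p) (mfderiv I I ψ p u) (mfderiv I I ψ p v)

theorem IsPullbackForm.formRep_eq [IsManifold I 1 M] {ψ : M → M} {c : ℝ}
    {B B' : ∀ p : M, TangentSpace I p →L[ℝ] TangentSpace I p →L[ℝ] ℝ}
    (h : IsPullbackForm ψ c B B') {p q : M} {z : E} (hz : z ∈ (extChartAt I p).target)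
    (hψ : MDifferentiableAt I I ψ ((extChartAt I p).symm z))
    (hq : ψ ((extChartAt I p).symm z) ∈ (extChartAt I q).source) :
    formRep B' p z = c • (formRep B q (extChartAt I q (ψ ((extChartAt I p).symm z)))).bilinearComp
      (fderivWithin ℝ (fun y => extChartAt I q (ψ ((extChartAt I p).symm y))) (range I) z)
      (fderivWithin ℝ (fun y => extChartAt I q (ψ ((extChartAt I p).symm y))) (range I) z) := by
  ext u v
  refine (h _ (chartSymmDeriv I p z u) (chartSymmDeriv I p z v)).trans ?_
  have h1 := formRep_extChartAt_apply B hq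
    (fderivWithin ℝ (fun y => extChartAt I q (ψ ((extChartAt I p).symm y))) (range I) z u)
    (fderivWithin ℝ (fun y => extChartAt I q (ψ ((extChartAt I p).symm y))) (range I) z v)
  rw [← mfderiv_comp_chartSymmDeriv hz hψ hq, ← mfderiv_comp_chartSymmDeriv hz hψ hq] at h1
  exact congrArg (c * ·) h1.symm

theorem contDiffWithinAt_chartMap {ψ : M → M} (hψ : ContMDiff I I ∞ ψ) (p : M) :
    ContDiffWithinAt ℝ ∞ (fun y => extChartAt I (ψ p) (ψ ((extChartAt I p).symm y))) (range I)
      (extChartAt I p p) :=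
  (contMDiffAt_iff.1 (hψ p)).2

theorem eventually_mem_chart {ψ : M → M} (hψ : ContMDiff I I ∞ ψ) (p : M) :
    ∀ᶠ z in 𝓝[range I] (extChartAt I p p), z ∈ (extChartAt I p).target ∧
      ψ ((extChartAt I p).symm z) ∈ (extChartAt I (ψ p)).source := by
  have h1 : Tendsto (fun z => ψ ((extChartAt I p).symm z)) (𝓝[range I] (extChartAt I p p))
      (𝓝 (ψ p)) := by
    refine (hψ.continuous.tendsto p).comp ?_
    have := (continuousAt_extChartAt_symm (I := I) p).tendsto
    rw [extChartAt_to_inv] at this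
    exact this.mono_left nhdsWithin_le_nhds
  filter_upwards [extChartAt_target_mem_nhdsWithin (I := I) p,
    h1.eventually (extChartAt_source_mem_nhds (I := I) (ψ p))] with z h2 h3
  exact ⟨h2, h3⟩

theorem isInvertible_mfderiv (ψ : M ≃ₘ^∞⟮I, I⟯ M) (p : M) :
    (mfderiv I I ψ p : E →L[ℝ] E).IsInvertible :=
  ⟨(ψ.mfderivToContinuousLinearEquiv (by simp) p :), rfl⟩

theorem IsPullbackForm.pos {ψ : M ≃ₘ^∞⟮I, I⟯ M} {c : ℝ} (hc : 0 < c)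
    {B B' : ∀ p : M, TangentSpace I p →L[ℝ] TangentSpace I p →L[ℝ] ℝ}
    (h : IsPullbackForm ψ c B B') (hB : ∀ p (v : TangentSpace I p), v ≠ 0 → 0 < B p v v)
    (p : M) (v : TangentSpace I p) (hv : v ≠ 0) : 0 < B' p v v := by
  rw [h p v v]
  refine mul_pos hc (hB _ _ fun h0 => hv ?_)
  exact (isInvertible_mfderiv ψ p).injective (h0.trans (map_zero (mfderiv I I ψ p)).symm)

variable [IsManifold I ∞ M]

variable [FiniteDimensional ℝ E]

/-- Proved for bare fields of forms, since smoothness is needed to construct the pulled-back metric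
in the first place. -/
theorem IsPullbackForm.contDiffWithinAt {ψ : M → M} (hψ : ContMDiff I I ∞ ψ) {c : ℝ}
    {B B' : ∀ p : M, TangentSpace I p →L[ℝ] TangentSpace I p →L[ℝ] ℝ}
    (h : IsPullbackForm ψ c B B') (p : M)
    (hB : ContDiffWithinAt ℝ ∞ (formRep B (ψ p)) (range I) (extChartAt I (ψ p) (ψ p))) :
    ContDiffWithinAt ℝ ∞ (formRep B' p) (range I) (extChartAt I p p) := by
  have : IsManifold I 1 M := .of_le (n := ∞) (by simp)
  have hf := contDiffWithinAt_chartMap hψ p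
  have hz : extChartAt I p p ∈ range I := mem_range_self _
  set f := fun y => extChartAt I (ψ p) (ψ ((extChartAt I p).symm y)) with hfdef
  have hfz : f (extChartAt I p p) = extChartAt I (ψ p) (ψ p) := by
    simp only [hfdef, extChartAt_to_inv]
  have hG : ContDiffWithinAt ℝ ∞ (fun y => formRep B (ψ p) (f y)) (range I)
      (extChartAt I p p) := by
    rw [← hfz] at hB
    exact hB.comp _ hf fun y _ => mem_range_self _
  have hD : ContDiffWithinAt ℝ ∞ (fderivWithin ℝ f (range I)) (range I) (extChartAt I p p) :=
    hf.fderivWithin_right (m := ∞) I.uniqueDiffOn (by simp) hz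
  have heq : ∀ᶠ y in 𝓝[range I] (extChartAt I p p), formRep B' p y =
      c • (formRep B (ψ p) (f y)).bilinearComp (fderivWithin ℝ f (range I) y)
        (fderivWithin ℝ f (range I) y) := by
    filter_upwards [eventually_mem_chart hψ p] with y hy
    exact h.formRep_eq hy.1 ((hψ _).mdifferentiableAt (by simp)) hy.2
  refine LocalFlow.contDiffWithinAt_of_forall_apply fun v =>
    LocalFlow.contDiffWithinAt_of_forall_apply fun w => ?_
  have hsm := (contDiffWithinAt_const (c := c)).mul
    ((hG.clm_apply (hD.clm_apply (contDiffWithinAt_const (c := v)))).clm_apply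
    (hD.clm_apply (contDiffWithinAt_const (c := w))))
  refine hsm.congr_of_eventuallyEq (heq.mono fun x hx => ?_) ?_
  · simp [hx]
  · rw [heq.self_of_nhdsWithin hz]
    rfl

/-- The bridge from the manifold to the coordinate computations. The finite orders of regularity 3
and 2 hold on a whole neighbourhood, as required by arguments that differentiate the transformation
law. -/
theorem IsPullbackForm.eventually_isPullbackAt {ψ : M ≃ₘ^∞⟮I, I⟯ M} {c : ℝ} (hc : 0 < c)
    {B B' : ∀ p : M, TangentSpace I p →L[ℝ] TangentSpace I p →L[ℝ] ℝ}
    (h : IsPullbackForm ψ c B B') (hB : ∀ p (v : TangentSpace I p), v ≠ 0 → 0 < B p v v)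
    (hsymm : ∀ p (v w : TangentSpace I p), B p v w = B p w v) (p : M)
    (hsmooth : ContDiffWithinAt ℝ ∞ (formRep B (ψ p)) (range I) (extChartAt I (ψ p) (ψ p))) :
    ∀ᶠ y in 𝓝[range I] (extChartAt I p p), IsPullbackAt (range I)
      (fun y => extChartAt I (ψ p) (ψ ((extChartAt I p).symm y)))
      (formRep B (ψ p)) (formRep B' p) c y := by
  have : IsManifold I 1 M := .of_le (n := ∞) (by simp)
  have hf := contDiffWithinAt_chartMap ψ.contMDiff p
  have hz : extChartAt I p p ∈ range I := mem_range_self _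
  have hmem := eventually_mem_chart ψ.contMDiff p
  set f := fun y => extChartAt I (ψ p) (ψ ((extChartAt I p).symm y)) with hfdef
  have hfz : f (extChartAt I p p) = extChartAt I (ψ p) (ψ p) := by
    simp only [hfdef, extChartAt_to_inv]
  have hft : Tendsto f (𝓝[range I] (extChartAt I p p))
      (𝓝[range I] (extChartAt I (ψ p) (ψ p))) :=
    tendsto_nhdsWithin_iff.2 ⟨by rw [← hfz]; exact hf.continuousWithinAt,
      Eventually.of_forall fun y => mem_range_self _⟩
  have hG : ∀ᶠ y in 𝓝[range I] (extChartAt I (ψ p) (ψ p)),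
      ContDiffWithinAt ℝ 2 (formRep B (ψ p)) (range I) y := by
    have := (hsmooth.of_le (m := 2) (WithTop.coe_le_coe.2 (le_top : (2 : ℕ∞) ≤ ⊤))).eventually (by simp)
    rwa [insert_eq_of_mem (show extChartAt I (ψ p) (ψ p) ∈ range I from mem_range_self _)] at this
  have hf3 : ∀ᶠ y in 𝓝[range I] (extChartAt I p p), ContDiffWithinAt ℝ 3 f (range I) y := by
    have := (hf.of_le (m := 3) (WithTop.coe_le_coe.2 (le_top : (3 : ℕ∞) ≤ ⊤))).eventually (by simp)
    rwa [insert_eq_of_mem hz] at this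
  filter_upwards [self_mem_nhdsWithin, hft.eventually hG, hf3, hmem,
    eventually_eventually_nhdsWithin.2 hmem] with y hyS hyG hyf hy hy'
  have hyt : f y ∈ (extChartAt I (ψ p)).target := (extChartAt I (ψ p)).map_source hy.2
  refine ⟨hyS, Eventually.of_forall fun w => mem_range_self _, hyf, hyG, fun u v => ?_,
    formRep_isInvertible hB hyt, formRep_isInvertible (h.pos hc hB) hy.1, ?_, ?_⟩
  · exact hsymm _ (chartSymmDeriv I (ψ p) (f y) u) (chartSymmDeriv I (ψ p) (f y) v)
  -- In coordinates the derivative is that of ψ conjugated by the invertible derivatives of the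
  -- inverse charts.
  · obtain ⟨e1, he1⟩ := isInvertible_chartSymmDeriv (I := I) hyt
    obtain ⟨e2, he2⟩ := isInvertible_mfderiv ψ ((extChartAt I p).symm y)
    obtain ⟨e3, he3⟩ := isInvertible_chartSymmDeriv (I := I) hy.1
    refine ⟨(e3.trans e2).trans e1.symm, ?_⟩
    ext u : 1
    refine e1.injective ?_
    have h1 := mfderiv_comp_chartSymmDeriv (ψ := ψ) (q := ψ p) hy.1
      ((ψ.contMDiff _).mdifferentiableAt (by simp)) hy.2 u
    rw [← he2, ← he3] at h1
    exact (e1.apply_symm_apply _).trans (h1.trans (DFunLike.congr_fun he1 _).symm)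
  · filter_upwards [hy'] with w hw
    exact h.formRep_eq hw.1 ((ψ.contMDiff _).mdifferentiableAt (by simp)) hw.2

end ChartForms

end WeightedYamabe
end

/-! ### Naturality and scaling of the weighted curvatures -/

noncomputable section

open Filter Topology

namespace WeightedYamabe

variable {n : ℕ} [NeZero n] {M : Type*} [TopologicalSpace M]
  [ChartedSpace (EuclideanHalfSpace n) M] [IsManifold (𝓡∂ n) ∞ M]

/-- Being interior can be tested in any chart of the atlas. Chart targets are relatively open in the
half-space, so interiority in the target amounts to x₀ > 0. -/
theorem isBoundaryPoint_iff_extChartAt {p q : M} (hq : q ∈ (extChartAt (𝓡∂ n) p).source) :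
    (𝓡∂ n).IsBoundaryPoint q ↔ (extChartAt (𝓡∂ n) p q : Coord n) 0 = 0 := by
  have hnn : (0 : ℝ) ≤ (extChartAt (𝓡∂ n) p q : Coord n) 0 := by
    have : extChartAt (𝓡∂ n) p q ∈ range (𝓡∂ n) := mem_range_self _
    rwa [range_modelWithCornersEuclideanHalfSpace] at this
  have h1 := (𝓡∂ n).isInteriorPoint_iff_of_mem_atlas (n := ∞) (by simp)
    (chart_mem_atlas (EuclideanHalfSpace n) p) (by rwa [← extChartAt_source (𝓡∂ n)])
  rw [ModelWithCorners.isBoundaryPoint_iff_not_isInteriorPoint, h1]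
  change ¬ extChartAt (𝓡∂ n) p q ∈ interior (extChartAt (𝓡∂ n) p).target ↔ _
  have h2 : extChartAt (𝓡∂ n) p q ∈ interior (extChartAt (𝓡∂ n) p).target ↔
      extChartAt (𝓡∂ n) p q ∈ interior (range (𝓡∂ n)) := by
    refine ⟨fun h => interior_mono (extChartAt_target_subset_range p) h, fun h => ?_⟩
    have h3 := extChartAt_target_mem_nhdsWithin' (I := 𝓡∂ n) hq
    rw [nhdsWithin_eq_nhds.2 (mem_interior_iff_mem_nhds.1 h)] at h3
    exact mem_interior_iff_mem_nhds.2 h3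
  rw [h2, interior_range_modelWithCornersEuclideanHalfSpace]
  exact not_lt.trans ⟨fun h => le_antisymm h hnn, fun h => h.le⟩

theorem contDiffWithinAt_chartMetric (g : Metric n M) (p : M) :
    ContDiffWithinAt ℝ ∞ (chartMetric g p) (range (𝓡∂ n)) (extChartAt (𝓡∂ n) p p) :=
  (contMDiffAt_form_iff g.inner p).1 (g.contMDiff p)

theorem contDiffWithinAt_chartFun {φ : M → ℝ} (hφ : ContMDiff (𝓡∂ n) 𝓘(ℝ, ℝ) ∞ φ) (p : M) :
    ContDiffWithinAt ℝ ∞ (chartFun φ p) (range (𝓡∂ n)) (extChartAt (𝓡∂ n) p p) :=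
  (contMDiffAt_iff.1 (hφ p)).2

/-- The metric `c ψ^* g`. -/
def pullbackMetric (g : Metric n M) (ψ : M ≃ₘ^∞⟮𝓡∂ n, 𝓡∂ n⟯ M) {c : ℝ} (hc : 0 < c) :
    Metric n M :=
  let inner' (p : M) : TangentSpace (𝓡∂ n) p →L[ℝ] TangentSpace (𝓡∂ n) p →L[ℝ] ℝ :=
    let b : Coord n →L[ℝ] Coord n →L[ℝ] ℝ := g.inner (ψ p)
    let D : Coord n →L[ℝ] Coord n := mfderiv (𝓡∂ n) (𝓡∂ n) ψ p
    c • b.bilinearComp D D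
  have h : IsPullbackForm ψ c g.inner inner' := fun _ _ _ => rfl
  { inner := inner'
    symm := fun p v w => by rw [h, h, g.symm]
    pos := h.pos hc g.pos
    -- The unit ball of c ψ^*g lies in the image of that of g under c^(-1/2) (Dψ)⁻¹, and continuous
    -- linear images of bounded sets are bounded.
    isVonNBounded := fun p => by
      let e := ψ.mfderivToContinuousLinearEquiv (by simp) p
      have he : ∀ v, mfderiv (𝓡∂ n) (𝓡∂ n) ψ p v = e v := fun _ => rfl
      have hs : Real.sqrt c ≠ 0 := (Real.sqrt_pos.2 hc).ne'
      refine ((g.isVonNBounded (ψ p)).image ((Real.sqrt c)⁻¹ •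
        (e.symm : TangentSpace (𝓡∂ n) (ψ p) →L[ℝ] TangentSpace (𝓡∂ n) p))).subset fun v hv => ?_
      refine ⟨Real.sqrt c • e v, ?_, ?_⟩
      · change inner' p v v < 1 at hv
        rw [h, he] at hv
        change g.inner (ψ p) (Real.sqrt c • e v) (Real.sqrt c • e v) < 1
        rwa [map_smul, map_smul, smul_apply, smul_eq_mul, smul_eq_mul, ← mul_assoc,
          Real.mul_self_sqrt hc.le]
      · simp [smul_smul, hs]
    contMDiff := fun p => (contMDiffAt_form_iff inner' p).2
      (h.contDiffWithinAt ψ.contMDiff p (contDiffWithinAt_chartMetric g (ψ p))) }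

theorem isPullbackForm_pullbackMetric (g : Metric n M) (ψ : M ≃ₘ^∞⟮𝓡∂ n, 𝓡∂ n⟯ M) {c : ℝ}
    (hc : 0 < c) : IsPullbackForm ψ c g.inner (pullbackMetric g ψ hc).inner :=
  fun _ _ _ => rfl

section Naturality

variable {g g' : Metric n M} {ψ : M ≃ₘ^∞⟮𝓡∂ n, 𝓡∂ n⟯ M} {c : ℝ}

/-- The map `ψ` between the preferred charts at `p` and `ψ p`. -/
abbrev chartMap (ψ : M → M) (p : M) (z : Coord n) : Coord n :=
  extChartAt (𝓡∂ n) (ψ p) (ψ ((extChartAt (𝓡∂ n) p).symm z))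

theorem chartMap_extChartAt (ψ : M → M) (p : M) :
    chartMap ψ p (extChartAt (𝓡∂ n) p p) = extChartAt (𝓡∂ n) (ψ p) (ψ p) := by
  rw [chartMap, extChartAt_to_inv]

theorem eventually_isPullbackAt (h : IsPullbackForm ψ c g.inner g'.inner) (hc : 0 < c) (p : M) :
    ∀ᶠ y in 𝓝[range (𝓡∂ n)] (extChartAt (𝓡∂ n) p p), IsPullbackAt (range (𝓡∂ n))
      (chartMap ψ p) (chartMetric g (ψ p)) (chartMetric g' p) c y :=
  h.eventually_isPullbackAt hc g.pos g.symm p (contDiffWithinAt_chartMetric g (ψ p))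

theorem extChartAt_mem_range (p : M) : extChartAt (𝓡∂ n) p p ∈ range (𝓡∂ n) := mem_range_self _

theorem contDiffWithinAt_two {F : Type*} [NormedAddCommGroup F] [NormedSpace ℝ F]
    {f : Coord n → F} {s : Set (Coord n)} {z : Coord n} (h : ContDiffWithinAt ℝ ∞ f s z) :
    ContDiffWithinAt ℝ 2 f s z :=
  h.of_le (WithTop.coe_le_coe.2 (le_top : (2 : ℕ∞) ≤ ⊤))

theorem scalarCurvature_of_isPullbackForm (h : IsPullbackForm ψ c g.inner g'.inner) (hc : 0 < c)
    (p : M) : scalarCurvature g' p = c⁻¹ * scalarCurvature g (ψ p) := by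
  have h1 := scalar_pullback (extChartAt_mem_range p) (eventually_isPullbackAt h hc p) hc.ne'
    (𝓡∂ n).uniqueDiffOn (𝓡∂ n).range_subset_closure_interior
    (contDiffWithinAt_two (contDiffWithinAt_chartMetric g' p))
  rw [chartMap_extChartAt] at h1
  exact h1

variable {φ φ' : M → ℝ} {r : ℝ}

theorem chartFun_eventuallyEq (hφ' : ∀ p, φ' p = φ (ψ p) - r) (p : M) :
    chartFun φ' p =ᶠ[𝓝[range (𝓡∂ n)] (extChartAt (𝓡∂ n) p p)]
      fun y => chartFun φ (ψ p) (chartMap ψ p y) - r := by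
  filter_upwards [eventually_mem_chart ψ.contMDiff p] with z hz
  rw [chartFun, hφ', chartFun, chartMap, (extChartAt (𝓡∂ n) (ψ p)).left_inv hz.2]

theorem laplacian_of_isPullbackForm (h : IsPullbackForm ψ c g.inner g'.inner) (hc : 0 < c)
    (hφ : ContMDiff (𝓡∂ n) 𝓘(ℝ, ℝ) ∞ φ) (hφ' : ∀ p, φ' p = φ (ψ p) - r) (p : M) :
    laplacian g' φ' p = c⁻¹ * laplacian g φ (ψ p) := by
  have h2 := contDiffWithinAt_two (contDiffWithinAt_chartFun hφ (ψ p))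
  rw [← chartMap_extChartAt] at h2
  have h1 := laplacian_pullback (extChartAt_mem_range p) (eventually_isPullbackAt h hc p) hc.ne'
    (𝓡∂ n).uniqueDiffOn (𝓡∂ n).range_subset_closure_interior h2 (chartFun_eventuallyEq hφ' p)
  rw [chartMap_extChartAt] at h1
  exact h1

theorem gradNormSq_of_isPullbackForm (h : IsPullbackForm ψ c g.inner g'.inner) (hc : 0 < c)
    (hφ : ContMDiff (𝓡∂ n) 𝓘(ℝ, ℝ) ∞ φ) (hφ' : ∀ p, φ' p = φ (ψ p) - r) (p : M) :
    gradNormSq g' φ' p = c⁻¹ * gradNormSq g φ (ψ p) := by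
  have h2 := contDiffWithinAt_chartFun hφ (ψ p)
  rw [← chartMap_extChartAt] at h2
  have h1 := gradNormSq_pullback
    ((eventually_isPullbackAt h hc p).self_of_nhdsWithin (extChartAt_mem_range p)) hc.ne'
    (𝓡∂ n).uniqueDiffOn (h2.differentiableWithinAt (by simp)) (chartFun_eventuallyEq hφ' p)
  rw [chartMap_extChartAt] at h1
  exact h1

/-- A diffeomorphism preserves boundary points, and these are detected by x₀ = 0 in every chart. -/
theorem eventually_chartMap_zero (ψ : M ≃ₘ^∞⟮𝓡∂ n, 𝓡∂ n⟯ M) (p : M) :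
    ∀ᶠ y in 𝓝[range (𝓡∂ n)] (extChartAt (𝓡∂ n) p p), y 0 = 0 → chartMap ψ p y 0 = 0 := by
  filter_upwards [eventually_mem_chart ψ.contMDiff p] with z hz hz0
  have h1 := isBoundaryPoint_iff_extChartAt ((extChartAt (𝓡∂ n) p).map_target hz.1)
  rw [(extChartAt (𝓡∂ n) p).right_inv hz.1] at h1
  have h2 := ((ψ.isLocalDiffeomorph ((extChartAt (𝓡∂ n) p).symm z)).isBoundaryPoint_iff
    (by simp)).1 (h1.2 hz0)
  exact (isBoundaryPoint_iff_extChartAt hz.2).1 h2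

theorem extChartAt_zero_of_mem_boundary {p : M} (hp : p ∈ (𝓡∂ n).boundary M) :
    (extChartAt (𝓡∂ n) p p : Coord n) 0 = 0 :=
  (isBoundaryPoint_iff_extChartAt (mem_extChartAt_source p)).1 hp

theorem meanCurvature_of_isPullbackForm (h : IsPullbackForm ψ c g.inner g'.inner) (hc : 0 < c)
    {p : M} (hp : p ∈ (𝓡∂ n).boundary M) :
    meanCurvature g' p = (Real.sqrt c)⁻¹ * meanCurvature g (ψ p) := by
  have h1 := mean_pullback (extChartAt_mem_range p) (eventually_isPullbackAt h hc p) hc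
    (𝓡∂ n).uniqueDiffOn (𝓡∂ n).range_subset_closure_interior
    (range_modelWithCornersEuclideanHalfSpace n) (eventually_chartMap_zero ψ p)
    (extChartAt_zero_of_mem_boundary hp)
  rw [chartMap_extChartAt] at h1
  exact h1

theorem lieDerivFun_eq_fderivWithin (X : ∀ p : M, TangentSpace (𝓡∂ n) p)
    (hφ : ContMDiff (𝓡∂ n) 𝓘(ℝ, ℝ) ∞ φ) (p : M) :
    lieDerivFun X φ p = fderivWithin ℝ (chartFun φ p) (range (𝓡∂ n)) (extChartAt (𝓡∂ n) p p)
      (X p : Coord n) := by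
  rw [lieDerivFun, ((hφ p).mdifferentiableAt (by simp)).mfderiv]
  rfl

/-- The outward normal unfolds to `unitNormal` of the chart metric, so `map_unitNormal` and the
chain rule yield the factor c^(-1/2); the constant r disappears on differentiation. -/
theorem lieDerivFun_outwardNormal (h : IsPullbackForm ψ c g.inner g'.inner) (hc : 0 < c)
    (hφ : ContMDiff (𝓡∂ n) 𝓘(ℝ, ℝ) ∞ φ) (hφ' : ∀ p, φ' p = φ (ψ p) - r)
    {p : M} (hp : p ∈ (𝓡∂ n).boundary M) :
    lieDerivFun (outwardNormal g') φ' p =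
      (Real.sqrt c)⁻¹ * lieDerivFun (outwardNormal g) φ (ψ p) := by
  have hsm : ContMDiff (𝓡∂ n) 𝓘(ℝ, ℝ) ∞ φ' := by
    have : φ' = fun p => φ (ψ p) - r := funext hφ'
    rw [this]
    exact (hφ.comp ψ.contMDiff).sub contMDiff_const
  have h0 := (eventually_isPullbackAt h hc p).self_of_nhdsWithin (extChartAt_mem_range p)
  have h2 := contDiffWithinAt_chartFun hφ (ψ p)
  rw [← chartMap_extChartAt] at h2
  rw [lieDerivFun_eq_fderivWithin _ hsm, lieDerivFun_eq_fderivWithin _ hφ]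
  have h1 := fderivWithin_pullback h0 (𝓡∂ n).uniqueDiffOn (h2.differentiableWithinAt (by simp))
    (chartFun_eventuallyEq hφ' p) (unitNormal (chartMetric g' p (extChartAt (𝓡∂ n) p p)))
  rw [h0.map_unitNormal hc (range_modelWithCornersEuclideanHalfSpace n)
    (eventually_chartMap_zero ψ p) (extChartAt_zero_of_mem_boundary hp), map_smul,
    chartMap_extChartAt] at h1
  exact h1

end Naturality

namespace SmoothMetricMeasureSpace

variable {m : ℝ} (A : SmoothMetricMeasureSpace n m M) (ψ : M ≃ₘ^∞⟮𝓡∂ n, 𝓡∂ n⟯ M) {c : ℝ}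

/-- The metric `c ψ^* g` with the density `ψ^* φ - (m / 2) log c`. -/
def pullback (hc : 0 < c) : SmoothMetricMeasureSpace n m M where
  g := pullbackMetric A.g ψ hc
  φ := fun p => A.φ (ψ p) - m / 2 * Real.log c
  contMDiff_φ := (A.contMDiff_φ.comp ψ.contMDiff).sub contMDiff_const
  dim_nonneg := A.dim_nonneg
  φ_eq_zero := fun h => by
    funext p
    simp [A.φ_eq_zero h, h]

/-- Ricci, Hessian and df ⊗ df ignore the constants c and (m/2) log c, so c enters only through the
metric trace, once in each of the three terms. -/
theorem scalarCurv_pullback (hc : 0 < c) (p : M) :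
    (A.pullback ψ hc).scalarCurv p = c⁻¹ * A.scalarCurv (ψ p) := by
  have h := isPullbackForm_pullbackMetric A.g ψ hc
  have hφ : ∀ p, (A.pullback ψ hc).φ p = A.φ (ψ p) - m / 2 * Real.log c := fun _ => rfl
  rw [scalarCurv, scalarCurv, scalarCurvature_of_isPullbackForm (g' := (A.pullback ψ hc).g) h hc,
    laplacian_of_isPullbackForm (g' := (A.pullback ψ hc).g) h hc A.contMDiff_φ hφ,
    gradNormSq_of_isPullbackForm (g' := (A.pullback ψ hc).g) h hc A.contMDiff_φ hφ]
  ring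

theorem meanCurv_pullback (hc : 0 < c) {p : M} (hp : p ∈ (𝓡∂ n).boundary M) :
    (A.pullback ψ hc).meanCurv p = (Real.sqrt c)⁻¹ * A.meanCurv (ψ p) := by
  have h := isPullbackForm_pullbackMetric A.g ψ hc
  have hφ : ∀ p, (A.pullback ψ hc).φ p = A.φ (ψ p) - m / 2 * Real.log c := fun _ => rfl
  rw [meanCurv, meanCurv, meanCurvature_of_isPullbackForm (g' := (A.pullback ψ hc).g) h hc hp,
    lieDerivFun_outwardNormal (g' := (A.pullback ψ hc).g) h hc A.contMDiff_φ hφ hp]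
  ring

end SmoothMetricMeasureSpace

end WeightedYamabe
end

/-! ### The Lie derivative as derivative of pullbacks, in coordinates -/

noncomputable section

open Filter Topology

namespace WeightedYamabe

section LocalLieDerivative

variable {E : Type*} [NormedAddCommGroup E] [NormedSpace ℝ E] {S : Set E} {z₀ : E}
  {Φ : ℝ × E → E} {V : E → E}

/-- The spatial derivative of a flow evolves by the derivative of its generator. -/
theorem hasDerivAt_fderivWithin_flow (hS : UniqueDiffOn ℝ S) (hS' : S ⊆ closure (interior S))
    (hz : z₀ ∈ S) (hΦ : ContDiffWithinAt ℝ 2 Φ (univ ×ˢ S) (0, z₀))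
    (hV : ∀ᶠ z in 𝓝[S] z₀, HasDerivAt (fun s => Φ (s, z)) (V z) 0) (u : E) :
    HasDerivAt (fun s => fderivWithin ℝ (fun z => Φ (s, z)) S z₀ u)
      (fderivWithin ℝ V S z₀ u) 0 := by
  set W : Set (ℝ × E) := univ ×ˢ S with hW
  have hWu : UniqueDiffOn ℝ W := uniqueDiffOn_univ.prod hS
  have hmem : ((0 : ℝ), z₀) ∈ W := ⟨mem_univ _, hz⟩
  have hmem' : ((0 : ℝ), z₀) ∈ closure (interior W) := by
    rw [hW, interior_prod_eq, closure_prod_eq, interior_univ, closure_univ]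
    exact ⟨mem_univ _, hS' hz⟩
  have hd : ∀ᶠ x in 𝓝[W] ((0 : ℝ), z₀), DifferentiableWithinAt ℝ Φ W x := by
    have := hΦ.eventually (by simp)
    rw [insert_eq_of_mem hmem] at this
    exact this.mono fun y hy => hy.differentiableWithinAt (by norm_num)
  have hD : HasFDerivWithinAt (fderivWithin ℝ Φ W)
      (fderivWithin ℝ (fderivWithin ℝ Φ W) W (0, z₀)) W (0, z₀) :=
    ((hΦ.fderivWithin_right (m := 1) hWu (by norm_num [one_add_one_eq_two])
      hmem).differentiableWithinAt (by norm_num)).hasFDerivWithinAt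
  -- The claim is the equality of the mixed partials ∂_s ∂_z Φ = ∂_z ∂_s Φ. Both are read off the
  -- second derivative of Φ on ℝ × S, in the directions (1, 0) and (0, u).
  have hsymm := (hΦ.isSymmSndFDerivWithinAt (by simp) hWu hmem' hmem).eq
  have ht : Tendsto (fun s : ℝ => (s, z₀)) (𝓝 0) (𝓝[W] ((0 : ℝ), z₀)) :=
    tendsto_nhdsWithin_iff.2 ⟨(Continuous.tendsto' (by fun_prop) _ _ rfl),
      Eventually.of_forall fun s => ⟨mem_univ _, hz⟩⟩
  have hz' : Tendsto (fun z : E => ((0 : ℝ), z)) (𝓝[S] z₀) (𝓝[W] ((0 : ℝ), z₀)) :=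
    tendsto_nhdsWithin_iff.2 ⟨(Continuous.tendsto' (by fun_prop) _ _ rfl).mono_left
      nhdsWithin_le_nhds, eventually_nhdsWithin_of_forall fun s hs => ⟨mem_univ _, hs⟩⟩
  have hincl : ∀ s z, HasFDerivWithinAt (fun z : E => (s, z))
      (ContinuousLinearMap.inr ℝ ℝ E) S z := fun s z =>
    (hasFDerivAt_prodMk_right s z).hasFDerivWithinAt
  have hincl' : ∀ s z, HasFDerivAt (fun s : ℝ => (s, z))
      (ContinuousLinearMap.inl ℝ ℝ E) s := fun s z => hasFDerivAt_prodMk_left s z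
  have h1 : (fun s => fderivWithin ℝ (fun z => Φ (s, z)) S z₀ u) =ᶠ[𝓝 0]
      fun s => fderivWithin ℝ Φ W (s, z₀) (0, u) := by
    filter_upwards [ht.eventually hd] with s hs
    have := hs.hasFDerivWithinAt.comp z₀ (hincl s z₀)
      (show MapsTo (fun z => (s, z)) S W from fun z hz => ⟨mem_univ _, hz⟩)
    have h2 := this.fderivWithin (hS z₀ hz)
    refine (DFunLike.congr_fun h2 u).trans ?_
    simp
  have h2 : V =ᶠ[𝓝[S] z₀] fun z => fderivWithin ℝ Φ W (0, z) (1, 0) := by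
    filter_upwards [hz'.eventually hd, hV, self_mem_nhdsWithin] with z hz1 hz2 hz3
    have h3 := hz1.hasFDerivWithinAt.comp_hasDerivAt (0 : ℝ) (hincl' 0 z).hasDerivAt
      (Eventually.of_forall fun s => (⟨mem_univ _, hz3⟩ : (s, z) ∈ W))
    refine (hz2.unique h3).trans ?_
    simp
  have h3 : HasFDerivWithinAt V _ S z₀ :=
    ((hD.comp z₀ (hincl 0 z₀) (show MapsTo (fun z => ((0 : ℝ), z)) S W from
      fun z hz => ⟨mem_univ _, hz⟩)).clm_apply
      (hasFDerivWithinAt_const ((1 : ℝ), (0 : E)) z₀ S)).congr_of_eventuallyEq h2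
      (h2.self_of_nhdsWithin hz)
  have h4 := (hD.comp_hasDerivAt (0 : ℝ) (hincl' 0 z₀).hasDerivAt
    (Eventually.of_forall fun s => (⟨mem_univ _, hz⟩ : (s, z₀) ∈ W))).clm_apply
      (hasDerivAt_const (0 : ℝ) ((0 : ℝ), u))
  refine (h4.congr_of_eventuallyEq h1).congr_deriv ?_
  rw [h3.fderivWithin (hS z₀ hz)]
  simpa using hsymm (1, 0) (0, u)

/-- The derivative of the pullback of a bilinear form by a flow is its Lie derivative. -/
theorem hasDerivAt_pullback_form (hS : UniqueDiffOn ℝ S) (hS' : S ⊆ closure (interior S))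
    (hz : z₀ ∈ S) (hΦ : ContDiffWithinAt ℝ 2 Φ (univ ×ˢ S) (0, z₀))
    (hV : ∀ᶠ z in 𝓝[S] z₀, HasDerivAt (fun s => Φ (s, z)) (V z) 0)
    (hΦS : ∀ s, Φ (s, z₀) ∈ S) (hΦ0 : ∀ᶠ z in 𝓝[S] z₀, Φ (0, z) = z)
    {G : E → E →L[ℝ] E →L[ℝ] ℝ} (hG : DifferentiableWithinAt ℝ G S z₀) (u v : E) :
    HasDerivAt (fun s => G (Φ (s, z₀)) (fderivWithin ℝ (fun z => Φ (s, z)) S z₀ u)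
      (fderivWithin ℝ (fun z => Φ (s, z)) S z₀ v))
      (fderivWithin ℝ G S z₀ (V z₀) u v + G z₀ (fderivWithin ℝ V S z₀ u) v +
        G z₀ u (fderivWithin ℝ V S z₀ v)) 0 := by
  have h0 : Φ (0, z₀) = z₀ := hΦ0.self_of_nhdsWithin hz
  have hid : fderivWithin ℝ (fun z => Φ (0, z)) S z₀ = ContinuousLinearMap.id ℝ E := by
    have h1 : (fun z => Φ (0, z)) =ᶠ[𝓝[S] z₀] id := hΦ0
    rw [h1.fderivWithin_eq h0]
    exact fderivWithin_id (hS z₀ hz)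
  have hG' : HasDerivAt (fun s => G (Φ (s, z₀))) (fderivWithin ℝ G S z₀ (V z₀)) 0 := by
    have h1 : HasFDerivWithinAt G (fderivWithin ℝ G S z₀) S (Φ (0, z₀)) := by
      rw [h0]
      exact hG.hasFDerivWithinAt
    exact h1.comp_hasDerivAt (0 : ℝ) (hV.self_of_nhdsWithin hz) (Eventually.of_forall hΦS)
  have h2 := (hG'.clm_apply (hasDerivAt_fderivWithin_flow hS hS' hz hΦ hV u)).clm_apply
    (hasDerivAt_fderivWithin_flow hS hS' hz hΦ hV v)
  refine h2.congr_deriv ?_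
  rw [hid, h0]
  simp

end LocalLieDerivative

end WeightedYamabe
end

/-! ### Derivatives of metrics and functions along the flow -/

noncomputable section

open Filter Topology

namespace WeightedYamabe

section FlowDerivative

variable {E : Type*} [NormedAddCommGroup E] [NormedSpace ℝ E]
  {H : Type*} [TopologicalSpace H] {I : ModelWithCorners ℝ E H}
  {M : Type*} [TopologicalSpace M] [ChartedSpace H M]

theorem mfderiv_apply_eq_chartSymmDeriv [IsManifold I 1 M] {ψ : M → M} {p q : M}
    (hψ : MDifferentiableAt I I ψ p) (hq : ψ p ∈ (extChartAt I q).source) (u : E) :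
    (mfderiv I I ψ p : E →L[ℝ] E) u = chartSymmDeriv I q (extChartAt I q (ψ p))
      (fderivWithin ℝ (fun y => extChartAt I q (ψ ((extChartAt I p).symm y))) (range I)
        (extChartAt I p p) u) := by
  have h0 : (extChartAt I p).symm (extChartAt I p p) = p := extChartAt_to_inv p
  have h1 := mfderiv_comp_chartSymmDeriv (ψ := ψ) (q := q) (mem_extChartAt_target (I := I) p)
    (by rwa [h0]) (by rwa [h0]) u
  have h2 : ∀ x, x = p → ∀ w : E, (mfderiv I I ψ x : E →L[ℝ] E) w =
      (mfderiv I I ψ p : E →L[ℝ] E) w := by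
    rintro x rfl w
    rfl
  rw [chartSymmDeriv_self] at h1
  refine ((h2 _ h0 u).symm.trans h1).trans ?_
  rw [h0]

variable [IsManifold I ∞ M] [T2Space M] [FiniteDimensional ℝ E]
  {X : ∀ p : M, TangentSpace I p} {θ : ℝ → M → M}

open ManifoldFlow

theorem contDiffWithinAt_flowRep (hθ : IsFlow θ X)
    (hX : ContMDiff I I.tangent ∞ (fun p => (⟨p, X p⟩ : TangentBundle I M))) (q : M) :
    ContDiffWithinAt ℝ ∞ (fun x : ℝ × E => extChartAt I q (θ x.1 ((extChartAt I q).symm x.2)))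
      (univ ×ˢ range I) (0, extChartAt I q q) := by
  have hr : range (𝓘(ℝ, ℝ).prod I) = univ ×ˢ range I := by
    ext ⟨a, b⟩
    exact ⟨fun ⟨y, hy⟩ => ⟨mem_univ _, y.2, congrArg Prod.snd hy⟩,
      fun ⟨_, y, hy⟩ => ⟨(a, y), Prod.ext rfl hy⟩⟩
  have h := (contMDiffAt_iff.1 (hθ.contMDiff hX ((0 : ℝ), q))).2
  rw [hr] at h
  simp only [hθ.zero, extChartAt_prod] at h
  exact h

/-- For times near zero the curve through q stays in the chart at q, so the coordinate formula
applies there. Other times are reached afterwards by the group law. -/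
theorem hasDerivAt_form_flow_zero (hθ : IsFlow θ X)
    (hX : ContMDiff I I.tangent ∞ (fun p => (⟨p, X p⟩ : TangentBundle I M)))
    (B : ∀ p : M, TangentSpace I p →L[ℝ] TangentSpace I p →L[ℝ] ℝ) (q : M)
    (hB : ContDiffWithinAt ℝ ∞ (formRep B q) (range I) (extChartAt I q q)) (u v : E) :
    HasDerivAt (fun s => (B (θ s q) : E →L[ℝ] E →L[ℝ] ℝ) ((mfderiv I I (θ s) q : E →L[ℝ] E) u)
      ((mfderiv I I (θ s) q : E →L[ℝ] E) v))
      (fderivWithin ℝ (formRep B q) (range I) (extChartAt I q q)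
          (fieldRep X q (extChartAt I q q)) u v +
        formRep B q (extChartAt I q q)
          (fderivWithin ℝ (fieldRep X q) (range I) (extChartAt I q q) u) v +
        formRep B q (extChartAt I q q) u
          (fderivWithin ℝ (fieldRep X q) (range I) (extChartAt I q q) v)) 0 := by
  have : IsManifold I 1 M := .of_le (n := ∞) (by simp)
  have hz : extChartAt I q q ∈ range I := mem_range_self _
  have h1 := hasDerivAt_pullback_form I.uniqueDiffOn I.range_subset_closure_interior hz
    ((contDiffWithinAt_flowRep hθ hX q).of_le
      (WithTop.coe_le_coe.2 (le_top : (2 : ℕ∞) ≤ ⊤))) (V := fieldRep X q) ?_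
    (fun s => mem_range_self _) ?_ (hB.differentiableWithinAt (by simp)) u v
  · refine h1.congr_of_eventuallyEq ?_
    have hc : ContinuousAt (fun s => θ s q) 0 := (hθ.integralCurve q 0).continuousAt
    have hc' : ∀ᶠ s in 𝓝 (0 : ℝ), θ s q ∈ (extChartAt I q).source :=
      hc.eventually (extChartAt_source_mem_nhds' (by simp [hθ.zero]))
    filter_upwards [hc'] with s hs
    have hd : MDifferentiableAt I I (θ s) q :=
      (hθ.contMDiff_time hX s q).mdifferentiableAt (by simp)
    rw [mfderiv_apply_eq_chartSymmDeriv hd hs, mfderiv_apply_eq_chartSymmDeriv hd hs]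
    simp only [extChartAt_to_inv]
    exact (formRep_extChartAt_apply B hs _ _).symm
  · filter_upwards [extChartAt_target_mem_nhdsWithin (I := I) q] with z hz'
    have hs : θ 0 ((extChartAt I q).symm z) ∈ (extChartAt I q).source := by
      rw [hθ.zero]
      exact (extChartAt I q).map_target hz'
    have h2 := IsMIntegralCurve.hasDerivAt_extChartAt (hθ.integralCurve ((extChartAt I q).symm z))
      (t := 0) hs
    rwa [hθ.zero, (extChartAt I q).right_inv hz'] at h2
  · filter_upwards [extChartAt_target_mem_nhdsWithin (I := I) q] with z hz'
    rw [hθ.zero, (extChartAt I q).right_inv hz']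

end FlowDerivative

variable {n : ℕ} [NeZero n] {M : Type*} [TopologicalSpace M] [T2Space M]
  [ChartedSpace (EuclideanHalfSpace n) M] [IsManifold (𝓡∂ n) ∞ M]
  {X : ∀ p : M, TangentSpace (𝓡∂ n) p} {θ : ℝ → M → M}

open ManifoldFlow

/-- The derivative of the pullback of a metric by a flow is the pullback of its Lie derivative. -/
theorem hasDerivAt_metric_flow (hθ : IsFlow θ X)
    (hX : ContMDiff (𝓡∂ n) (𝓡∂ n).tangent ∞ (fun p => (⟨p, X p⟩ : TangentBundle (𝓡∂ n) M)))
    (g : Metric n M) (p : M) (u v : TangentSpace (𝓡∂ n) p) (r : ℝ) :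
    HasDerivAt (fun s => g.inner (θ s p) (mfderiv (𝓡∂ n) (𝓡∂ n) (θ s) p u)
      (mfderiv (𝓡∂ n) (𝓡∂ n) (θ s) p v))
      (lieDerivMetric X g (θ r p) (mfderiv (𝓡∂ n) (𝓡∂ n) (θ r) p u)
        (mfderiv (𝓡∂ n) (𝓡∂ n) (θ r) p v)) r := by
  have h1 := hasDerivAt_form_flow_zero hθ hX g.inner (θ r p)
    (contDiffWithinAt_chartMetric g (θ r p))
    (mfderiv (𝓡∂ n) (𝓡∂ n) (θ r) p u) (mfderiv (𝓡∂ n) (𝓡∂ n) (θ r) p v)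
  rw [← sub_self r] at h1
  have h2 := h1.comp_sub_const r r
  refine h2.congr_of_eventuallyEq (Eventually.of_forall fun s => ?_)
  -- Writing θ_s = θ_{s-r} ∘ θ_r turns the derivative at time r into the derivative at time zero,
  -- based at θ_r p and evaluated on the pushed-forward vectors.
  have h3 : ∀ w : Coord n, (mfderiv (𝓡∂ n) (𝓡∂ n) (θ s) p : Coord n →L[ℝ] Coord n) w =
      (mfderiv (𝓡∂ n) (𝓡∂ n) (θ (s - r)) (θ r p) : Coord n →L[ℝ] Coord n)
        ((mfderiv (𝓡∂ n) (𝓡∂ n) (θ r) p : Coord n →L[ℝ] Coord n) w) := by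
    intro w
    have h4 : θ s = θ (s - r) ∘ θ r := by
      funext x
      rw [Function.comp_apply, ← hθ.add hX, sub_add_cancel]
    rw [h4]
    have h5 := mfderiv_comp p ((hθ.contMDiff_time hX (s - r) _).mdifferentiableAt (by simp))
      ((hθ.contMDiff_time hX r p).mdifferentiableAt (by simp))
    exact DFunLike.congr_fun h5 w
  have h6 : θ s p = θ (s - r) (θ r p) := by rw [← hθ.add hX, sub_add_cancel]
  refine (congrArg₂ (fun a b : Coord n =>
    (g.inner (θ s p) : Coord n →L[ℝ] Coord n →L[ℝ] ℝ) a b) (h3 u) (h3 v)).trans ?_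
  exact form_congr g.inner h6 _ _

/-- The derivative of a function along a flow is its Lie derivative. -/
theorem hasDerivAt_fun_flow (hθ : IsFlow θ X) {φ : M → ℝ} (hφ : ContMDiff (𝓡∂ n) 𝓘(ℝ, ℝ) ∞ φ)
    (p : M) (r : ℝ) : HasDerivAt (fun s => φ (θ s p)) (lieDerivFun X φ (θ r p)) r := by
  have h1 := ((hφ (θ r p)).mdifferentiableAt (by simp)).hasMFDerivAt.comp r (hθ.integralCurve p r)
  let D : Coord n →L[ℝ] ℝ := mfderiv (𝓡∂ n) 𝓘(ℝ, ℝ) φ (θ r p)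
  have h2 : HasFDerivAt (fun s => φ (θ s p))
    (D ∘L (1 : ℝ →L[ℝ] ℝ).smulRight (X (θ r p) : Coord n)) r := h1.hasFDerivAt
  have h3 := h2.hasDerivAt
  have h4 : (D ∘L (1 : ℝ →L[ℝ] ℝ).smulRight (X (θ r p) : Coord n)) 1 = D (X (θ r p)) := by
    change D ((1 : ℝ) • (X (θ r p) : Coord n)) = D (X (θ r p))
    rw [one_smul]
  rw [h4] at h3
  exact h3

end WeightedYamabe
end

/-! ### The time change and the self-similar solution -/

noncomputable section

open Filter Topology ManifoldFlow

namespace WeightedYamabe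

/-- The antiderivative of `1 / (1 - λ t)` which vanishes at zero. -/
def solitonTime (lam t : ℝ) : ℝ := if lam = 0 then t else -(Real.log (1 - lam * t)) / lam

theorem solitonTime_zero (lam : ℝ) : solitonTime lam 0 = 0 := by simp [solitonTime]

theorem hasDerivAt_one_sub_mul (lam t : ℝ) : HasDerivAt (fun s => 1 - lam * s) (-lam) t := by
  simpa using ((hasDerivAt_id t).const_mul lam).const_sub 1

theorem hasDerivAt_solitonTime {lam t : ℝ} (ht : 0 < 1 - lam * t) :
    HasDerivAt (solitonTime lam) (1 - lam * t)⁻¹ t := by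
  by_cases h : lam = 0
  · have h1 : solitonTime lam = id := by
      funext s
      simp [solitonTime, h]
    rw [h1, h]
    simpa using hasDerivAt_id t
  · have h1 : solitonTime lam = fun s => -(Real.log (1 - lam * s)) / lam := by
      funext s
      simp [solitonTime, h]
    rw [h1]
    refine (((hasDerivAt_one_sub_mul lam t).log ht.ne').neg.div_const lam).congr_deriv ?_
    field_simp

theorem contDiffOn_solitonTime (lam : ℝ) :
    ContDiffOn ℝ ∞ (solitonTime lam) {t : ℝ | 0 < 1 - lam * t} := by
  by_cases h : lam = 0
  · have h1 : solitonTime lam = id := by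
      funext s
      simp [solitonTime, h]
    rw [h1]
    exact contDiffOn_id
  · have h1 : solitonTime lam = fun s => -(Real.log (1 - lam * s)) / lam := by
      funext s
      simp [solitonTime, h]
    rw [h1]
    have h2 : ContDiffOn ℝ ∞ (fun s : ℝ => 1 - lam * s) {t : ℝ | 0 < 1 - lam * t} :=
      ContDiff.contDiffOn (by fun_prop)
    exact (h2.log fun t ht => (ne_of_gt ht)).neg.div_const lam

theorem eventually_pos_one_sub_mul {lam t : ℝ} (ht : 0 < 1 - lam * t) :
    ∀ᶠ s in 𝓝 t, 0 < 1 - lam * s :=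
  (hasDerivAt_one_sub_mul lam t).continuousAt.eventually (lt_mem_nhds ht)

variable {n : ℕ} [NeZero n] {m : ℝ} {M : Type*} [TopologicalSpace M]
  [ChartedSpace (EuclideanHalfSpace n) M] [IsManifold (𝓡∂ n) ∞ M]

namespace SmoothMetricMeasureSpace

theorem ext_apply {A B : SmoothMetricMeasureSpace n m M}
    (hg : ∀ p (u v : TangentSpace (𝓡∂ n) p), A.g.inner p u v = B.g.inner p u v)
    (hφ : ∀ p, A.φ p = B.φ p) : A = B := by
  obtain ⟨⟨a, _, _, _, _⟩, φ, _, _, _⟩ := A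
  obtain ⟨⟨b, _, _, _, _⟩, φ', _, _, _⟩ := B
  obtain rfl : a = b := by
    funext p
    ext u v
    exact hg p u v
  obtain rfl : φ = φ' := funext hφ
  rfl

/-- The equations for ψ and c are hypotheses because at time 0 the map ψ_0 and the factor 1 - λ · 0
equal the identity and 1 only propositionally. -/
theorem pullback_refl (A : SmoothMetricMeasureSpace n m M) {ψ : M ≃ₘ^∞⟮𝓡∂ n, 𝓡∂ n⟯ M} {c : ℝ}
    (hψ : ψ = Diffeomorph.refl (𝓡∂ n) M ∞) (hc : 0 < c) (hc1 : c = 1) :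
    A.pullback ψ hc = A := by
  subst hψ hc1
  refine ext_apply (fun p u v => ?_) fun p => ?_
  · have h1 : mfderiv (𝓡∂ n) (𝓡∂ n) (Diffeomorph.refl (𝓡∂ n) M ∞) p =
        ContinuousLinearMap.id ℝ (TangentSpace (𝓡∂ n) p) := mfderiv_id
    have h2 := isPullbackForm_pullbackMetric A.g (Diffeomorph.refl (𝓡∂ n) M ∞) hc p u v
    rw [h1, one_mul] at h2
    exact h2
  · change A.φ p - m / 2 * Real.log 1 = A.φ p
    simp

end SmoothMetricMeasureSpace

end WeightedYamabe
end

theorem mainTheorem6 (n : ℕ) [NeZero n] (m : ℝ) {M : Type*} [TopologicalSpace M] [T2Space M]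
    [SecondCountableTopology M] [ChartedSpace (EuclideanHalfSpace n) M] [IsManifold (𝓡∂ n) ∞ M]
    (A₀ : WeightedYamabe.SmoothMetricMeasureSpace n m M)
    (X : ∀ p : M, TangentSpace (𝓡∂ n) p)
    (hX : ContMDiff (𝓡∂ n) (𝓡∂ n).tangent ∞ (fun p => (⟨p, X p⟩ : TangentBundle (𝓡∂ n) M)))
    (hXc : WeightedYamabe.IsCompleteField X)
    (lam : ℝ) (hsol : A₀.IsYamabeSoliton X lam) :
    ∃ (A : ℝ → WeightedYamabe.SmoothMetricMeasureSpace n m M)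
      (ψ : ℝ → M ≃ₘ^∞⟮𝓡∂ n, 𝓡∂ n⟯ M)
      (Y : ℝ → ∀ p : M, TangentSpace (𝓡∂ n) p),
      -- the family solves the flow for all `t` with `σ(t) = 1 - λ t > 0`, from the given data
      WeightedYamabe.SmoothMetricMeasureSpace.IsYamabeFlow A {t : ℝ | 0 < 1 - lam * t} ∧
      A 0 = A₀ ∧ ψ 0 = Diffeomorph.refl (𝓡∂ n) M ∞ ∧ Y 0 = X ∧
      -- `ψ` is a smooth family, generated by `X(t) = X / σ(t)`
      ContMDiffOn (𝓘(ℝ, ℝ).prod (𝓡∂ n)) (𝓡∂ n) ∞ (fun x : ℝ × M => ψ x.1 x.2)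
        ({t : ℝ | 0 < 1 - lam * t} ×ˢ univ) ∧
      ∀ t : ℝ, 0 < 1 - lam * t → ∀ p : M,
        Y t p = (1 - lam * t)⁻¹ • X p ∧
        HasMFDerivAt 𝓘(ℝ, ℝ) (𝓡∂ n) (fun s => ψ s p) t
          ((1 : ℝ →L[ℝ] ℝ).smulRight (Y t (ψ t p))) ∧
        -- `g(t) = σ(t) ψ_t^* g₀` and `φ(t) = ψ_t^* φ₀ - (m/2) log σ(t)`
        (∀ u v : TangentSpace (𝓡∂ n) p, (A t).g.inner p u v =
          (1 - lam * t) * A₀.g.inner (ψ t p)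
            (mfderiv (𝓡∂ n) (𝓡∂ n) (ψ t) p u) (mfderiv (𝓡∂ n) (𝓡∂ n) (ψ t) p v)) ∧
        (A t).φ p = A₀.φ (ψ t p) - m / 2 * Real.log (1 - lam * t) ∧
        -- `X(t) = σ(t)⁻¹ ψ_t^* X`
        Y t p = (1 - lam * t)⁻¹ • VectorField.mpullback (𝓡∂ n) (𝓡∂ n) (ψ t) X p := by
  choose γ hγ0 hγ using hXc
  have hθ : ManifoldFlow.IsFlow (fun t p => γ p t) X := ⟨hγ0, hγ⟩
  -- Since τ' = 1/σ, running the flow of `X` for time τ(t) makes the family be generated by X /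
  -- σ(t).
  let ψ : ℝ → M ≃ₘ^∞⟮𝓡∂ n, 𝓡∂ n⟯ M := fun t => hθ.diffeomorph hX (WeightedYamabe.solitonTime lam t)
  let A : ℝ → WeightedYamabe.SmoothMetricMeasureSpace n m M := fun t =>
    -- Where σ(t) ≤ 0 the rescaled form is not a metric; `A₀` is an arbitrary default there.
    if h : 0 < 1 - lam * t then A₀.pullback (ψ t) h else A₀
  have hA : ∀ {t : ℝ} (h : 0 < 1 - lam * t), A t = A₀.pullback (ψ t) h := fun h => dif_pos h
  have hψ0 : ψ 0 = Diffeomorph.refl (𝓡∂ n) M ∞ := by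
    ext p
    change γ p (WeightedYamabe.solitonTime lam 0) = p
    rw [WeightedYamabe.solitonTime_zero, hγ0]
  have hg : ∀ {t : ℝ}, 0 < 1 - lam * t → ∀ (p : M) (u v : TangentSpace (𝓡∂ n) p),
      (A t).g.inner p u v = (1 - lam * t) * A₀.g.inner (ψ t p)
        (mfderiv (𝓡∂ n) (𝓡∂ n) (ψ t) p u) (mfderiv (𝓡∂ n) (𝓡∂ n) (ψ t) p v) := by
    intro t ht p u v
    rw [hA ht]
    rfl
  have hφ : ∀ {t : ℝ}, 0 < 1 - lam * t → ∀ p : M,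
      (A t).φ p = A₀.φ (ψ t p) - m / 2 * Real.log (1 - lam * t) := by
    intro t ht p
    rw [hA ht]
    rfl
  refine ⟨A, ψ, fun t p => (1 - lam * t)⁻¹ • X p, ⟨?_, ?_, ?_⟩, ?_, hψ0, ?_, ?_,
    fun t ht p => ⟨rfl, ?_, hg ht p, hφ ht p, ?_⟩⟩
  · intro t ht p u v
    have ht' : 0 < 1 - lam * t := ht
    -- The chain rule gives ∂_t(ψ_t^*g₀) = σ⁻¹ ψ_t^*(L_X g₀), and the soliton equation replaces L_X
    -- g₀ by (λ - R)g₀. In the derivative of σ ψ_t^*g₀ the terms with λ cancel.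
    have h1 := (WeightedYamabe.hasDerivAt_metric_flow hθ hX A₀.g p u v
      (WeightedYamabe.solitonTime lam t)).comp t
      (WeightedYamabe.hasDerivAt_solitonTime ht')
    rw [← hsol.metric_eq] at h1
    have h2 := (WeightedYamabe.hasDerivAt_one_sub_mul lam t).mul h1
    refine (h2.congr_of_eventuallyEq
      ((WeightedYamabe.eventually_pos_one_sub_mul ht').mono fun s hs => hg hs p u v)).congr_deriv ?_
    rw [hg ht', hA ht', WeightedYamabe.SmoothMetricMeasureSpace.scalarCurv_pullback]
    change -lam * A₀.g.inner (ψ t p) (mfderiv (𝓡∂ n) (𝓡∂ n) (ψ t) p u)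
        (mfderiv (𝓡∂ n) (𝓡∂ n) (ψ t) p v) + (1 - lam * t) *
        ((lam - A₀.scalarCurv (ψ t p)) * A₀.g.inner (ψ t p)
          (mfderiv (𝓡∂ n) (𝓡∂ n) (ψ t) p u) (mfderiv (𝓡∂ n) (𝓡∂ n) (ψ t) p v) *
          (1 - lam * t)⁻¹) = _
    field_simp
    ring
  · intro t ht p
    have ht' : 0 < 1 - lam * t := ht
    have h1 := (WeightedYamabe.hasDerivAt_fun_flow hθ A₀.contMDiff_φ p
      (WeightedYamabe.solitonTime lam t)).comp t
      (WeightedYamabe.hasDerivAt_solitonTime ht')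
    rw [hsol.φ_eq] at h1
    -- Differentiating -(m/2) log σ contributes (m/2)λ/σ, which cancels the λ in the soliton
    -- equation for φ₀.
    have h2 := h1.sub (((WeightedYamabe.hasDerivAt_one_sub_mul lam t).log ht'.ne').const_mul (m / 2))
    refine (h2.congr_of_eventuallyEq
      ((WeightedYamabe.eventually_pos_one_sub_mul ht').mono fun s hs => hφ hs p)).congr_deriv ?_
    rw [hA ht', WeightedYamabe.SmoothMetricMeasureSpace.scalarCurv_pullback]
    change m / 2 * (A₀.scalarCurv (ψ t p) - lam) * (1 - lam * t)⁻¹ -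
      m / 2 * (-lam / (1 - lam * t)) = m / 2 * ((1 - lam * t)⁻¹ * A₀.scalarCurv (ψ t p))
    field_simp
    ring
  · intro t ht p hp
    rw [hA ht, WeightedYamabe.SmoothMetricMeasureSpace.meanCurv_pullback _ _ _ hp,
      hsol.meanCurv_eq, mul_zero]
    exact (((ψ t).isLocalDiffeomorph p).isBoundaryPoint_iff (by simp)).1 hp
  · have h0 : 0 < 1 - lam * 0 := by simp
    rw [hA h0]
    exact A₀.pullback_refl hψ0 h0 (by simp)
  · funext p
    simp
  · have h1 : ContMDiffOn (𝓘(ℝ, ℝ).prod (𝓡∂ n)) 𝓘(ℝ, ℝ) ∞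
        (fun x : ℝ × M => WeightedYamabe.solitonTime lam x.1) ({t : ℝ | 0 < 1 - lam * t} ×ˢ univ) :=
      (WeightedYamabe.contDiffOn_solitonTime lam).contMDiffOn.comp contMDiffOn_fst fun x hx => hx.1
    exact (hθ.contMDiff hX).comp_contMDiffOn (h1.prodMk contMDiffOn_snd)
  · have h1 : HasMFDerivAt 𝓘(ℝ, ℝ) 𝓘(ℝ, ℝ) (WeightedYamabe.solitonTime lam) t
        ((1 : ℝ →L[ℝ] ℝ).smulRight ((1 - lam * t)⁻¹ : ℝ)) :=
      (WeightedYamabe.hasDerivAt_solitonTime ht).hasFDerivAt.hasMFDerivAt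
    have h2 := (hθ.integralCurve p (WeightedYamabe.solitonTime lam t)).comp t h1
    have h3 : ((1 : ℝ →L[ℝ] ℝ).smulRight (X (ψ t p) : WeightedYamabe.Coord n)) ∘L
        ((1 : ℝ →L[ℝ] ℝ).smulRight ((1 - lam * t)⁻¹ : ℝ)) =
        (1 : ℝ →L[ℝ] ℝ).smulRight ((1 - lam * t)⁻¹ • X (ψ t p) : WeightedYamabe.Coord n) := by
      ext
      simp
    rw [← h3]
    exact h2
  -- Invariance of `X` under its flow says Dψ_t(X) = X ∘ ψ_t; applying the inverse of Dψ_t shows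
  -- ψ_t^*X = X.
  · have h1 := hθ.mfderiv_apply hX (WeightedYamabe.solitonTime lam t) p
    let D : WeightedYamabe.Coord n →L[ℝ] WeightedYamabe.Coord n := mfderiv (𝓡∂ n) (𝓡∂ n) (ψ t) p
    have h2 : D (X p : WeightedYamabe.Coord n) = (X (ψ t p) : WeightedYamabe.Coord n) := h1
    have h3 : D.inverse (X (ψ t p) : WeightedYamabe.Coord n) = (X p : WeightedYamabe.Coord n) := by
      rw [← h2]
      exact (WeightedYamabe.isInvertible_mfderiv (ψ t) p).inverse_apply_self _
    exact congrArg (fun w : WeightedYamabe.Coord n => (1 - lam * t)⁻¹ • w) h3.symm
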